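/- Let $f:(\mathbb{C}^2,0)\to(\mathbb{C}^2,0)$ be a holomorphic germ that is dominant ($\det(df_p)\not\equiv 0$). Let $\mathcal{C}(f)=\{p : \det(df_p)=0\}$ and $\mathcal{C}^\infty(f)=\bigcup_{n\ge 0}f^{-n}(\mathcal{C}(f))$ (as germs at $0$). Suppose that $f$ is rigid, i.e. $\mathcal{C}^\infty(f)$ is empty or has normal crossings at the origin (in suitable local holomorphic coordinates $(x,y)$ it is $\{x=0\}$ or $\{xy=0\}$), and $f(\mathcal{C}^\infty(f))\subseteq\mathcal{C}^\infty(f)$. Suppose also that $f$ is semi-superattracting, i.e. $\operatorname{Spec}(df_0)=\{0,\lambda\}$ with $\lambda\neq 0$. Two formal germs $F,E$ are called formally conjugate if $\Phi\circ F=E\circ\Phi$ for some invertible formal change of coordinates $\Phi\in\mathbb{C}[[z,w]]^2$ fixing the origin. (i) If $|\lambda|<1$, or $\lambda=e^{2\pi i\theta}$ with $\theta\in\mathbb{R}\setminus\mathbb{Q}$, then $f$ is formally conjugate to $$(z,w)\mapsto(\lambda z,\ z^cw^d).$$ (ii) If $|\lambda|>1$, then $f$ is formally conjugate to $$(z,w)\mapsto\big(\lambda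 z,\ z^cw^d(1+\varepsilon z^l)\big),$$ for some integer $l\ge 1$, where $\varepsilon\in\{0,1\}$ if $\lambda^l=d$ (resonant case) and $\varepsilon=0$ otherwise. (iii) If $\lambda$ is a root of unity of exact order $r\ge 1$, then $f$ is formally conjugate to a map of the form $$(z,w)\mapsto\big(\lambda z(1+z^s+\beta z^{2s}),\ z^cw^d(1+\varepsilon(z^r))\big)\quad\text{with } s\ge 1,\ r\mid s,\ \beta\in\mathbb{C},$$ or to a map of the form $$(z,w)\mapsto\big(\lambda z,\ z^cw^d(1+\varepsilon(z^r))\big),$$ where in both cases $\varepsilon\in\mathbb{C}[[t]]$ is a formal power series with $\varepsilon(0)\neq -1$ (a non-zero constant term $\varepsilon(0)$ is allowed), and $\varepsilon\equiv 0$ if $d\ge 2$. In all cases $c,d$ are integers with $c\ge 0$, $d\ge 1$ and $c+d\ge 2$. -/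

import Mathlib

open Filter Topology

noncomputable section

namespace RigidGerm

/-! ### Holomorphic germs at the origin of the complex plane

A holomorphic germ is given by a representative `f : ℂ × ℂ → ℂ × ℂ`, analytic at the origin and fixing it.
All notions below depend only on the values of `f` near the origin. Germs of subsets are compared by
`≤ᶠ[𝓝 0]` (inclusion) and `=ᶠ[𝓝 0]` (equality). -/

/-- The Jacobian determinant `det (df_p)`. -/
def jac (f : ℂ × ℂ → ℂ × ℂ) (p : ℂ × ℂ) : ℂ :=
  (fderiv ℂ f p).det

/-- `f` represents a holomorphic germ `(ℂ², 0) → (ℂ², 0)`. -/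
structure IsHolomorphicGerm (f : ℂ × ℂ → ℂ × ℂ) : Prop where
  analyticAt : AnalyticAt ℂ f 0
  map_zero : f 0 = 0

/-- `f` is dominant: `det (df_p)` does not vanish identically near the origin. -/
def IsDominant (f : ℂ × ℂ → ℂ × ℂ) : Prop :=
  ¬ ∀ᶠ p in 𝓝 (0 : ℂ × ℂ), jac f p = 0

/-- The critical set `C(f)`. -/
def critSet (f : ℂ × ℂ → ℂ × ℂ) : Set (ℂ × ℂ) :=
  {p | jac f p = 0}

/-- The germ of `V` at the origin is the generalized critical set, the union over all `n ≥ 0` of the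
germs `f⁻ⁿ(C(f))`. The union is taken in the sense of germs: `V` contains each of
these germs and is covered by finitely many of them (a curve has finitely many branches, so
it is the union of a sequence of germs of analytic sets exactly when it is the union of finitely many of them
and contains all the others). -/
def IsGenCritSet (f : ℂ × ℂ → ℂ × ℂ) (V : Set (ℂ × ℂ)) : Prop :=
  (∀ n : ℕ, (f^[n] ⁻¹' critSet f : Set (ℂ × ℂ)) ≤ᶠ[𝓝 0] V) ∧
    ∃ N : ℕ, V ≤ᶠ[𝓝 0] (⋃ n ≤ N, f^[n] ⁻¹' critSet f : Set (ℂ × ℂ))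

/-- `ψ` is a system of local holomorphic coordinates centred at the origin. -/
structure IsLocalCoord (ψ : ℂ × ℂ → ℂ × ℂ) : Prop where
  analyticAt : AnalyticAt ℂ ψ 0
  map_zero : ψ 0 = 0
  jac_ne_zero : jac ψ 0 ≠ 0

/-- The germ of `V` at the origin is empty or has normal crossings: in suitable local holomorphic coordinates
`(x, y)` it is `{x = 0}` or `{x y = 0}`. -/
def IsEmptyOrNormalCrossings (V : Set (ℂ × ℂ)) : Prop :=
  V =ᶠ[𝓝 0] (∅ : Set (ℂ × ℂ)) ∨
    ∃ ψ : ℂ × ℂ → ℂ × ℂ, IsLocalCoord ψ ∧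
      (V =ᶠ[𝓝 0] {p : ℂ × ℂ | (ψ p).1 = 0} ∨
        V =ᶠ[𝓝 0] {p : ℂ × ℂ | (ψ p).1 * (ψ p).2 = 0})

/-- Rigid germs: dominant holomorphic germs whose generalized critical set is empty or
has normal crossings, and is forward invariant. -/
structure IsRigid (f : ℂ × ℂ → ℂ × ℂ) : Prop where
  holomorphic : IsHolomorphicGerm f
  dominant : IsDominant f
  genCritSet : ∃ V : Set (ℂ × ℂ), IsGenCritSet f V ∧ IsEmptyOrNormalCrossings V ∧
    ∀ᶠ p in 𝓝 (0 : ℂ × ℂ), p ∈ V → f p ∈ V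

/-- `f` is semi-superattracting with non-zero eigenvalue `lam`: `Spec(df_0) = {0, lam}`, `lam ≠ 0`. -/
def IsSemiSuperattracting (f : ℂ × ℂ → ℂ × ℂ) (lam : ℂ) : Prop :=
  lam ≠ 0 ∧ spectrum ℂ (fderiv ℂ f 0) = {0, lam}

/-! ### Formal germs -/

/-- Pairs of formal power series in the two variables `z = X 0`, `w = X 1`. -/
abbrev FormalMap := Fin 2 → MvPowerSeries (Fin 2) ℂ

/-- Composition `F ∘ G` (meaningful when `G` has no constant terms). -/
def FormalMap.comp (F G : FormalMap) : FormalMap :=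
  fun i => (F i).subst G

/-- `Φ` is an invertible formal change of coordinates fixing the origin: it has no constant terms
and its linear part is invertible. -/
structure IsFormalCoord (Φ : FormalMap) : Prop where
  constantCoeff_eq_zero : ∀ i, MvPowerSeries.constantCoeff (Φ i) = 0
  det_ne_zero :
    (Matrix.of fun i j : Fin 2 => MvPowerSeries.coeff (Finsupp.single j 1) (Φ i)).det ≠ 0

/-- The formal germs `F` and `E` are formally conjugate: `Φ ∘ F = E ∘ Φ` for an invertible formal `Φ`. -/
def FormallyConj (F E : FormalMap) : Prop :=
  ∃ Φ : FormalMap, IsFormalCoord Φ ∧ Φ.comp F = E.comp Φ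

/-- The Taylor coefficient `∂_z^i ∂_w^j g (0) / (i! j!)` of a function `g` of two complex variables `(z, w)`. -/
def taylorCoeff (g : ℂ × ℂ → ℂ) (i j : ℕ) : ℂ :=
  iteratedFDeriv ℂ (i + j) g 0
      (fun k : Fin (i + j) => if k.val < i then ((1, 0) : ℂ × ℂ) else (0, 1)) /
    (i.factorial * j.factorial : ℂ)

/-- The Taylor series at the origin of a function of two complex variables. -/
def taylorSeries (g : ℂ × ℂ → ℂ) : MvPowerSeries (Fin 2) ℂ :=
  fun n => taylorCoeff g (n 0) (n 1)

/-- The formal germ of a holomorphic germ, i.e. the Taylor series of its two components. -/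
def toFormal (f : ℂ × ℂ → ℂ × ℂ) : FormalMap :=
  ![taylorSeries fun p => (f p).1, taylorSeries fun p => (f p).2]

/-- The variable `z`. -/
abbrev zVar : MvPowerSeries (Fin 2) ℂ := MvPowerSeries.X 0

/-- The variable `w`. -/
abbrev wVar : MvPowerSeries (Fin 2) ℂ := MvPowerSeries.X 1

/-- A complex constant as a power series. -/
abbrev const (a : ℂ) : MvPowerSeries (Fin 2) ℂ := MvPowerSeries.C a

end RigidGerm

end

/-!
Write `z = X 0`, `w = X 1`. A rigid semi-superattracting germ is brought into coordinates in which
its Jacobian determinant is a monomial `z ^ a w ^ b` times a unit (`IsRigid.exists_hasMonomialJac`);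
from there on the argument is formal.

*Monomial Jacobian.* Straighten the generalized critical set to `{x = 0}` or `{x y = 0}`. The
critical set is contained in it and it is totally invariant, so the Jacobian determinant vanishes on
the coordinate axes only. An analytic function whose zeros lie on the axes is a monomial times a
unit (`exists_taylorSeries_eq_monomial_mul`): after division by the largest monomial, a remaining
zero at the origin would be isolated, and the minimum modulus principle on discs `{x} × {|y| ≤ δ}`
excludes isolated zeros. For `{x y = 0}`, invariance leaves the possibility that both axes are
mapped into one of them. Then the other component of the germ vanishes only on the axes, hence is a
monomial up to a unit too, and its linear term, which carries the eigenvalue `lam`, shows that the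
axis is in fact preserved. If the axes are interchanged, the trace of the linear part is zero, not
`lam`.

*Monomial second component.* Diagonalize the linear part to `(lam z, 0)` and apply Poincaré–Dulac
(`exists_resonant_form`): the first component becomes a series in `z` alone with exponents `i` such
that `lam ^ i = lam`, and the second a multiple of `w`. The critical axes remain invariant
(`X_zero_dvd_conj`, `X_one_dvd_conj`), so the Jacobian determinant is still monomial. It equals a
unit times the `w`-derivative of the second component, which is therefore `z ^ a w ^ (b + 1)` times
a unit `v`. Thus `c = a`, `d = b + 1`, and `c + d ≥ 2` because the determinant vanishes at the
origin.

*The unit.* The substitution `w ↦ w U` replaces `v` by a series in `z` in which, besides the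
constant term, only exponents `i` with `lam ^ i = d` occur (`exists_resonant_unit`). A diagonal
linear map then normalizes the remaining coefficients. If `|lam| < 1` or `lam` is an irrational
rotation there is no resonance, and if `|lam| > 1` at most one; in these cases `lam ^ i = lam` holds
for `i = 1` only, so that the first component is linear. If `lam` is a root of unity of order `r`,
there are none for `d ≥ 2`, and the exponents are the multiples of `r` for `d = 1`.

*Roots of unity.* In this case the first component is `lam z Γ(z ^ r)`, which is reduced first to
`lam z` or `lam z (1 + z ^ s + β z ^ (2 s))` by the one-variable normal form of parabolic germs
(`exists_parabolic_form`); the change of variable depends on `z` only and keeps the second component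
monomial up to a unit.

Taylor series are handled through asymptotic expansions (`HasExpansion`), for which composition and
uniqueness are elementary. Formal equations are solved by successive approximation (`exists_limit`).
-/

noncomputable section

namespace RigidGerm
open MvPowerSeries

/-! ### Power series and substitution -/

/-- The ring of formal power series in `z` and `w`. -/
abbrev Series := MvPowerSeries (Fin 2) ℂ

/-- The ideal of power series of order at least `n`. -/
def ordIdeal {σ : Type*} (n : ℕ) : Ideal (MvPowerSeries σ ℂ) where
  carrier := {s | (n : ℕ∞) ≤ s.order}
  add_mem' ha hb := (le_min ha hb).trans min_order_le_add
  zero_mem' := by simp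
  smul_mem' c s hs := by
    simp only [Set.mem_ofPred_eq, smul_eq_mul] at *
    exact (hs.trans le_add_self).trans le_order_mul

variable {σ : Type*}

theorem mem_ordIdeal {n : ℕ} {s : MvPowerSeries σ ℂ} :
    s ∈ ordIdeal n ↔ (n : ℕ∞) ≤ s.order := Iff.rfl

theorem mem_ordIdeal_iff {n : ℕ} {s : MvPowerSeries σ ℂ} :
    s ∈ ordIdeal n ↔ ∀ d : σ →₀ ℕ, d.degree < n → coeff d s = 0 :=
  ⟨fun h _ hd => coeff_of_lt_order ((Nat.cast_lt.2 hd).trans_le h), fun h => nat_le_order h⟩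

theorem ordIdeal_anti {m n : ℕ} (h : m ≤ n) :
    (ordIdeal n : Ideal (MvPowerSeries σ ℂ)) ≤ ordIdeal m :=
  fun _ hs => (Nat.cast_le.2 h).trans (mem_ordIdeal.1 hs)

theorem mem_ordIdeal_zero (s : MvPowerSeries σ ℂ) : s ∈ ordIdeal 0 := by simp [mem_ordIdeal]

theorem mem_ordIdeal_one {s : MvPowerSeries σ ℂ} : s ∈ ordIdeal 1 ↔ constantCoeff s = 0 := by
  rw [mem_ordIdeal, Nat.cast_one, one_le_order_iff_constCoeff_eq_zero]

theorem mul_mem_ordIdeal {m n : ℕ} {s t : MvPowerSeries σ ℂ} (hs : s ∈ ordIdeal m)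
    (ht : t ∈ ordIdeal n) : s * t ∈ ordIdeal (m + n) := by
  rw [mem_ordIdeal] at *
  push_cast
  exact (add_le_add hs ht).trans le_order_mul

theorem X_mem_ordIdeal (i : Fin 2) : (X i : Series) ∈ ordIdeal 1 := by
  simp [mem_ordIdeal_one]

theorem eq_zero_of_forall_mem_ordIdeal {s : MvPowerSeries σ ℂ}
    (h : ∀ n, s ∈ ordIdeal n) : s = 0 := by
  ext d
  exact mem_ordIdeal_iff.1 (h (d.degree + 1)) d (Nat.lt_succ_self _)

theorem coeff_add_single_X_mul (i : Fin 2) (d : Fin 2 →₀ ℕ) (s : Series) :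
    coeff (d + Finsupp.single i 1) (X i * s) = coeff d s := by
  rw [X_def, mul_comm, coeff_add_mul_monomial, mul_one]

theorem mem_ordIdeal_of_X_mul_mem {i : Fin 2} {n : ℕ} {s : Series}
    (h : X i * s ∈ ordIdeal (n + 1)) : s ∈ ordIdeal n := by
  rw [mem_ordIdeal_iff] at *
  intro d hd
  rw [← coeff_add_single_X_mul i]
  apply h
  simpa using hd

/-- A power series without constant term is a combination of the variables, and the order of the
coefficients drops by at most one. -/
theorem exists_eq_X_mul_add (s : Series) (hs : constantCoeff s = 0) :
    ∃ s₀ s₁ : Series, s = X 0 * s₀ + X 1 * s₁ ∧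
      ∀ n, s ∈ ordIdeal (n + 1) → s₀ ∈ ordIdeal n ∧ s₁ ∈ ordIdeal n := by
  let s₁ : Series := fun d => if d 0 = 0 then coeff (d + Finsupp.single 1 1) s else 0
  have c₁ : ∀ d, coeff d s₁ = if d 0 = 0 then coeff (d + Finsupp.single 1 1) s else 0 :=
    fun d => rfl
  have key : (X 0 : Series) ∣ s - X 1 * s₁ := by
    rw [X_dvd_iff]
    intro d hd
    by_cases h1 : d 1 = 0
    · have : d = 0 := by ext i; fin_cases i <;> simp [hd, h1]
      subst this
      simp [hs]
    · obtain ⟨e, rfl⟩ : ∃ e, d = e + Finsupp.single 1 1 :=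
        ⟨d - Finsupp.single 1 1, by ext i; fin_cases i <;> simp; omega⟩
      rw [map_sub, coeff_add_single_X_mul, c₁, if_pos (by simpa using hd), sub_self]
  obtain ⟨s₀, h₀⟩ := key
  refine ⟨s₀, s₁, by rw [← h₀]; ring, fun n hn => ?_⟩
  have h₁ : s₁ ∈ ordIdeal n := by
    rw [mem_ordIdeal_iff] at *
    intro d hd
    rw [c₁]
    split_ifs
    · apply hn
      simpa using hd
    · rfl
  refine ⟨mem_ordIdeal_of_X_mul_mem (i := 0) ?_, h₁⟩
  rw [← h₀]
  refine sub_mem hn ?_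
  rw [add_comm]
  exact mul_mem_ordIdeal (X_mem_ordIdeal 1) h₁

/-- Every power series is its constant term plus a combination of the variables. -/
theorem exists_eq_C_add (s : Series) :
    ∃ s₀ s₁ : Series, s = C (constantCoeff s) + (X 0 * s₀ + X 1 * s₁) := by
  obtain ⟨s₀, s₁, h, -⟩ := exists_eq_X_mul_add (s - C (constantCoeff s)) (by simp)
  exact ⟨s₀, s₁, by rw [← h]; ring⟩

/-- A formal map without constant terms, i.e. a formal germ fixing the origin. -/
def FormalMap.IsCentered (Φ : FormalMap) : Prop := ∀ i, constantCoeff (Φ i) = 0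

theorem FormalMap.IsCentered.hasSubst {Φ : FormalMap} (h : Φ.IsCentered) : HasSubst Φ :=
  hasSubst_of_constantCoeff_zero h

theorem FormalMap.IsCentered.mem {Φ : FormalMap} (h : Φ.IsCentered) (i : Fin 2) :
    Φ i ∈ ordIdeal 1 := mem_ordIdeal_one.2 (h i)

theorem isCentered_X : FormalMap.IsCentered X := fun i => by simp

variable {Φ Ψ : FormalMap}

theorem FormalMap.IsCentered.subst_X (hΦ : Φ.IsCentered) (i : Fin 2) :
    subst Φ (X i : Series) = Φ i := MvPowerSeries.subst_X hΦ.hasSubst i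

theorem FormalMap.IsCentered.subst_zero (hΦ : Φ.IsCentered) : subst Φ (0 : Series) = 0 := by
  rw [← coe_substAlgHom hΦ.hasSubst, map_zero]

theorem FormalMap.IsCentered.subst_one (hΦ : Φ.IsCentered) : subst Φ (1 : Series) = 1 := by
  rw [← coe_substAlgHom hΦ.hasSubst, map_one]

theorem subst_C_add (hΦ : Φ.IsCentered) (a : ℂ) (s₀ s₁ : Series) :
    subst Φ (C a + (X 0 * s₀ + X 1 * s₁)) =
      C a + (Φ 0 * subst Φ s₀ + Φ 1 * subst Φ s₁) := by
  have h := hΦ.hasSubst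
  simp [subst_add h, subst_mul h, subst_X h, subst_C]

theorem subst_X_mul_add (hΦ : Φ.IsCentered) (s₀ s₁ : Series) :
    subst Φ (X 0 * s₀ + X 1 * s₁) = Φ 0 * subst Φ s₀ + Φ 1 * subst Φ s₁ := by
  have h := hΦ.hasSubst
  simp [subst_add h, subst_mul h, hΦ.subst_X]

theorem constantCoeff_subst_of_isCentered (hΦ : Φ.IsCentered) (s : Series) :
    constantCoeff (subst Φ s) = constantCoeff s := by
  obtain ⟨s₀, s₁, h⟩ := exists_eq_C_add s
  conv_lhs => rw [h, subst_C_add hΦ]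
  simp [hΦ 0, hΦ 1]

theorem FormalMap.IsCentered.comp (hΨ : Ψ.IsCentered) (hΦ : Φ.IsCentered) :
    (Ψ.comp Φ).IsCentered := fun i => by
  rw [FormalMap.comp, constantCoeff_subst_of_isCentered hΦ, hΨ i]

theorem subst_subst (hΨ : Ψ.IsCentered) (hΦ : Φ.IsCentered) (s : Series) :
    subst Φ (subst Ψ s) = subst (Ψ.comp Φ) s :=
  subst_comp_subst_apply hΨ.hasSubst hΦ.hasSubst s

theorem FormalMap.comp_assoc {Θ : FormalMap} (hΨ : Ψ.IsCentered) (hΦ : Φ.IsCentered) :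
    (Θ.comp Ψ).comp Φ = Θ.comp (Ψ.comp Φ) :=
  funext fun i => subst_subst hΨ hΦ (Θ i)

theorem subst_X_eq (s : Series) : subst (X : FormalMap) s = s := by
  rw [subst_self]; rfl

theorem subst_mem_ordIdeal (hΦ : Φ.IsCentered) {n : ℕ} {s : Series} (hs : s ∈ ordIdeal n) :
    subst Φ s ∈ ordIdeal n := by
  induction n generalizing s with
  | zero => exact mem_ordIdeal_zero _
  | succ n ih =>
    obtain ⟨s₀, s₁, h, h'⟩ := exists_eq_X_mul_add s
      (mem_ordIdeal_one.1 (ordIdeal_anti (Nat.le_add_left 1 n) hs))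
    rw [h, subst_X_mul_add hΦ, add_comm n]
    exact add_mem (mul_mem_ordIdeal (hΦ.mem 0) (ih (h' n hs).1))
      (mul_mem_ordIdeal (hΦ.mem 1) (ih (h' n hs).2))

theorem subst_sub_subst_mem (hΦ : Φ.IsCentered) (hΨ : Ψ.IsCentered) {n : ℕ}
    (h : ∀ i, Φ i - Ψ i ∈ ordIdeal n) (s : Series) : subst Φ s - subst Ψ s ∈ ordIdeal n := by
  suffices H : ∀ k ≤ n, ∀ s : Series, subst Φ s - subst Ψ s ∈ ordIdeal k from H n le_rfl s
  intro k
  induction k with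
  | zero => exact fun _ s => mem_ordIdeal_zero _
  | succ k ih =>
    intro hk s
    obtain ⟨s₀, s₁, hs⟩ := exists_eq_C_add s
    rw [hs, subst_C_add hΦ, subst_C_add hΨ]
    have e : C (constantCoeff s) + (Φ 0 * subst Φ s₀ + Φ 1 * subst Φ s₁) -
        (C (constantCoeff s) + (Ψ 0 * subst Ψ s₀ + Ψ 1 * subst Ψ s₁)) =
        (Φ 0 - Ψ 0) * subst Φ s₀ + (Φ 1 - Ψ 1) * subst Φ s₁ +
        (Ψ 0 * (subst Φ s₀ - subst Ψ s₀) + Ψ 1 * (subst Φ s₁ - subst Ψ s₁)) := by ring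
    rw [e]
    have ih' := ih (by omega)
    refine add_mem (ordIdeal_anti hk (add_mem (Ideal.mul_mem_right _ _ (h 0))
      (Ideal.mul_mem_right _ _ (h 1)))) ?_
    rw [add_comm k]
    exact add_mem (mul_mem_ordIdeal (hΨ.mem 0) (ih' s₀)) (mul_mem_ordIdeal (hΨ.mem 1) (ih' s₁))

/-- A series of order `n + 1` gains `n` orders of agreement from the maps substituted into it. -/
theorem subst_sub_subst_mem_of_mem (hΦ : Φ.IsCentered) (hΨ : Ψ.IsCentered) {m n : ℕ}
    (h : ∀ i, Φ i - Ψ i ∈ ordIdeal (m + 1)) {s : Series} (hs : s ∈ ordIdeal n) :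
    subst Φ s - subst Ψ s ∈ ordIdeal (m + n) := by
  induction n generalizing s with
  | zero => exact ordIdeal_anti (Nat.le_succ m) (subst_sub_subst_mem hΦ hΨ h s)
  | succ n ih =>
    obtain ⟨s₀, s₁, e, h'⟩ := exists_eq_X_mul_add s
      (mem_ordIdeal_one.1 (ordIdeal_anti (Nat.le_add_left 1 n) hs))
    obtain ⟨h₀, h₁⟩ := h' n hs
    rw [e, subst_X_mul_add hΦ, subst_X_mul_add hΨ]
    have e : (Φ 0 * subst Φ s₀ + Φ 1 * subst Φ s₁) - (Ψ 0 * subst Ψ s₀ + Ψ 1 * subst Ψ s₁) =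
        ((Φ 0 - Ψ 0) * subst Φ s₀ + (Φ 1 - Ψ 1) * subst Φ s₁) +
        (Ψ 0 * (subst Φ s₀ - subst Ψ s₀) + Ψ 1 * (subst Φ s₁ - subst Ψ s₁)) := by ring
    rw [e]
    refine add_mem ?_ ?_
    · rw [show m + (n + 1) = m + 1 + n by ring]
      exact add_mem (mul_mem_ordIdeal (h 0) (subst_mem_ordIdeal hΦ h₀))
        (mul_mem_ordIdeal (h 1) (subst_mem_ordIdeal hΦ h₁))
    · rw [show m + (n + 1) = 1 + (m + n) by ring]
      exact add_mem (mul_mem_ordIdeal (hΨ.mem 0) (ih h₀)) (mul_mem_ordIdeal (hΨ.mem 1) (ih h₁))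

/-- Successive approximation: if approximate solutions of order `n` can be corrected to approximate
solutions of order `n + 1` by terms of order `n`, then there is a family of power series
approximated to every order by them. -/
theorem exists_limit {ι : Type*} (P : ℕ → (ι → MvPowerSeries σ ℂ) → Prop)
    (step : ∀ n u, P n u → ∃ u', P (n + 1) u' ∧ ∀ i, u' i - u i ∈ ordIdeal n)
    (u₀ : ι → MvPowerSeries σ ℂ) (h₀ : P 0 u₀) :
    ∃ L : ι → MvPowerSeries σ ℂ, ∀ n, ∃ u, P n u ∧ ∀ i, L i - u i ∈ ordIdeal n := by
  classical
  choose! nxt hP hd using step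
  let seq : ℕ → ι → MvPowerSeries σ ℂ := fun n => Nat.rec u₀ (fun n u => nxt n u) n
  have hseq : ∀ n, P n (seq n) := fun n => by
    induction n with
    | zero => exact h₀
    | succ n ih => exact hP n _ ih
  have hstep : ∀ n i, seq (n + 1) i - seq n i ∈ ordIdeal n := fun n i => hd n _ (hseq n) i
  have hmono : ∀ n k i, seq (n + k) i - seq n i ∈ ordIdeal n := fun n k i => by
    induction k with
    | zero => simp
    | succ k ih =>
      have := add_mem (ordIdeal_anti (Nat.le_add_right n k) (hstep (n + k) i)) ih
      simpa [add_assoc] using this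
  let L : ι → MvPowerSeries σ ℂ := fun i d => coeff d (seq (d.degree + 1) i)
  have hL : ∀ i d, coeff d (L i) = coeff d (seq (d.degree + 1) i) := fun _ _ => rfl
  refine ⟨L, fun n => ⟨seq n, hseq n, fun i => ?_⟩⟩
  rw [mem_ordIdeal_iff]
  intro d hdn
  obtain ⟨k, rfl⟩ := Nat.exists_eq_add_of_le (Nat.succ_le_of_lt hdn)
  have := mem_ordIdeal_iff.1 (hmono (d.degree + 1) k i) d (Nat.lt_succ_self _)
  rw [map_sub, sub_eq_zero] at this ⊢
  rw [hL]
  exact this.symm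

/-- Coefficients after substitution of a diagonal linear map. -/
theorem coeff_subst_diag (α β : ℂ) (s : Series) (d : Fin 2 →₀ ℕ) :
    coeff d (subst (![C α * X 0, C β * X 1] : FormalMap) s) = α ^ d 0 * β ^ d 1 * coeff d s := by
  have : (![C α * X 0, C β * X 1] : FormalMap) = (![α, β] : Fin 2 → ℂ) • (X : FormalMap) := by
    funext i; fin_cases i <;> simp [smul_eq_C_mul]
  rw [this, ← rescale_eq_subst, coeff_rescale, Finsupp.prod_fintype _ _ (by simp)]
  simp

/-- The chain rule for formal partial derivatives. -/
theorem pderiv_subst (hΦ : Φ.IsCentered) (i : Fin 2) (s : Series) :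
    pderiv ℂ i (subst Φ s) = subst Φ (pderiv ℂ 0 s) * pderiv ℂ i (Φ 0) +
      subst Φ (pderiv ℂ 1 s) * pderiv ℂ i (Φ 1) := by
  rw [← sub_eq_zero]
  apply eq_zero_of_forall_mem_ordIdeal
  intro n
  induction n generalizing s with
  | zero => exact mem_ordIdeal_zero _
  | succ n ih =>
    obtain ⟨s₀, s₁, hs⟩ := exists_eq_C_add s
    have h := hΦ.hasSubst
    have e : pderiv ℂ i (subst Φ s) - (subst Φ (pderiv ℂ 0 s) * pderiv ℂ i (Φ 0) +
        subst Φ (pderiv ℂ 1 s) * pderiv ℂ i (Φ 1)) =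
        Φ 0 * (pderiv ℂ i (subst Φ s₀) - (subst Φ (pderiv ℂ 0 s₀) * pderiv ℂ i (Φ 0) +
          subst Φ (pderiv ℂ 1 s₀) * pderiv ℂ i (Φ 1))) +
        Φ 1 * (pderiv ℂ i (subst Φ s₁) - (subst Φ (pderiv ℂ 0 s₁) * pderiv ℂ i (Φ 0) +
          subst Φ (pderiv ℂ 1 s₁) * pderiv ℂ i (Φ 1))) := by
      conv_lhs => rw [hs, subst_C_add hΦ]
      have h01 : pderiv ℂ (0 : Fin 2) (X 1 : Series) = 0 := pderiv_X_of_ne (by decide)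
      have h10 : pderiv ℂ (1 : Fin 2) (X 0 : Series) = 0 := pderiv_X_of_ne (by decide)
      simp only [map_add, Derivation.leibniz, pderiv_C, pderiv_X_self, h01, h10, smul_eq_mul,
        subst_add h, subst_mul h, hΦ.subst_X]
      simp only [hΦ.subst_one, hΦ.subst_zero]
      ring
    rw [e, add_comm n]
    exact add_mem (mul_mem_ordIdeal (hΦ.mem 0) (ih s₀)) (mul_mem_ordIdeal (hΦ.mem 1) (ih s₁))

end RigidGerm

namespace RigidGerm
open MvPowerSeries

variable {Φ Ψ : FormalMap}

/-! ### Linear parts, inverses and conjugation -/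

/-- The matrix of the linear part of a formal map. -/
def linPart (Φ : FormalMap) : Matrix (Fin 2) (Fin 2) ℂ :=
  Matrix.of fun i j => coeff (Finsupp.single j 1) (Φ i)

theorem linPart_apply (Φ : FormalMap) (i j : Fin 2) :
    linPart Φ i j = coeff (Finsupp.single j 1) (Φ i) := rfl

theorem constantCoeff_pderiv (j : Fin 2) (s : Series) :
    constantCoeff (pderiv ℂ j s) = coeff (Finsupp.single j 1) s := by
  rw [← coeff_zero_eq_constantCoeff_apply, coeff_pderiv]
  simp

theorem linPart_comp (hΦ : Φ.IsCentered) : linPart (Ψ.comp Φ) = linPart Ψ * linPart Φ := by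
  ext i j
  rw [Matrix.mul_apply, Fin.sum_univ_two]
  simp only [linPart_apply, ← constantCoeff_pderiv, FormalMap.comp]
  rw [pderiv_subst hΦ, map_add, map_mul, map_mul, constantCoeff_subst_of_isCentered hΦ,
    constantCoeff_subst_of_isCentered hΦ]

theorem isFormalCoord_iff : IsFormalCoord Φ ↔ Φ.IsCentered ∧ (linPart Φ).det ≠ 0 :=
  ⟨fun h => ⟨h.1, h.2⟩, fun h => ⟨h.1, h.2⟩⟩

theorem IsFormalCoord.isCentered (h : IsFormalCoord Φ) : Φ.IsCentered := h.1

theorem IsFormalCoord.comp (hΨ : IsFormalCoord Ψ) (hΦ : IsFormalCoord Φ) :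
    IsFormalCoord (Ψ.comp Φ) := by
  rw [isFormalCoord_iff] at *
  refine ⟨hΨ.1.comp hΦ.1, ?_⟩
  rw [linPart_comp hΦ.1, Matrix.det_mul]
  exact mul_ne_zero hΨ.2 hΦ.2

/-- A power series is given by its linear part up to second order terms. -/
theorem sub_linear_mem {s : Series} (hs : constantCoeff s = 0) :
    s - (C (coeff (Finsupp.single 0 1) s) * X 0 + C (coeff (Finsupp.single 1 1) s) * X 1) ∈
      ordIdeal 2 := by
  rw [mem_ordIdeal_iff]
  intro d hd
  have h01 : d 0 + d 1 < 2 := by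
    simpa [Finsupp.degree_eq_sum, Fin.sum_univ_two] using hd
  have hcases : d = 0 ∨ d = Finsupp.single 0 1 ∨ d = Finsupp.single 1 1 := by
    rcases (by omega : (d 0 = 0 ∧ d 1 = 0) ∨ (d 0 = 1 ∧ d 1 = 0) ∨ (d 0 = 0 ∧ d 1 = 1)) with
      h | h | h
    · left; ext i; fin_cases i <;> simp [h]
    · right; left; ext i; fin_cases i <;> simp [h]
    · right; right; ext i; fin_cases i <;> simp [h]
  rcases hcases with rfl | rfl | rfl
  · simp [hs]
  · simp [coeff_X, Finsupp.single_left_inj]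
  · simp [coeff_X, Finsupp.single_left_inj]

/-- The linear formal map with matrix `M`. -/
def linMap (M : Matrix (Fin 2) (Fin 2) ℂ) : FormalMap :=
  fun i => C (M i 0) * X 0 + C (M i 1) * X 1

theorem linMap_isCentered (M : Matrix (Fin 2) (Fin 2) ℂ) : (linMap M).IsCentered :=
  fun i => by simp [linMap]

theorem linPart_linMap (M : Matrix (Fin 2) (Fin 2) ℂ) : linPart (linMap M) = M := by
  ext i j
  fin_cases j <;> simp [linMap, linPart_apply, coeff_X, Finsupp.single_left_inj]

theorem sub_linMap_mem (hΦ : Φ.IsCentered) (i : Fin 2) :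
    Φ i - linMap (linPart Φ) i ∈ ordIdeal 2 := sub_linear_mem (hΦ i)

theorem linMap_one : linMap 1 = X := by
  funext i
  rcases Fin.exists_fin_two.1 ⟨i, rfl⟩ with rfl | rfl <;> simp [linMap]

theorem linPart_eq_of_sub_mem (h : ∀ i, Φ i - Ψ i ∈ ordIdeal 2) : linPart Φ = linPart Ψ := by
  ext i j
  have := mem_ordIdeal_iff.1 (h i) (Finsupp.single j 1) (by simp)
  rwa [map_sub, sub_eq_zero] at this

theorem isFormalCoord_of_sub_X_mem (h : ∀ i, Φ i - X i ∈ ordIdeal 2) : IsFormalCoord Φ := by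
  refine isFormalCoord_iff.2 ⟨fun i => ?_, ?_⟩
  · have := mem_ordIdeal_one.1 (ordIdeal_anti one_le_two (h i))
    simpa using this
  · rw [linPart_eq_of_sub_mem h, ← linMap_one, linPart_linMap]
    simp

/-- Substitution of an invertible formal change of coordinates is surjective. -/
theorem IsFormalCoord.exists_subst_eq (hΦ : IsFormalCoord Φ) (s : Series) :
    ∃ t : Series, subst Φ t = s := by
  have hc := hΦ.isCentered
  have hdet : IsUnit (linPart Φ).det := (isFormalCoord_iff.1 hΦ).2.isUnit
  set N := linMap (linPart Φ)⁻¹ with hN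
  have hNc : N.IsCentered := linMap_isCentered _
  have hNΦ : ∀ i, N.comp Φ i - (X : FormalMap) i ∈ ordIdeal 2 := fun i => by
    have h1 := sub_linMap_mem (hNc.comp hc) i
    rwa [linPart_comp hc, hN, linPart_linMap, Matrix.nonsing_inv_mul _ hdet, linMap_one] at h1
  obtain ⟨L, hL⟩ := exists_limit (ι := Unit) (fun n u => s - subst Φ (u ()) ∈ ordIdeal n)
    (fun n u hu => by
      -- the linear substitution `N` inverts `subst Φ` up to terms of higher order
      refine ⟨fun _ => u () + subst N (s - subst Φ (u ())), ?_, fun _ => ?_⟩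
      · have h1 := subst_sub_subst_mem_of_mem (hNc.comp hc) isCentered_X (m := 1) hNΦ hu
        rw [← subst_subst hNc hc, subst_X_eq, add_comm 1] at h1
        rw [subst_add hc.hasSubst]
        have := neg_mem h1
        rwa [show -(subst Φ (subst N (s - subst Φ (u ()))) - (s - subst Φ (u ()))) =
          s - (subst Φ (u ()) + subst Φ (subst N (s - subst Φ (u ())))) by ring] at this
      · simpa using subst_mem_ordIdeal hNc hu) (fun _ => 0) (mem_ordIdeal_zero _)
  refine ⟨L (), ?_⟩
  rw [← sub_eq_zero]
  apply eq_zero_of_forall_mem_ordIdeal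
  intro n
  obtain ⟨u, hu, hLu⟩ := hL n
  have := sub_mem (subst_mem_ordIdeal hc (hLu ())) hu
  rw [subst_sub hc.hasSubst] at this
  convert this using 1
  ring

theorem IsFormalCoord.exists_leftInverse (hΦ : IsFormalCoord Φ) :
    ∃ Θ : FormalMap, IsFormalCoord Θ ∧ Θ.comp Φ = X := by
  choose Θ hΘ using fun i => hΦ.exists_subst_eq (X i)
  have h : FormalMap.comp Θ Φ = X := funext hΘ
  refine ⟨Θ, isFormalCoord_iff.2 ⟨fun i => ?_, fun h0 => ?_⟩, h⟩
  · rw [← constantCoeff_subst_of_isCentered hΦ.isCentered, hΘ i]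
    simp
  · have := congrArg Matrix.det (linPart_comp (Ψ := Θ) hΦ.isCentered)
    rw [h, Matrix.det_mul, h0, ← linMap_one, linPart_linMap] at this
    simp at this

/-- The formal inverse function theorem. -/
theorem IsFormalCoord.exists_inverse (hΦ : IsFormalCoord Φ) :
    ∃ Θ : FormalMap, IsFormalCoord Θ ∧ Θ.comp Φ = X ∧ Φ.comp Θ = X := by
  obtain ⟨Θ, hΘ, h⟩ := hΦ.exists_leftInverse
  obtain ⟨Φ', -, h'⟩ := hΘ.exists_leftInverse
  have : Φ' = Φ := by
    have h1 : (Φ'.comp Θ).comp Φ = Φ := by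
      rw [h']; funext i; exact subst_X hΦ.isCentered.hasSubst i
    rw [FormalMap.comp_assoc hΘ.isCentered hΦ.isCentered, h] at h1
    rw [← h1]; funext i; exact (subst_X_eq _).symm
  exact ⟨Θ, hΘ, h, this ▸ h'⟩

theorem IsFormalCoord.subst_injective (hΦ : IsFormalCoord Φ) :
    Function.Injective (subst Φ : Series → Series) := by
  obtain ⟨Θ, hΘ, -, h⟩ := hΦ.exists_inverse
  intro s t hst
  have := congrArg (subst Θ) hst
  rwa [subst_subst hΦ.isCentered hΘ.isCentered, subst_subst hΦ.isCentered hΘ.isCentered, h,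
    subst_X_eq, subst_X_eq] at this

/-- Every centered formal map can be pushed forward by a formal change of coordinates. -/
theorem IsFormalCoord.exists_comp_eq (hΦ : IsFormalCoord Φ) {F : FormalMap} (hF : F.IsCentered) :
    ∃ E : FormalMap, E.IsCentered ∧ Φ.comp F = E.comp Φ := by
  choose E hE using fun i => hΦ.exists_subst_eq (Φ.comp F i)
  refine ⟨E, fun i => ?_, funext fun i => (hE i).symm⟩
  rw [← constantCoeff_subst_of_isCentered hΦ.isCentered, hE i]
  exact (hΦ.isCentered.comp hF) i

theorem FormallyConj.trans {F E G : FormalMap} (hF : F.IsCentered) (hE : E.IsCentered)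
    (h₁ : FormallyConj F E) (h₂ : FormallyConj E G) : FormallyConj F G := by
  obtain ⟨Φ, hΦ, e₁⟩ := h₁
  obtain ⟨Ψ, hΨ, e₂⟩ := h₂
  refine ⟨Ψ.comp Φ, hΨ.comp hΦ, ?_⟩
  rw [FormalMap.comp_assoc hΦ.isCentered hF, e₁, ← FormalMap.comp_assoc hE hΦ.isCentered, e₂,
    FormalMap.comp_assoc hΨ.isCentered hΦ.isCentered]

theorem linPart_mul_of_comp_eq {F E : FormalMap} (hΦ : Φ.IsCentered) (hF : F.IsCentered)
    (h : Φ.comp F = E.comp Φ) : linPart Φ * linPart F = linPart E * linPart Φ := by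
  rw [← linPart_comp hF, ← linPart_comp hΦ, h]

/-! ### Formal Jacobian determinants -/

/-- The Jacobian determinant of a formal map. -/
def formalJac (F : FormalMap) : Series :=
  pderiv ℂ 0 (F 0) * pderiv ℂ 1 (F 1) - pderiv ℂ 1 (F 0) * pderiv ℂ 0 (F 1)

theorem formalJac_comp (hΦ : Φ.IsCentered) :
    formalJac (Ψ.comp Φ) = subst Φ (formalJac Ψ) * formalJac Φ := by
  have h := hΦ.hasSubst
  simp only [formalJac, FormalMap.comp, pderiv_subst hΦ, subst_sub h, subst_mul h]
  ring

theorem constantCoeff_formalJac (F : FormalMap) :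
    constantCoeff (formalJac F) = (linPart F).det := by
  rw [Matrix.det_fin_two]
  simp only [formalJac, map_sub, map_mul, constantCoeff_pderiv, linPart_apply]

theorem IsFormalCoord.isUnit_formalJac (hΦ : IsFormalCoord Φ) : IsUnit (formalJac Φ) := by
  rw [isUnit_iff_constantCoeff, constantCoeff_formalJac]
  exact (isFormalCoord_iff.1 hΦ).2.isUnit

theorem isUnit_subst (hΦ : Φ.IsCentered) {s : Series} (hs : IsUnit s) : IsUnit (subst Φ s) := by
  rw [isUnit_iff_constantCoeff] at *
  rwa [constantCoeff_subst_of_isCentered hΦ]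

theorem IsFormalCoord.isUnit_of_subst (hΦ : IsFormalCoord Φ) {s : Series}
    (hs : IsUnit (subst Φ s)) : IsUnit s := by
  rw [isUnit_iff_constantCoeff] at *
  rwa [constantCoeff_subst_of_isCentered hΦ.isCentered] at hs

/-- The Jacobian determinants of conjugate formal maps agree up to a unit. -/
theorem subst_formalJac_associated {F E : FormalMap} (hΦ : IsFormalCoord Φ) (hF : F.IsCentered)
    (h : Φ.comp F = E.comp Φ) : Associated (subst Φ (formalJac E)) (formalJac F) := by
  have e : subst F (formalJac Φ) * formalJac F = subst Φ (formalJac E) * formalJac Φ := by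
    rw [← formalJac_comp hF, ← formalJac_comp hΦ.isCentered, h]
  have h₁ : Associated (subst Φ (formalJac E) * formalJac Φ) (subst Φ (formalJac E)) :=
    associated_mul_unit_left _ _ hΦ.isUnit_formalJac
  have h₂ : Associated (subst F (formalJac Φ) * formalJac F) (formalJac F) :=
    associated_unit_mul_left _ _ (isUnit_subst hF hΦ.isUnit_formalJac)
  exact (e ▸ h₁.symm).trans h₂

/-! ### Resonant normal forms -/

/-- The linear map `(z, w) ↦ (lam z, 0)`. -/
def diagMap (lam : ℂ) : FormalMap := ![C lam * X 0, C 0 * X 1]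

theorem diagMap_eq_linMap (lam : ℂ) : diagMap lam = linMap !![lam, 0; 0, 0] := by
  funext i; fin_cases i <;> simp [diagMap, linMap]

theorem diagMap_isCentered (lam : ℂ) : (diagMap lam).IsCentered :=
  diagMap_eq_linMap lam ▸ linMap_isCentered _

theorem sub_diagMap_mem {lam : ℂ} {F : FormalMap} (hF : F.IsCentered)
    (h : linPart F = !![lam, 0; 0, 0]) (i : Fin 2) : F i - diagMap lam i ∈ ordIdeal 2 := by
  rw [diagMap_eq_linMap, ← h]
  exact sub_linMap_mem hF i

theorem linPart_eq_of_sub_diagMap_mem {lam : ℂ} {F : FormalMap}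
    (h : ∀ i, F i - diagMap lam i ∈ ordIdeal 2) : linPart F = !![lam, 0; 0, 0] := by
  rw [linPart_eq_of_sub_mem h, diagMap_eq_linMap, linPart_linMap]

/-- The homological equation for `(z, w) ↦ (lam z, 0)`: it can be solved up to
the resonant monomials, those for which `lam ^ i * 0 ^ j = mu`. -/
theorem exists_homological (lam mu : ℂ) {n : ℕ} {e : Series} (he : e ∈ ordIdeal n) :
    ∃ h k : Series, h ∈ ordIdeal n ∧ k ∈ ordIdeal n ∧
      subst (diagMap lam) h - C mu * h = k - e ∧
      ∀ d, coeff d k ≠ 0 → lam ^ d 0 * 0 ^ d 1 = mu := by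
  classical
  let h : Series := fun d => if lam ^ d 0 * 0 ^ d 1 = mu then 0 else
    -coeff d e / (lam ^ d 0 * 0 ^ d 1 - mu)
  let k : Series := fun d => if lam ^ d 0 * 0 ^ d 1 = mu then coeff d e else 0
  have hh : ∀ d, coeff d h = if lam ^ d 0 * 0 ^ d 1 = mu then 0 else
    -coeff d e / (lam ^ d 0 * 0 ^ d 1 - mu) := fun _ => rfl
  have hk : ∀ d, coeff d k = if lam ^ d 0 * 0 ^ d 1 = mu then coeff d e else 0 := fun _ => rfl
  rw [mem_ordIdeal_iff] at he
  refine ⟨h, k, ?_, ?_, ?_, ?_⟩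
  · rw [mem_ordIdeal_iff]
    intro d hd
    simp [hh, he d hd]
  · rw [mem_ordIdeal_iff]
    intro d hd
    simp [hk, he d hd]
  · ext d
    rw [diagMap, map_sub, coeff_subst_diag, coeff_C_mul, map_sub, hh, hk]
    split_ifs with hd
    · simp
    · have : lam ^ d 0 * 0 ^ d 1 - mu ≠ 0 := sub_ne_zero.2 hd
      rw [← sub_mul, mul_div_cancel₀ _ this]
      ring
  · intro d hd
    by_contra hne
    exact hd (by rw [hk, if_neg hne])

/-- The Poincaré–Dulac theorem for a formal map with linear part `(lam z, 0)`: a change of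
coordinates tangent to the identity removes all non-resonant monomials. In the first component only
the powers `z ^ i` with `lam ^ i = lam` remain, in the second one only multiples of `w`. -/
theorem exists_resonant_form {lam : ℂ} (hlam : lam ≠ 0) {E : FormalMap} (hE : E.IsCentered)
    (hlin : linPart E = !![lam, 0; 0, 0]) :
    ∃ Φ G : FormalMap, (∀ i, Φ i - X i ∈ ordIdeal 2) ∧ Φ.comp E = G.comp Φ ∧
      G.IsCentered ∧ linPart G = !![lam, 0; 0, 0] ∧
      (∀ d, coeff d (G 0) ≠ 0 → d 1 = 0 ∧ lam ^ d 0 = lam) ∧ X 1 ∣ G 1 := by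
  let mu : Fin 2 → ℂ := ![lam, 0]
  have hdiag : ∀ i, diagMap lam i = C (mu i) * X i := fun i => by
    fin_cases i <;> simp [diagMap, mu]
  -- `u (inl i)` are the components of the conjugacy, `u (inr i)` those of the normal form
  let P : ℕ → (Fin 2 ⊕ Fin 2 → Series) → Prop := fun n u =>
    (∀ i, u (.inl i) - X i ∈ ordIdeal 2) ∧ (∀ i, u (.inr i) - diagMap lam i ∈ ordIdeal 2) ∧
    (∀ i d, coeff d (u (.inr i)) ≠ 0 → lam ^ d 0 * 0 ^ d 1 = mu i) ∧
    ∀ i, subst E (u (.inl i)) - subst (fun j => u (.inl j)) (u (.inr i)) ∈ ordIdeal (n + 2)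
  have centered_of : ∀ Φ : FormalMap, (∀ i, Φ i - X i ∈ ordIdeal 2) → Φ.IsCentered :=
    fun Φ h => (isFormalCoord_of_sub_X_mem h).isCentered
  have step : ∀ n u, P n u → ∃ u', P (n + 1) u' ∧ ∀ i, u' i - u i ∈ ordIdeal n := by
    rintro n u ⟨hΦ, hG, hres, herr⟩
    set Φ : FormalMap := fun j => u (.inl j) with hΦdef
    have hΦc := centered_of Φ hΦ
    choose h k hh hk heq hkres using fun i => exists_homological lam (mu i) (herr i)
    have hle : (ordIdeal (n + 2) : Ideal Series) ≤ ordIdeal 2 := ordIdeal_anti (by omega)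
    have hΦ' : ∀ i, (Φ i + h i) - X i ∈ ordIdeal 2 := fun i => by
      have := add_mem (hΦ i) (hle (hh i))
      rwa [show Φ i + h i - X i = u (.inl i) - X i + h i by simp only [hΦdef]; ring]
    have hΦ'c : FormalMap.IsCentered (fun i => Φ i + h i) := centered_of _ hΦ'
    refine ⟨Sum.elim (fun i => Φ i + h i) (fun i => u (.inr i) + k i),
      ⟨hΦ', fun i => ?_, fun i d hd => ?_, fun i => ?_⟩, ?_⟩
    · have := add_mem (hG i) (hle (hk i))
      simpa [add_sub_right_comm] using this
    · by_contra hne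
      refine hd ?_
      simp only [Sum.elim_inr, map_add]
      rw [not_imp_comm.1 (hres i d) hne, not_imp_comm.1 (hkres i d) hne, add_zero]
    · simp only [Sum.elim_inl, Sum.elim_inr]
      have a₁ : subst E (h i) - subst (diagMap lam) (h i) ∈ ordIdeal (1 + (n + 2)) :=
        subst_sub_subst_mem_of_mem hE (diagMap_isCentered lam) (m := 1)
          (sub_diagMap_mem hE hlin) (hh i)
      have a₂ : subst (fun i => Φ i + h i) (k i) - k i ∈ ordIdeal (1 + (n + 2)) := by
        have := subst_sub_subst_mem_of_mem hΦ'c isCentered_X (m := 1) hΦ' (hk i)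
        rwa [subst_X_eq] at this
      have a₃ : subst (fun i => Φ i + h i) (u (.inr i) - diagMap lam i) -
          subst Φ (u (.inr i) - diagMap lam i) ∈ ordIdeal (n + 1 + 2) :=
        subst_sub_subst_mem_of_mem hΦ'c hΦc (m := n + 1)
          (fun j => by simpa using hh j) (hG i)
      rw [subst_sub hΦ'c.hasSubst, subst_sub hΦc.hasSubst, hdiag, subst_mul hΦ'c.hasSubst,
        subst_mul hΦc.hasSubst, subst_X hΦ'c.hasSubst, subst_X hΦc.hasSubst, subst_C, subst_C] at a₃
      rw [show 1 + (n + 2) = n + 1 + 2 by ring] at a₁ a₂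
      have := sub_mem (sub_mem a₁ a₂) a₃
      rw [subst_add hE.hasSubst, subst_add hΦ'c.hasSubst]
      convert this using 1
      linear_combination heq i
    · rintro (i | i)
      · simpa [hΦdef] using ordIdeal_anti (by omega : n ≤ n + 2) (hh i)
      · simpa using ordIdeal_anti (by omega : n ≤ n + 2) (hk i)
  have base : P 0 (Sum.elim X (diagMap lam)) := by
    refine ⟨fun i => by simp, fun i => by simp, fun i d hd => ?_, fun i => ?_⟩
    · simp only [Sum.elim_inr, hdiag, coeff_C_mul, coeff_X] at hd
      have hd' : d = Finsupp.single i 1 := by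
        by_contra hne; simp [hne] at hd
      subst hd'
      fin_cases i <;> simp [mu]
    · simp only [Sum.elim_inl, Sum.elim_inr]
      rw [subst_X hE.hasSubst, subst_X_eq]
      exact sub_diagMap_mem hE hlin i
  obtain ⟨L, hL⟩ := exists_limit P step _ base
  have hLX : ∀ i, L (.inl i) - X i ∈ ordIdeal 2 := fun i => by
    obtain ⟨u, ⟨h, -⟩, hu⟩ := hL 2
    have := add_mem (hu (.inl i)) (h i)
    simpa using this
  have hLG : ∀ i, L (.inr i) - diagMap lam i ∈ ordIdeal 2 := fun i => by
    obtain ⟨u, ⟨-, h, -⟩, hu⟩ := hL 2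
    have := add_mem (hu (.inr i)) (h i)
    simpa using this
  have hres : ∀ i d, coeff d (L (.inr i)) ≠ 0 → lam ^ d 0 * 0 ^ d 1 = mu i := fun i d hd => by
    obtain ⟨u, ⟨-, -, h, -⟩, hu⟩ := hL (d.degree + 1)
    refine h i d ?_
    have := mem_ordIdeal_iff.1 (hu (.inr i)) d (Nat.lt_succ_self _)
    rw [map_sub, sub_eq_zero] at this
    rwa [← this]
  have hc := centered_of (fun i => L (.inl i)) hLX
  refine ⟨fun i => L (.inl i), fun i => L (.inr i), hLX, funext fun i => ?_, fun i => ?_,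
    linPart_eq_of_sub_diagMap_mem hLG, fun d hd => ?_, ?_⟩
  · simp only [FormalMap.comp]
    rw [← sub_eq_zero]
    apply eq_zero_of_forall_mem_ordIdeal
    intro n
    obtain ⟨u, ⟨h, -, -, herr⟩, hu⟩ := hL n
    have huc := centered_of (fun i => u (.inl i)) h
    have a₁ := subst_mem_ordIdeal hE (hu (.inl i))
    have a₂ := subst_mem_ordIdeal huc (hu (.inr i))
    have a₃ := subst_sub_subst_mem hc huc (fun i => hu (.inl i)) (L (.inr i))
    rw [subst_sub hE.hasSubst] at a₁
    rw [subst_sub huc.hasSubst] at a₂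
    have := sub_mem (sub_mem (add_mem a₁ (ordIdeal_anti (by omega : n ≤ n + 2) (herr i))) a₂) a₃
    convert this using 1
    ring
  · have h1 := mem_ordIdeal_one.1 (ordIdeal_anti one_le_two (hLG i))
    rw [map_sub, diagMap_isCentered lam i, sub_zero] at h1
    exact h1
  · have h1 := hres 0 d hd
    by_cases h0 : d 1 = 0
    · exact ⟨h0, by simpa [h0, mu] using h1⟩
    · simp [h0, mu] at h1
      exact absurd h1.symm hlam
  · rw [X_dvd_iff]
    intro d h0
    by_contra hd
    have h1 := hres 1 d hd
    simp [h0, mu] at h1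
    exact hlam h1.1

end RigidGerm

namespace RigidGerm
open MvPowerSeries

variable {Φ Ψ : FormalMap}

/-! ### Invariant axes -/

theorem X_zero_dvd_of_subst_eq_zero {s : Series} (h : subst (![0, X 1] : FormalMap) s = 0) :
    X 0 ∣ s := by
  rw [X_dvd_iff]
  intro d hd
  have := congrArg (coeff d) h
  rw [show (![0, X 1] : FormalMap) = ![C 0 * X 0, C 1 * X 1] by simp, coeff_subst_diag] at this
  simpa [hd] using this

theorem X_one_dvd_of_subst_eq_zero {s : Series} (h : subst (![X 0, 0] : FormalMap) s = 0) :
    X 1 ∣ s := by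
  rw [X_dvd_iff]
  intro d hd
  have := congrArg (coeff d) h
  rw [show (![X 0, 0] : FormalMap) = ![C 1 * X 0, C 0 * X 1] by simp, coeff_subst_diag] at this
  simpa [hd] using this

theorem isCentered_vec {s t : Series} (hs : constantCoeff s = 0) (ht : constantCoeff t = 0) :
    FormalMap.IsCentered ![s, t] := fun i => by fin_cases i <;> simp [hs, ht]

theorem mem_of_mul_isUnit_mem {n : ℕ} {s t : Series} (ht : IsUnit t) (h : s * t ∈ ordIdeal n) :
    s ∈ ordIdeal n := by
  obtain ⟨u, rfl⟩ := ht
  simpa [mul_assoc] using Ideal.mul_mem_right (↑u⁻¹ : Series) _ h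

theorem isUnit_iff_ne {s : Series} : IsUnit s ↔ constantCoeff s ≠ 0 := by
  rw [isUnit_iff_constantCoeff, isUnit_iff_ne_zero]

theorem constantCoeff_eq_coeff_single {i : Fin 2} {s : Series} :
    constantCoeff s = coeff (Finsupp.single i 1) (X i * s) := by
  have := coeff_add_single_X_mul i 0 s
  rw [zero_add] at this
  rw [this, coeff_zero_eq_constantCoeff_apply]

theorem mem_succ_of_coeff {n : ℕ} {s : Series} (hs : s ∈ ordIdeal n)
    (h : ∀ d : Fin 2 →₀ ℕ, d.degree = n → coeff d s = 0) : s ∈ ordIdeal (n + 1) := by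
  rw [mem_ordIdeal_iff] at *
  intro d hd
  rcases Nat.lt_succ_iff_lt_or_eq.1 hd with hd | hd
  exacts [hs d hd, h d hd]

variable {lam : ℂ} {E G : FormalMap}

/-- If the axis `{z = 0}` is invariant under `E`, then a conjugacy to a map with
invariant axis `{z = 0}` preserves this axis, because the restriction of `E` to it has order
at least two. -/
theorem X_zero_dvd_conj (hlam : lam ≠ 0) (hE : E.IsCentered) (hΦ : Φ.IsCentered)
    (hlin : linPart E = !![lam, 0; 0, 0]) (h : Φ.comp E = G.comp Φ)
    (hlinG : linPart G = !![lam, 0; 0, 0]) (hG : X 0 ∣ G 0) (hE0 : X 0 ∣ E 0) : X 0 ∣ Φ 0 := by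
  -- `N` parametrizes the axis, `Q` is the restriction of `E` to it and `p` that of `Φ 0`
  set N : FormalMap := ![0, X 1] with hN
  have hNc : N.IsCentered := isCentered_vec (by simp) (by simp)
  set q := subst N (E 1) with hq
  set Q : FormalMap := ![0, q] with hQ
  have hE1 : E 1 ∈ ordIdeal 2 := by
    have := sub_diagMap_mem hE hlin 1
    simpa [diagMap] using this
  have hqm : q ∈ ordIdeal 2 := subst_mem_ordIdeal hNc hE1
  have hQc : Q.IsCentered :=
    isCentered_vec (by simp) (mem_ordIdeal_one.1 (ordIdeal_anti one_le_two hqm))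
  set p := subst N (Φ 0) with hp
  have hEN : E.comp N = N.comp Q := by
    refine funext (Fin.forall_fin_two.2 ⟨?_, ?_⟩)
    · obtain ⟨e, he⟩ := hE0
      change subst N (E 0) = subst Q (0 : Series)
      rw [he, subst_mul hNc.hasSubst, hNc.subst_X, hQc.subst_zero]
      exact zero_mul _
    · exact (hQc.subst_X 1).symm
  obtain ⟨γ, hγ⟩ := hG
  have hγu : IsUnit γ := by
    rw [isUnit_iff_ne, constantCoeff_eq_coeff_single (i := 0), ← hγ, ← linPart_apply, hlinG]
    simpa using hlam
  have key : subst Q p = p * subst N (subst Φ γ) := by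
    have h0 : subst E (Φ 0) = subst Φ (G 0) := congrFun h 0
    have := congrArg (subst N) h0
    rw [subst_subst hE hNc, hEN, ← subst_subst hNc hQc, hγ, subst_mul hΦ.hasSubst,
      subst_mul hNc.hasSubst, hΦ.subst_X] at this
    exact this
  apply X_zero_dvd_of_subst_eq_zero
  apply eq_zero_of_forall_mem_ordIdeal
  intro n
  induction n with
  | zero => exact mem_ordIdeal_zero _
  | succ n ih =>
    refine mem_of_mul_isUnit_mem (isUnit_subst hNc (isUnit_subst hΦ hγu)) ?_
    change p * _ ∈ _
    rw [← key]
    have h0c : FormalMap.IsCentered ![0, 0] := isCentered_vec (by simp) (by simp)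
    have := subst_sub_subst_mem_of_mem hQc h0c (m := 1) (s := p) (fun i => by
      fin_cases i <;> simp [hQ, hqm]) ih
    have hz : subst (![0, 0] : FormalMap) p = 0 := by
      rw [show (![0, 0] : FormalMap) = fun _ => 0 by funext i; fin_cases i <;> rfl]
      refine subst_zero_of_constantCoeff_zero ?_
      rw [hp, constantCoeff_subst_of_isCentered hNc, hΦ]
    rwa [hz, sub_zero, add_comm] at this

/-- If the axis `{w = 0}` is invariant under `E`, then a conjugacy to a map with
invariant axis `{w = 0}` preserves this axis, because `E` is invertible along it, whereas
the second component of the target map vanishes to order two there. -/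
theorem X_one_dvd_conj (hlam : lam ≠ 0) (hE : E.IsCentered) (hΦ : Φ.IsCentered)
    (hlin : linPart E = !![lam, 0; 0, 0]) (h : Φ.comp E = G.comp Φ)
    (hlinG : linPart G = !![lam, 0; 0, 0]) (hG : X 1 ∣ G 1) (hE1 : X 1 ∣ E 1) : X 1 ∣ Φ 1 := by
  -- `N` parametrizes the axis, `Q` is the restriction of `E` to it and `p` that of `Φ 1`
  set N : FormalMap := ![X 0, 0] with hN
  have hNc : N.IsCentered := isCentered_vec (by simp) (by simp)
  set q := subst N (E 0) with hq
  set Q : FormalMap := ![q, 0] with hQ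
  have hqm : q - C lam * X 0 ∈ ordIdeal 2 := by
    have := subst_mem_ordIdeal hNc (sub_diagMap_mem hE hlin 0)
    change subst N (E 0 - C lam * X 0) ∈ _ at this
    rwa [subst_sub hNc.hasSubst, subst_mul hNc.hasSubst, subst_C, hNc.subst_X] at this
  have hq0 : constantCoeff q = 0 := by
    rw [hq, constantCoeff_subst_of_isCentered hNc, hE]
  have hQc : Q.IsCentered := isCentered_vec hq0 (by simp)
  set p := subst N (Φ 1) with hp
  have hEN : E.comp N = N.comp Q := by
    refine funext (Fin.forall_fin_two.2 ⟨?_, ?_⟩)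
    · exact (hQc.subst_X 0).symm
    · obtain ⟨e, he⟩ := hE1
      change subst N (E 1) = subst Q (0 : Series)
      rw [he, subst_mul hNc.hasSubst, hNc.subst_X, hQc.subst_zero]
      exact zero_mul _
  obtain ⟨γ, hγ⟩ := hG
  have hγ0 : constantCoeff γ = 0 := by
    rw [constantCoeff_eq_coeff_single (i := 1), ← hγ, ← linPart_apply, hlinG]
    simp
  have key : subst Q p = p * subst N (subst Φ γ) := by
    have h0 : subst E (Φ 1) = subst Φ (G 1) := congrFun h 1
    have := congrArg (subst N) h0
    rw [subst_subst hE hNc, hEN, ← subst_subst hNc hQc, hγ, subst_mul hΦ.hasSubst,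
      subst_mul hNc.hasSubst, hΦ.subst_X] at this
    exact this
  have hpd : ∀ d, d 1 ≠ 0 → coeff d p = 0 := fun d hd => by
    rw [hp, hN, show (![X 0, 0] : FormalMap) = ![C 1 * X 0, C 0 * X 1] by simp, coeff_subst_diag]
    simp [hd]
  apply X_one_dvd_of_subst_eq_zero
  apply eq_zero_of_forall_mem_ordIdeal
  intro n
  change p ∈ _
  induction n with
  | zero => exact mem_ordIdeal_zero _
  | succ n ih =>
    have a₁ : subst Q p ∈ ordIdeal (n + 1) := by
      rw [key]
      refine mul_mem_ordIdeal ih (mem_ordIdeal_one.2 ?_)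
      rw [constantCoeff_subst_of_isCentered hNc, constantCoeff_subst_of_isCentered hΦ, hγ0]
    have a₂ := subst_sub_subst_mem_of_mem hQc (diagMap_isCentered lam) (m := 1) (s := p)
      (fun i => by fin_cases i <;> simp [hQ, diagMap, hqm]) ih
    rw [add_comm] at a₂
    have a₃ : subst (diagMap lam) p ∈ ordIdeal (n + 1) := by simpa using sub_mem a₁ a₂
    refine mem_succ_of_coeff ih fun d hd => ?_
    by_cases h1 : d 1 = 0
    · have := mem_ordIdeal_iff.1 a₃ d (by omega)
      rw [diagMap, coeff_subst_diag, h1] at this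
      simpa [hlam] using this
    · exact hpd d h1

/-! ### Maps with monomial Jacobian determinant -/

theorem eq_X_mul_unit {i : Fin 2} {s : Series} (h : X i ∣ s)
    (h1 : coeff (Finsupp.single i 1) s ≠ 0) : ∃ u, IsUnit u ∧ s = X i * u := by
  obtain ⟨u, rfl⟩ := h
  exact ⟨u, by rwa [isUnit_iff_ne, constantCoeff_eq_coeff_single (i := i)], rfl⟩

/-- A multiple of `w` whose derivative with respect to `w` is a monomial up to a unit is a monomial
up to a unit. -/
theorem exists_eq_monomial_of_pderiv {a b : ℕ} {g u : Series} (hu : IsUnit u)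
    (hg : pderiv ℂ 1 g = X 0 ^ a * X 1 ^ b * u) (hw : X 1 ∣ g) :
    ∃ v, IsUnit v ∧ g = X 0 ^ a * X 1 ^ (b + 1) * v := by
  have hpow : ∀ d : Fin 2 →₀ ℕ, coeff d (X 0 ^ a * X 1 ^ b * u) ≠ 0 → a ≤ d 0 ∧ b ≤ d 1 := by
    intro d hd
    constructor
    · by_contra hlt
      exact hd (X_pow_dvd_iff.1 (Dvd.intro (X 1 ^ b * u) (by ring)) d (not_le.1 hlt))
    · by_contra hlt
      exact hd (X_pow_dvd_iff.1 (Dvd.intro (X 0 ^ a * u) (by ring)) d (not_le.1 hlt))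
  have hsupp : ∀ d : Fin 2 →₀ ℕ, coeff d g ≠ 0 → a ≤ d 0 ∧ b + 1 ≤ d 1 := by
    intro d hd
    have h1 : d 1 ≠ 0 := fun h0 => hd (X_dvd_iff.1 hw d h0)
    obtain ⟨e, rfl⟩ : ∃ e, d = e + Finsupp.single 1 1 :=
      ⟨d - Finsupp.single 1 1, by ext i; fin_cases i <;> simp; omega⟩
    have := hpow e (by
      rw [← hg, coeff_pderiv]
      exact mul_ne_zero hd (Nat.cast_add_one_ne_zero _))
    simpa using this
  have hXa : X 0 ^ a ∣ g := X_pow_dvd_iff.2 fun d hd => by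
    by_contra hne
    have := (hsupp d hne).1
    omega
  obtain ⟨g', rfl⟩ := hXa
  have hXb : X 1 ^ (b + 1) ∣ g' := X_pow_dvd_iff.2 fun d hd => by
    by_contra hne
    have hc : coeff (d + Finsupp.single 0 a) (X 0 ^ a * g') = coeff d g' := by
      rw [X_pow_eq, mul_comm, coeff_add_mul_monomial, mul_one]
    have := (hsupp (d + Finsupp.single 0 a) (by rwa [hc])).2
    simp at this
    omega
  obtain ⟨v, rfl⟩ := hXb
  refine ⟨v, ?_, by ring⟩
  have h10 : pderiv ℂ (1 : Fin 2) (X 0 : Series) = 0 := pderiv_X_of_ne (by decide)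
  have hX : ∀ i : Fin 2, (X i : Series) ≠ 0 := fun i h0 => by
    have := congrArg (coeff (Finsupp.single i 1)) h0
    simp at this
  have e : X 0 ^ a * X 1 ^ b * (((b : Series) + 1) * v + X 1 * pderiv ℂ 1 v) =
      X 0 ^ a * X 1 ^ b * u := by
    rw [← hg]
    simp only [Derivation.leibniz, Derivation.leibniz_pow, smul_eq_mul, h10, pderiv_X_self,
      nsmul_eq_mul]
    push_cast
    simp
    ring
  have e' := mul_left_cancel₀ (mul_ne_zero (pow_ne_zero _ (hX 0)) (pow_ne_zero _ (hX 1))) e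
  have := congrArg constantCoeff e'
  rw [isUnit_iff_ne] at hu ⊢
  intro hv
  simp [hv] at this
  exact hu this.symm

/-- Formal germs with linear part `[lam, *; *, 0]` of determinant zero whose
Jacobian determinant is `z ^ a w ^ b` times a unit, with invariant critical axes. -/
structure HasMonomialJac (lam : ℂ) (a b : ℕ) (E : FormalMap) : Prop where
  isCentered : E.IsCentered
  lin_zero_zero : linPart E 0 0 = lam
  lin_one_one : linPart E 1 1 = 0
  lin_mul : linPart E 0 1 * linPart E 1 0 = 0
  jac : Associated (X 0 ^ a * X 1 ^ b) (formalJac E)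
  dvd_zero : 1 ≤ a → X 0 ∣ E 0
  dvd_one : 1 ≤ b → X 1 ∣ E 1

theorem exists_eq_mul_unit_of_associated {s t : Series} (h : Associated s t) :
    ∃ u, IsUnit u ∧ t = s * u := by
  obtain ⟨u, hu⟩ := h
  exact ⟨u, u.isUnit, hu.symm⟩

/-- A conjugate map has the same monomial Jacobian determinant up to a unit if the change of
coordinates preserves those axes on which the determinant vanishes. -/
theorem associated_formalJac_conj {a b : ℕ} (hΦ : IsFormalCoord Φ) (hE : E.IsCentered)
    (h : Φ.comp E = G.comp Φ) (hjac : Associated (X 0 ^ a * X 1 ^ b) (formalJac E))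
    (h0 : 1 ≤ a → Associated (X 0) (Φ 0)) (h1 : 1 ≤ b → Associated (X 1) (Φ 1)) :
    Associated (X 0 ^ a * X 1 ^ b) (formalJac G) := by
  have hs := hΦ.isCentered.hasSubst
  have hpow : ∀ (i : Fin 2) (k : ℕ), (1 ≤ k → Associated (X i) (Φ i)) →
      Associated (X i ^ k) (Φ i ^ k) := fun i k hk => by
    rcases Nat.eq_zero_or_pos k with rfl | hk'
    · simp
    · exact (hk hk').pow_pow
  have e : Associated (Φ 0 ^ a * Φ 1 ^ b) (subst Φ (formalJac G)) :=
    (((hpow 0 a h0).mul_mul (hpow 1 b h1)).symm.trans hjac).trans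
      (subst_formalJac_associated hΦ hE h).symm
  obtain ⟨u, hu, hu'⟩ := exists_eq_mul_unit_of_associated e
  obtain ⟨v, hv⟩ := hΦ.exists_subst_eq u
  have hv' : IsUnit v := hΦ.isUnit_of_subst (hv ▸ hu)
  have : formalJac G = X 0 ^ a * X 1 ^ b * v := hΦ.subst_injective (by
    simp only [subst_mul hs, subst_pow hs, hΦ.isCentered.subst_X]
    rw [hu', hv])
  rw [this]
  exact (associated_mul_unit_left _ _ hv').symm

theorem isFormalCoord_vec {s t : Series} (hs : constantCoeff s = 0) (ht : constantCoeff t = 0)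
    (hdet : coeff (Finsupp.single 0 1) s * coeff (Finsupp.single 1 1) t -
      coeff (Finsupp.single 1 1) s * coeff (Finsupp.single 0 1) t ≠ 0) :
    IsFormalCoord ![s, t] := by
  refine isFormalCoord_iff.2 ⟨isCentered_vec hs ht, ?_⟩
  rw [Matrix.det_fin_two]
  simpa [linPart_apply] using hdet

/-- A linear change of coordinates diagonalizes the linear part. -/
theorem HasMonomialJac.exists_diagonal {a b : ℕ} (hlam : lam ≠ 0) (hE : HasMonomialJac lam a b E) :
    ∃ G, HasMonomialJac lam a b G ∧ linPart G = !![lam, 0; 0, 0] ∧ FormallyConj E G := by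
  obtain ⟨hc, h00, h11, hmul, hjac, hd0, hd1⟩ := hE
  set α := linPart E 0 1 with hα
  set β := linPart E 1 0 with hβ
  have hα0 : 1 ≤ a → α = 0 := fun h => by
    rw [hα, linPart_apply]
    exact X_dvd_iff.1 (hd0 h) _ (by simp)
  have hβ0 : 1 ≤ b → β = 0 := fun h => by
    rw [hβ, linPart_apply]
    exact X_dvd_iff.1 (hd1 h) _ (by simp)
  -- one of `α`, `β` vanishes, and this matrix diagonalizes the other triangular part
  set M : Matrix (Fin 2) (Fin 2) ℂ := !![1, α / lam; -(β / lam), 1] with hM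
  have hαβ : α / lam * (β / lam) = 0 := by rw [div_mul_div_comm, hmul, zero_div]
  have hdet : M.det = 1 := by
    rw [Matrix.det_fin_two]
    simp [hM, hαβ]
  have hΦ : IsFormalCoord (linMap M) :=
    isFormalCoord_iff.2 ⟨linMap_isCentered M, by rw [linPart_linMap, hdet]; exact one_ne_zero⟩
  obtain ⟨G, hG, h⟩ := hΦ.exists_comp_eq hc
  have hlinE : linPart E = !![lam, α; β, 0] := by
    ext i j; fin_cases i <;> fin_cases j <;> simp [h00, h11, hα, hβ]
  have hlin : linPart G = !![lam, 0; 0, 0] := by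
    have e := linPart_mul_of_comp_eq hΦ.isCentered hc h
    rw [linPart_linMap, hlinE] at e
    have hM' : IsUnit M.det := by rw [hdet]; exact isUnit_one
    have e' : !![lam, 0; 0, 0] * M = linPart G * M := by
      rw [← e]
      have h1 : α / lam * β = 0 := by rw [div_mul_eq_mul_div, hmul, zero_div]
      have h2 : β / lam * α = 0 := by rw [div_mul_eq_mul_div, mul_comm, hmul, zero_div]
      have h3 : lam * (α / lam) = α := mul_div_cancel₀ _ hlam
      have h4 : β / lam * lam = β := div_mul_cancel₀ _ hlam
      simp [hM, h1, h2, h3, h4]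
      ext j; fin_cases j <;> rfl
    have := congrArg (· * M⁻¹) e'
    simpa [Matrix.mul_assoc, Matrix.mul_nonsing_inv _ hM'] using this.symm
  have hs := hΦ.isCentered.hasSubst
  have hΦ0 : 1 ≤ a → linMap M 0 = X 0 := fun h => by simp [linMap, hM, hα0 h]
  have hΦ1 : 1 ≤ b → linMap M 1 = X 1 := fun h => by simp [linMap, hM, hβ0 h]
  have hdvd : ∀ i, linMap M i = X i → X i ∣ E i → X i ∣ G i := fun i hi ⟨e, he⟩ => by
    obtain ⟨e', he'⟩ := hΦ.exists_subst_eq e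
    refine ⟨e', hΦ.subst_injective ?_⟩
    rw [subst_mul hs, hΦ.isCentered.subst_X, he', hi, ← he,
      ← show _ = subst (linMap M) (G i) from congrFun h i]
    simp only [FormalMap.comp, hi, hc.subst_X]
  refine ⟨G, ⟨hG, by simp [hlin], by simp [hlin], by simp [hlin], ?_,
    fun ha => hdvd 0 (hΦ0 ha) (hd0 ha), fun hb => hdvd 1 (hΦ1 hb) (hd1 hb)⟩, hlin, _, hΦ, h⟩
  exact associated_formalJac_conj hΦ hc h hjac (fun ha => by rw [hΦ0 ha])
    (fun hb => by rw [hΦ1 hb])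

/-- A formal germ with monomial Jacobian determinant is conjugate to one whose first component is
a resonant function of `z` and whose second component is a monomial up to a unit. -/
theorem HasMonomialJac.exists_monomial_form {a b : ℕ} (hlam : lam ≠ 0)
    (hE : HasMonomialJac lam a b E) :
    ∃ G v, G.IsCentered ∧ linPart G = !![lam, 0; 0, 0] ∧
      (∀ d, coeff d (G 0) ≠ 0 → d 1 = 0 ∧ lam ^ d 0 = lam) ∧
      IsUnit v ∧ G 1 = X 0 ^ a * X 1 ^ (b + 1) * v ∧ FormallyConj E G := by
  obtain ⟨E', hE', hlin, hconj⟩ := hE.exists_diagonal hlam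
  obtain ⟨Φ, G, hΦ, h, hG, hlinG, hres, hw⟩ := exists_resonant_form hlam hE'.isCentered hlin
  have hΦc := isFormalCoord_of_sub_X_mem hΦ
  have hz : X 0 ∣ G 0 := by
    rw [X_dvd_iff]
    intro d hd
    by_contra hne
    have h0 : d = 0 := by ext i; fin_cases i <;> simp [hd, (hres d hne).1]
    subst h0
    exact hne (hG 0)
  have hlinΦ : linPart Φ = 1 := by
    rw [linPart_eq_of_sub_mem hΦ, ← linMap_one, linPart_linMap]
  have hunit : ∀ i, X i ∣ Φ i → Associated (X i) (Φ i) := fun i hi => by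
    obtain ⟨u, hu, hu'⟩ := eq_X_mul_unit hi (by rw [← linPart_apply, hlinΦ]; simp)
    rw [hu']
    exact (associated_mul_unit_left _ _ hu).symm
  have hjac : Associated (X 0 ^ a * X 1 ^ b) (formalJac G) :=
    associated_formalJac_conj hΦc hE'.isCentered h hE'.jac
      (fun ha => hunit 0 (X_zero_dvd_conj hlam hE'.isCentered hΦc.isCentered hlin h hlinG hz
        (hE'.dvd_zero ha)))
      (fun hb => hunit 1 (X_one_dvd_conj hlam hE'.isCentered hΦc.isCentered hlin h hlinG hw
        (hE'.dvd_one hb)))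
  obtain ⟨u, hu, hu'⟩ := exists_eq_mul_unit_of_associated hjac
  have h1 : pderiv ℂ 1 (G 0) = 0 := by
    ext d
    rw [coeff_pderiv, coeff_zero]
    by_cases hne : coeff (d + Finsupp.single 1 1) (G 0) = 0
    · rw [hne, zero_mul]
    · have := (hres _ hne).1
      simp at this
  have h0 : IsUnit (pderiv ℂ 0 (G 0)) := by
    rw [isUnit_iff_ne, constantCoeff_pderiv, ← linPart_apply, hlinG]
    simpa using hlam
  obtain ⟨k, hk⟩ := h0.exists_right_inv
  have hG1 : pderiv ℂ 1 (G 1) = X 0 ^ a * X 1 ^ b * (u * k) := by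
    rw [formalJac, h1, zero_mul, sub_zero] at hu'
    rw [← mul_assoc, ← hu', mul_right_comm, hk, one_mul]
  obtain ⟨v, hv, hv'⟩ := exists_eq_monomial_of_pderiv
    (hu.mul (IsUnit.of_mul_eq_one_right _ hk)) hG1 hw
  exact ⟨G, v, hG, hlinG, hres, hv, hv', hconj.trans hE.isCentered hE'.isCentered ⟨Φ, hΦc, h⟩⟩

end RigidGerm

namespace RigidGerm
open MvPowerSeries

/-! ### Parabolic germs in one variable -/

theorem X_pow_dvd_iff_mem_ordIdeal {n : ℕ} {s : PowerSeries ℂ} :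
    (PowerSeries.X : PowerSeries ℂ) ^ n ∣ s ↔ s ∈ ordIdeal (σ := Unit) n := by
  rw [PowerSeries.X_pow_dvd_iff, mem_ordIdeal_iff]
  constructor
  · intro h d hd
    have hd' : d = Finsupp.single () (d ()) := by ext; simp
    rw [hd']
    refine h (d ()) ?_
    rw [hd'] at hd
    simpa using hd
  · intro h m hm
    exact h (Finsupp.single () m) (by simpa using hm)

theorem exists_pow_eq_one_add {S : ℕ} {Γ g : PowerSeries ℂ} (hS : 1 ≤ S)
    (hΓ : Γ = 1 + PowerSeries.X ^ S * g) (k : ℕ) :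
    ∃ t : PowerSeries ℂ, Γ ^ k = 1 + PowerSeries.X ^ S * t ∧
      PowerSeries.constantCoeff t = k * PowerSeries.constantCoeff g := by
  have hc : PowerSeries.constantCoeff Γ = 1 := by simp [hΓ, show S ≠ 0 by omega]
  refine ⟨g * ∑ i ∈ Finset.range k, Γ ^ i, ?_, ?_⟩
  · have h := mul_geom_sum Γ k
    rw [← mul_assoc, ← show Γ - 1 = PowerSeries.X ^ S * g by rw [hΓ]; ring, h]
    ring
  · simp [map_sum, hc, mul_comm]

theorem exists_add_pow_eq {m : ℕ} (hm : 1 ≤ m) (H h : PowerSeries ℂ) (p : ℕ) :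
    ∃ t : PowerSeries ℂ, (H + PowerSeries.X ^ m * h) ^ p = H ^ p + PowerSeries.X ^ m * h * t ∧
      PowerSeries.constantCoeff t = p * PowerSeries.constantCoeff H ^ (p - 1) := by
  refine ⟨∑ i ∈ Finset.range p, (H + PowerSeries.X ^ m * h) ^ i * H ^ (p - 1 - i), ?_, ?_⟩
  · have := (Commute.all (H + PowerSeries.X ^ m * h) H).mul_geom_sum₂ p
    rw [add_sub_cancel_left] at this
    rw [this]
    ring
  · have : PowerSeries.constantCoeff (H + PowerSeries.X ^ m * h) = PowerSeries.constantCoeff H := by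
      simp [show m ≠ 0 by omega]
    simp only [map_sum, map_mul, map_pow, this]
    rw [geom_sum₂_self]

/-- Normal form of `z ↦ z Γ(z ^ r)` under conjugation by `z ↦ z H(z ^ r)`, written in the variable
`z ^ r`: the equation says that the conjugate is
`z ↦ z (1 + z ^ s + β z ^ (2 s))` with `s = r S`. The coefficient of order `m` of `H` is
determined by the terms of order `m + S` of the equation, except for `m = S`, where `β` is. -/
theorem exists_parabolic_form {r S : ℕ} (hr : 1 ≤ r) (hS : 1 ≤ S) {Γ g : PowerSeries ℂ}
    (hΓ : Γ = 1 + PowerSeries.X ^ S * g) (hg : PowerSeries.constantCoeff g ≠ 0) :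
    ∃ (H : PowerSeries ℂ) (β : ℂ), PowerSeries.constantCoeff H ≠ 0 ∧
      PowerSeries.subst (PowerSeries.X * Γ ^ r) H * Γ =
        H * (1 + PowerSeries.X ^ S * H ^ (r * S) +
          PowerSeries.C β * (PowerSeries.X ^ S * H ^ (r * S)) ^ 2) := by
  set a := PowerSeries.constantCoeff g with ha
  have hrS : r * S ≠ 0 := by positivity
  obtain ⟨μ, hμ⟩ := IsAlgClosed.exists_pow_nat_eq a (Nat.pos_of_ne_zero hrS)
  have hμ0 : μ ≠ 0 := by rintro rfl; rw [zero_pow hrS] at hμ; exact hg hμ.symm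
  set q := r * S with hq
  have hsub : PowerSeries.HasSubst (PowerSeries.X * Γ ^ r) :=
    PowerSeries.HasSubst.of_constantCoeff_zero' (by simp)
  set σ : PowerSeries ℂ → PowerSeries ℂ := PowerSeries.subst (PowerSeries.X * Γ ^ r) with hσ
  have hσX : σ PowerSeries.X = PowerSeries.X * Γ ^ r := PowerSeries.subst_X hsub
  have hσadd : ∀ s t, σ (s + t) = σ s + σ t := fun s t => PowerSeries.subst_add hsub s t
  have hσmul : ∀ s t, σ (s * t) = σ s * σ t := fun s t => PowerSeries.subst_mul hsub s t
  have hσpow : ∀ s n, σ (s ^ n) = σ s ^ n := fun s n => PowerSeries.subst_pow hsub s n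
  have hσC : ∀ c : ℂ, σ (PowerSeries.C c) = PowerSeries.C c := fun c => PowerSeries.subst_C c
  -- `B` is `β τ ^ (2 S)`
  let err : PowerSeries ℂ → PowerSeries ℂ → PowerSeries ℂ := fun H B =>
    σ H * Γ - H * (1 + PowerSeries.X ^ S * H ^ q + B * H ^ (2 * q))
  have herr : ∀ H B, err H B = σ H * Γ -
    H * (1 + PowerSeries.X ^ S * H ^ q + B * H ^ (2 * q)) := fun _ _ => rfl
  let P : ℕ → (Bool → MvPowerSeries Unit ℂ) → Prop := fun n u =>
    PowerSeries.constantCoeff (R := ℂ) (u true) = μ ∧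
    (∃ β, u false = (PowerSeries.C β : PowerSeries ℂ) * PowerSeries.X ^ (2 * S)) ∧
    (PowerSeries.X : PowerSeries ℂ) ^ (n + 1 + S) ∣ err (u true) (u false)
  have step : ∀ n u, P n u → ∃ u', P (n + 1) u' ∧ ∀ i, u' i - u i ∈ ordIdeal n := by
    rintro n u ⟨hH, ⟨β, hB⟩, e, he⟩
    generalize hHd : (u true : PowerSeries ℂ) = H at *
    rw [hB] at he
    by_cases hmS : n + 1 = S
    -- the coefficient of `H` has no effect on this order, which is corrected by `β` instead
    · set β' := PowerSeries.constantCoeff e / μ ^ (2 * q + 1) with hβ'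
      refine ⟨fun b => bif b then H else
        (PowerSeries.C (β + β') : PowerSeries ℂ) * PowerSeries.X ^ (2 * S), ⟨hH, ⟨_, rfl⟩, ?_⟩, ?_⟩
      · have : err H ((PowerSeries.C (β + β') : PowerSeries ℂ) * PowerSeries.X ^ (2 * S)) =
            PowerSeries.X ^ (n + 1 + S) * (e - PowerSeries.C β' * H ^ (2 * q + 1)) := by
          rw [mul_sub, ← he, herr, herr, hmS, map_add]
          ring
        simp only [cond_true, cond_false]
        rw [this, add_right_comm, pow_succ]
        refine mul_dvd_mul_left _ (PowerSeries.X_dvd_iff.2 ?_)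
        simp only [map_sub, map_mul, map_pow, PowerSeries.constantCoeff_C, hH, hβ']
        rw [div_mul_cancel₀ _ (pow_ne_zero _ hμ0), sub_self]
      · rintro (_ | _)
        · simp only [cond_false, hB]
          refine X_pow_dvd_iff_mem_ordIdeal.1 ?_
          refine (pow_dvd_pow PowerSeries.X (by omega : n ≤ 2 * S)).trans ?_
          exact ⟨PowerSeries.C β', by rw [map_add]; ring⟩
        · simp [hHd]
    -- the term `b X ^ m` of `H` contributes `b a r (m - S)` to the coefficient of order `m + S`
    · set m := n + 1 with hm
      have hne : a * r * ((m : ℂ) - S) ≠ 0 := by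
        refine mul_ne_zero (mul_ne_zero hg (Nat.cast_ne_zero.2 (by omega))) (sub_ne_zero.2 ?_)
        exact_mod_cast hmS
      set b := -PowerSeries.constantCoeff e / (a * r * ((m : ℂ) - S)) with hb
      obtain ⟨t₁, ht₁, c₁⟩ := exists_pow_eq_one_add hS hΓ (r * m + 1)
      obtain ⟨t₂, ht₂, c₂⟩ := exists_add_pow_eq (m := m) (by omega) H (PowerSeries.C b) (q + 1)
      obtain ⟨t₃, ht₃, -⟩ := exists_add_pow_eq (m := m) (by omega) H (PowerSeries.C b) (2 * q + 1)
      refine ⟨fun i => bif i then H + PowerSeries.X ^ m * PowerSeries.C b else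
        (PowerSeries.C β : PowerSeries ℂ) * PowerSeries.X ^ (2 * S), ⟨?_, ⟨_, rfl⟩, ?_⟩, ?_⟩
      · simp only [cond_true]
        rw [map_add, hH]
        simp [hm]
      · have : err (H + PowerSeries.X ^ m * PowerSeries.C b)
            ((PowerSeries.C β : PowerSeries ℂ) * PowerSeries.X ^ (2 * S)) =
            PowerSeries.X ^ (m + S) * (e + PowerSeries.C b * t₁ - PowerSeries.C b * t₂ -
              PowerSeries.X ^ S * (PowerSeries.C β * PowerSeries.C b * t₃)) := by
          have e₁ : σ (H + PowerSeries.X ^ m * PowerSeries.C b) * Γ =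
              σ H * Γ + PowerSeries.X ^ m * PowerSeries.C b * Γ ^ (r * m + 1) := by
            rw [hσadd, hσmul, hσpow, hσX, hσC]
            ring
          rw [herr] at he ⊢
          rw [e₁, ht₁]
          linear_combination he - PowerSeries.X ^ S * ht₂ -
            PowerSeries.C β * PowerSeries.X ^ (2 * S) * ht₃
        simp only [cond_true, cond_false]
        rw [this, add_right_comm m 1 S, pow_succ]
        refine mul_dvd_mul_left _ (PowerSeries.X_dvd_iff.2 ?_)
        simp only [map_add, map_sub, map_mul, map_pow, PowerSeries.constantCoeff_C, c₁, c₂, hH,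
          PowerSeries.constantCoeff_X, zero_pow (show S ≠ 0 by omega), zero_mul, sub_zero,
          add_tsub_cancel_right, hμ, ← ha]
        have hbe : b * (a * r * ((m : ℂ) - S)) = -PowerSeries.constantCoeff e :=
          div_mul_cancel₀ _ hne
        rw [hq]
        push_cast
        linear_combination hbe
      · rintro (_ | _)
        · simp [hB]
        · simp only [cond_true]
          refine X_pow_dvd_iff_mem_ordIdeal.1 ?_
          refine (pow_dvd_pow PowerSeries.X (by omega : n ≤ m)).trans ?_
          exact ⟨PowerSeries.C b, by rw [hHd]; ring⟩
  -- the terms of order `S` agree because `μ ^ (r S) = a`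
  have base : P 0 (fun i => bif i then (PowerSeries.C μ : PowerSeries ℂ) else 0) := by
    refine ⟨by simp, ⟨0, by simp⟩, ?_⟩
    simp only [cond_true, cond_false]
    obtain ⟨g', hg'⟩ : PowerSeries.X ∣ g - PowerSeries.C a :=
      PowerSeries.X_dvd_iff.2 (by simp [ha])
    refine ⟨PowerSeries.C μ * g', ?_⟩
    rw [herr, hσC, ← map_pow, hμ, hΓ]
    linear_combination PowerSeries.C μ * PowerSeries.X ^ S * hg'
  obtain ⟨L, hL⟩ := exists_limit P step
    (fun i => bif i then (PowerSeries.C μ : PowerSeries ℂ) else (0 : PowerSeries ℂ)) base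
  have hL' : ∀ n, ∃ u : Bool → PowerSeries ℂ, P n u ∧
      ∀ i, (PowerSeries.X : PowerSeries ℂ) ^ n ∣ L i - u i := fun n => by
    obtain ⟨u, hu, h⟩ := hL n
    exact ⟨u, hu, fun i => X_pow_dvd_iff_mem_ordIdeal.2 (h i)⟩
  clear hL
  set H : PowerSeries ℂ := L true with hH
  set B : PowerSeries ℂ := L false with hB
  have hμH : PowerSeries.constantCoeff H = μ := by
    obtain ⟨u, ⟨h, -⟩, hu⟩ := hL' 1
    have := hu true
    rw [pow_one, PowerSeries.X_dvd_iff, map_sub, h, sub_eq_zero] at this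
    exact this
  have hBβ : B = PowerSeries.C (PowerSeries.coeff (2 * S) B) * PowerSeries.X ^ (2 * S) := by
    ext k
    obtain ⟨u, ⟨-, ⟨β, h⟩, -⟩, hu⟩ := hL' (k + 1)
    have h1 := PowerSeries.X_pow_dvd_iff.1 (hu false) k (Nat.lt_succ_self k)
    rw [map_sub, sub_eq_zero, h] at h1
    rw [← hB] at h1
    rw [PowerSeries.coeff_C_mul, PowerSeries.coeff_X_pow] at h1 ⊢
    split_ifs at h1 ⊢ with hk
    · rw [hk, mul_one]
    · rw [h1]; simp
  refine ⟨H, PowerSeries.coeff (2 * S) B, by rwa [hμH], ?_⟩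
  have hzero : err H B = 0 := by
    ext k
    obtain ⟨u, ⟨-, -, h⟩, hu⟩ := hL' (k + 1)
    set I : Ideal (PowerSeries ℂ) := Ideal.span {PowerSeries.X ^ (k + 1)} with hI
    have hmk : ∀ s t : PowerSeries ℂ, PowerSeries.X ^ (k + 1) ∣ s - t ↔
        Ideal.Quotient.mk I s = Ideal.Quotient.mk I t := fun s t => by
      rw [Ideal.Quotient.eq, hI, Ideal.mem_span_singleton]
    have h0 : Ideal.Quotient.mk I (err (u true) (u false)) = 0 := by
      have := (hmk (err (u true) (u false)) 0).1
        (by rw [sub_zero]; exact (pow_dvd_pow _ (by omega)).trans h)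
      rwa [map_zero] at this
    have hσ' : Ideal.Quotient.mk I (σ H) = Ideal.Quotient.mk I (σ (u true)) := by
      rw [← hmk]
      obtain ⟨t, ht⟩ := hu true
      refine ⟨(Γ ^ r) ^ (k + 1) * σ t, ?_⟩
      rw [show σ H - σ (u true) = σ (H - u true) from (PowerSeries.subst_sub hsub _ _).symm, ht,
        hσmul, hσpow, hσX]
      ring
    have h1 := (hmk H (u true)).1 (hu true)
    have h2 := (hmk B (u false)).1 (hu false)
    have h3 : Ideal.Quotient.mk I (err H B) = Ideal.Quotient.mk I 0 := by
      rw [map_zero, ← h0, herr, herr]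
      simp only [map_sub, map_mul, map_add, map_pow, hσ', h1, h2]
    have := PowerSeries.X_pow_dvd_iff.1 ((hmk _ _).2 h3) k (Nat.lt_succ_self k)
    simpa using this
  rw [herr, hBβ, sub_eq_zero] at hzero
  change σ H * Γ = _
  rw [hzero]
  ring

end RigidGerm

namespace RigidGerm
open MvPowerSeries

variable {Φ : FormalMap} {lam : ℂ} {G : FormalMap}

/-! ### Normal form of the second component -/

theorem mul_sub_mul_C_mem {n : ℕ} {x y : Series} {c : ℂ} (hx : x ∈ ordIdeal n)
    (hy : constantCoeff y = c) : x * y - x * C c ∈ ordIdeal (n + 1) := by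
  rw [← mul_sub]
  exact mul_mem_ordIdeal hx (mem_ordIdeal_one.2 (by simp [hy]))

/-- If the second component of `G` is `z ^ c w ^ d v`, the change of variable `w ↦ w U` replaces `v`
by a function `ρ` of `z` that contains, besides its constant term, only powers `z ^ i` with
`lam ^ i = d`. -/
theorem exists_resonant_unit (hG : G.IsCentered) (hlin : linPart G = !![lam, 0; 0, 0]) {d : ℕ}
    (hd : 1 ≤ d) {v : Series} (hv : constantCoeff v ≠ 0) :
    ∃ U ρ : Series, constantCoeff U = 1 ∧ constantCoeff ρ = constantCoeff v ∧
      (∀ e, coeff e ρ ≠ 0 → e 1 = 0 ∧ (e 0 = 0 ∨ lam ^ e 0 = d)) ∧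
      v * subst G U = U ^ d * ρ := by
  set v₀ := constantCoeff v with hv₀
  -- `u true` is `U` and `u false` is `ρ`
  let P : ℕ → (Bool → Series) → Prop := fun n u =>
    constantCoeff (u true) = 1 ∧ constantCoeff (u false) = v₀ ∧
    (∀ e, coeff e (u false) ≠ 0 → e 1 = 0 ∧ (e 0 = 0 ∨ lam ^ e 0 = d)) ∧
    v * subst G (u true) - u true ^ d * u false ∈ ordIdeal (n + 1)
  have step : ∀ n u, P n u → ∃ u', P (n + 1) u' ∧ ∀ i, u' i - u i ∈ ordIdeal n := by
    rintro n u ⟨hU, hρ, hres, herr⟩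
    set e := v * subst G (u true) - u true ^ d * u false with he
    obtain ⟨h, k, hh, hk, heq, hkres⟩ := exists_homological lam d
      (Ideal.mul_mem_left _ (C v₀⁻¹) herr)
    have hh0 : constantCoeff h = 0 :=
      mem_ordIdeal_one.1 (ordIdeal_anti (Nat.le_add_left 1 n) hh)
    have hk0 : constantCoeff k = 0 :=
      mem_ordIdeal_one.1 (ordIdeal_anti (Nat.le_add_left 1 n) hk)
    refine ⟨fun i => bif i then u true + h else u false + C v₀ * k,
      ⟨by simp [hU, hh0], by simp [hρ, hk0], fun m hm => ?_, ?_⟩, ?_⟩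
    · by_cases h1 : coeff m (u false) = 0
      · have h2 : coeff m k ≠ 0 := fun h2 => hm (by simp [h1, h2])
        have h3 := hkres m h2
        by_cases h4 : m 1 = 0
        · exact ⟨h4, Or.inr (by simpa [h4] using h3)⟩
        · simp only [zero_pow h4, mul_zero] at h3
          exact absurd (Nat.cast_eq_zero.1 h3.symm) (by omega)
      · exact hres m h1
    · simp only [cond_true, cond_false]
      set T := ∑ i ∈ Finset.range d, (u true + h) ^ i * u true ^ (d - 1 - i) with hT
      have hpow : (u true + h) ^ d = u true ^ d + h * T := by
        have := (Commute.all (u true + h) (u true)).mul_geom_sum₂ d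
        rw [add_sub_cancel_left] at this
        rw [this]
        ring
      have hT0 : constantCoeff (T * u false) = d * v₀ := by
        rw [map_mul, hρ, hT]
        simp [map_sum, hU, hh0]
      have b₁ : subst G h * v - subst G h * C v₀ ∈ ordIdeal (n + 1 + 1) :=
        mul_sub_mul_C_mem (subst_mem_ordIdeal hG hh) rfl
      have b₂ : subst G h - subst (diagMap lam) h ∈ ordIdeal (n + 1 + 1) := by
        rw [add_comm (n + 1)]
        exact subst_sub_subst_mem_of_mem hG (diagMap_isCentered lam) (m := 1)
          (sub_diagMap_mem hG hlin) hh
      have b₃ := mul_sub_mul_C_mem hh hT0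
      have b₄ : k * (u true + h) ^ d - k * C 1 ∈ ordIdeal (n + 1 + 1) :=
        mul_sub_mul_C_mem hk (by simp [hU, hh0])
      have := sub_mem (sub_mem (add_mem b₁ (Ideal.mul_mem_left _ (C v₀) b₂)) b₃)
        (Ideal.mul_mem_left _ (C v₀) b₄)
      rw [subst_add hG.hasSubst]
      convert this using 1
      have hvv : (C v₀ : Series) * C v₀⁻¹ = 1 := by
        rw [← map_mul, mul_inv_cancel₀ hv, map_one]
      rw [map_mul, map_one]
      linear_combination he + C v₀ * heq - (u false) * hpow - e * hvv
    · rintro (_ | _)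
      · simpa using Ideal.mul_mem_left _ (C v₀) (ordIdeal_anti (Nat.le_succ n) hk)
      · simpa using ordIdeal_anti (Nat.le_succ n) hh
  have base : P 0 (fun i => bif i then (1 : Series) else (C v₀ : Series)) := by
    refine ⟨by simp, by simp, fun e he => ?_, ?_⟩
    · simp only [cond_false, coeff_C] at he
      have : e = 0 := by by_contra h; simp [h] at he
      simp [this]
    · rw [zero_add, mem_ordIdeal_one]
      simp [hG.subst_one, hv₀]
  obtain ⟨L, hL⟩ := exists_limit P step (fun i => bif i then (1 : Series) else (C v₀ : Series)) base
  refine ⟨L true, L false, ?_, ?_, fun e he => ?_, ?_⟩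
  · obtain ⟨u, ⟨h, -⟩, hu⟩ := hL 1
    have := mem_ordIdeal_one.1 (hu true)
    rwa [map_sub, h, sub_eq_zero] at this
  · obtain ⟨u, ⟨-, h, -⟩, hu⟩ := hL 1
    have := mem_ordIdeal_one.1 (hu false)
    rwa [map_sub, h, sub_eq_zero] at this
  · obtain ⟨u, ⟨-, -, h, -⟩, hu⟩ := hL (e.degree + 1)
    refine h e ?_
    have := mem_ordIdeal_iff.1 (hu false) e (Nat.lt_succ_self _)
    rw [map_sub, sub_eq_zero] at this
    rwa [← this]
  · rw [← sub_eq_zero]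
    apply eq_zero_of_forall_mem_ordIdeal
    intro n
    obtain ⟨u, ⟨-, -, -, herr⟩, hu⟩ := hL n
    have c₁ := Ideal.mul_mem_left _ v (subst_mem_ordIdeal hG (hu true))
    have c₂ : L true ^ d - u true ^ d ∈ ordIdeal n :=
      Ideal.mem_of_dvd _ (sub_dvd_pow_sub_pow _ _ d) (hu true)
    have c₃ := Ideal.mul_mem_left _ (u true ^ d) (hu false)
    have := sub_mem (sub_mem (add_mem c₁ (ordIdeal_anti (Nat.le_succ n) herr))
      (Ideal.mul_mem_left _ (L false) c₂)) c₃
    rw [subst_sub hG.hasSubst] at this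
    convert this using 1
    ring

/-- Assembling a conjugacy `(z, w) ↦ (μ z, κ w U)` from a solution of the equation for `U`. -/
theorem formallyConj_of_resonant_unit {c d : ℕ} {v U ρ : Series} {μ κ : ℂ} {E : FormalMap}
    (hG : G.IsCentered) (hG1 : G 1 = X 0 ^ c * X 1 ^ d * v) (hU : constantCoeff U = 1)
    (hUρ : v * subst G U = U ^ d * ρ) (hμ : μ ≠ 0) (hκ : κ ≠ 0)
    (h0 : subst (![C μ * X 0, C κ * (X 1 * U)] : FormalMap) (E 0) = C μ * G 0)
    (h1 : subst (![C μ * X 0, C κ * (X 1 * U)] : FormalMap) (E 1) =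
      C κ * (X 0 ^ c * X 1 ^ d * U ^ d * ρ)) :
    FormallyConj G E := by
  have hUc : coeff (Finsupp.single 1 1) (X 1 * U) = 1 := by
    rw [← constantCoeff_eq_coeff_single, hU]
  have hΦ : IsFormalCoord (![C μ * X 0, C κ * (X 1 * U)] : FormalMap) := by
    refine isFormalCoord_vec (by simp) (by simp) ?_
    simp only [coeff_C_mul, hUc]
    simp [coeff_X, Finsupp.single_left_inj, hμ, hκ]
  refine ⟨_, hΦ, funext (Fin.forall_fin_two.2 ⟨?_, ?_⟩)⟩
  · refine Eq.trans ?_ h0.symm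
    change subst G (C μ * X 0) = _
    rw [subst_mul hG.hasSubst, subst_C, hG.subst_X]
  · refine Eq.trans ?_ h1.symm
    change subst G (C κ * (X 1 * U)) = _
    rw [subst_mul hG.hasSubst, subst_mul hG.hasSubst, subst_C, hG.subst_X, hG1]
    linear_combination C κ * (X 0 ^ c * X 1 ^ d) * hUρ

/-- A power series in `z` with exponents divisible by `r` is a power series in `z ^ r`. -/
theorem eq_subst_X_pow {r : ℕ} (hr : 0 < r) {s : Series}
    (hs : ∀ d, coeff d s ≠ 0 → d 1 = 0 ∧ r ∣ d 0) :
    ∃ f : PowerSeries ℂ, s = PowerSeries.subst (X 0 ^ r : Series) f := by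
  classical
  refine ⟨PowerSeries.mk fun k => coeff (Finsupp.single 0 (r * k)) s, ?_⟩
  have hsub : PowerSeries.HasSubst (X 0 ^ r : Series) :=
    PowerSeries.HasSubst.of_constantCoeff_zero (by simp [hr.ne'])
  ext d
  rw [PowerSeries.coeff_subst hsub]
  have hterm : ∀ k, coeff d ((X 0 ^ r : Series) ^ k) =
      if d = Finsupp.single 0 (r * k) then 1 else 0 :=
    fun k => by rw [← pow_mul, coeff_X_pow]
  by_cases hd : d 1 = 0 ∧ r ∣ d 0
  · obtain ⟨h1, k, hk⟩ := hd
    have hdk : d = Finsupp.single 0 (r * k) := by ext i; fin_cases i <;> simp [h1, hk]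
    rw [finsum_eq_single _ k]
    · rw [hterm, if_pos hdk, hdk]
      simp
    · intro j hj
      rw [hterm, if_neg, smul_zero]
      rw [hdk]
      intro h
      have h2 := DFunLike.congr_fun h 0
      simp at h2
      rcases h2 with h2 | h2
      · exact hj h2.symm
      · omega
  · rw [not_imp_comm.1 (hs d) hd, finsum_eq_zero_of_forall_eq_zero]
    intro k
    rw [hterm, if_neg, smul_zero]
    rintro rfl
    exact hd (by simp)

theorem constantCoeff_subst_X_pow {r : ℕ} (hr : 0 < r) (f : PowerSeries ℂ) :
    constantCoeff (PowerSeries.subst (X 0 ^ r : Series) f) = PowerSeries.constantCoeff f := by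
  have hsub : PowerSeries.HasSubst (X 0 ^ r : Series) :=
    PowerSeries.HasSubst.of_constantCoeff_zero (by simp [hr.ne'])
  obtain ⟨t, ht⟩ : PowerSeries.X ∣ f - PowerSeries.C (PowerSeries.constantCoeff f) :=
    PowerSeries.X_dvd_iff.2 (by simp)
  rw [show f = PowerSeries.C (PowerSeries.constantCoeff f) + PowerSeries.X * t by rw [← ht]; ring,
    PowerSeries.subst_add hsub, PowerSeries.subst_mul hsub, PowerSeries.subst_C,
    PowerSeries.subst_X hsub]
  simp [hr.ne']

theorem subst_powerSeries_subst (hΦ : Φ.IsCentered) {a : Series} (ha : constantCoeff a = 0)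
    (f : PowerSeries ℂ) :
    subst Φ (PowerSeries.subst a f) = PowerSeries.subst (subst Φ a) f :=
  subst_comp_subst_apply (PowerSeries.HasSubst.of_constantCoeff_zero ha).const hΦ.hasSubst f

/-- If the only resonance is the linear one, the first component of the normal form is linear. -/
theorem eq_C_mul_X_of_resonant (hG : G.IsCentered) (hlin : linPart G = !![lam, 0; 0, 0])
    (hres : ∀ d, coeff d (G 0) ≠ 0 → d 1 = 0 ∧ lam ^ d 0 = lam)
    (h : ∀ n, n ≠ 0 → lam ^ n = lam → n = 1) : G 0 = C lam * X 0 := by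
  classical
  ext d
  have hl : coeff (Finsupp.single 0 1) (G 0) = lam := by rw [← linPart_apply, hlin]; simp
  rw [coeff_C_mul, coeff_X]
  split_ifs with hd
  · rw [hd, hl, mul_one]
  · rw [mul_zero]
    by_contra hne
    obtain ⟨h1, h2⟩ := hres d hne
    by_cases h0 : d 0 = 0
    · have : d = 0 := by ext i; fin_cases i <;> simp [h0, h1]
      subst this
      exact hne (hG 0)
    · refine hd ?_
      ext i; fin_cases i
      · simp [h _ h0 h2]
      · simp [h1]

theorem exists_pow_eq_ne_zero {n : ℕ} (hn : 1 ≤ n) {a : ℂ} (ha : a ≠ 0) :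
    ∃ x : ℂ, x ≠ 0 ∧ x ^ n = a := by
  obtain ⟨x, hx⟩ := IsAlgClosed.exists_pow_nat_eq a hn
  refine ⟨x, ?_, hx⟩
  rintro rfl
  exact ha (by rw [← hx, zero_pow (by omega)])

/-- Normalization when the second component has no resonance other than the constant one. -/
theorem formallyConj_monomial (hG : G.IsCentered) (hlin : linPart G = !![lam, 0; 0, 0])
    (hG0 : G 0 = C lam * X 0) {c d : ℕ} (hd : 1 ≤ d) (hcd : 2 ≤ c + d) {v : Series} (hv : IsUnit v)
    (hG1 : G 1 = X 0 ^ c * X 1 ^ d * v) (hres : ∀ n, n ≠ 0 → lam ^ n ≠ d) :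
    FormallyConj G ![const lam * zVar, zVar ^ c * wVar ^ d] := by
  classical
  rw [isUnit_iff_ne] at hv
  obtain ⟨U, ρ, hU, hρ, hρres, hUρ⟩ := exists_resonant_unit hG hlin hd hv
  set v₀ := constantCoeff v with hv₀
  have hρC : ρ = C v₀ := by
    ext e
    rw [coeff_C]
    split_ifs with he
    · rw [he]; exact hρ
    · by_contra hne
      obtain ⟨h1, h0 | h0⟩ := hρres e hne
      · exact he (by ext i; fin_cases i <;> simp [h0, h1])
      · exact hres (e 0) (fun h => he (by ext i; fin_cases i <;> simp [h, h1])) h0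
  -- the diagonal map with entries `μ`, `κ` multiplies the coefficient by `μ ^ c κ ^ (d - 1)`, which
  -- takes every non-zero value because `c + d ≥ 2`
  obtain ⟨μ, κ, hμ, hκ, hμκ⟩ : ∃ μ κ : ℂ, μ ≠ 0 ∧ κ ≠ 0 ∧ μ ^ c * κ ^ (d - 1) = v₀ := by
    rcases Nat.lt_or_ge 1 d with h | h
    · obtain ⟨κ, hκ, hκ'⟩ := exists_pow_eq_ne_zero (by omega : 1 ≤ d - 1) hv
      exact ⟨1, κ, one_ne_zero, hκ, by rw [one_pow, one_mul, hκ']⟩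
    · obtain ⟨μ, hμ, hμ'⟩ := exists_pow_eq_ne_zero (by omega : 1 ≤ c) hv
      exact ⟨μ, 1, hμ, one_ne_zero, by rw [one_pow, mul_one, hμ']⟩
  have hc : FormalMap.IsCentered ![C μ * X 0, C κ * (X 1 * U)] :=
    isCentered_vec (by simp) (by simp)
  refine formallyConj_of_resonant_unit hG hG1 hU hUρ hμ hκ ?_ ?_
  · change subst _ (C lam * X 0) = _
    rw [subst_mul hc.hasSubst, subst_C, hc.subst_X, hG0]
    simp
    ring
  · change subst _ (X 0 ^ c * X 1 ^ d) = _
    rw [subst_mul hc.hasSubst, subst_pow hc.hasSubst, subst_pow hc.hasSubst, hc.subst_X,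
      hc.subst_X, hρC, ← hμκ]
    obtain ⟨d, rfl⟩ : ∃ d', d = d' + 1 := ⟨d - 1, by omega⟩
    simp
    ring

/-- Normalization when the second component has at most one resonance besides the constant one. -/
theorem formallyConj_monomial_mul (hG : G.IsCentered) (hlin : linPart G = !![lam, 0; 0, 0])
    (hG0 : G 0 = C lam * X 0) {c d l : ℕ} (hd : 2 ≤ d) {v : Series}
    (hv : IsUnit v) (hG1 : G 1 = X 0 ^ c * X 1 ^ d * v) (hl : l ≠ 0)
    (hres : ∀ n, lam ^ n = d → n = l) :
    ∃ ε : ℂ, (ε = 0 ∨ ε = 1) ∧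
    FormallyConj G ![const lam * zVar, zVar ^ c * wVar ^ d * (1 + const ε * zVar ^ l)] := by
  classical
  rw [isUnit_iff_ne] at hv
  obtain ⟨U, ρ, hU, hρ, hρres, hUρ⟩ := exists_resonant_unit hG hlin (one_le_two.trans hd) hv
  set v₀ := constantCoeff v with hv₀
  set e := coeff (Finsupp.single 0 l) ρ with he
  have hρC : ρ = C v₀ + C e * X 0 ^ l := by
    ext m
    rw [map_add, coeff_C, coeff_C_mul, coeff_X_pow]
    by_cases hm : m = 0
    · subst hm
      have : (0 : Fin 2 →₀ ℕ) ≠ Finsupp.single 0 l := fun h => by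
        have := DFunLike.congr_fun h 0
        simp at this
        exact hl this.symm
      rw [if_pos rfl, if_neg this, mul_zero, add_zero]
      exact hρ
    · rw [if_neg hm, zero_add]
      split_ifs with hml
      · rw [hml, mul_one]
      · rw [mul_zero]
        by_contra hne
        obtain ⟨h1, h0 | h0⟩ := hρres m hne
        · exact hm (by ext i; fin_cases i <;> simp [h0, h1])
        · exact hml (by ext i; fin_cases i <;> simp [hres _ h0, h1])
  obtain ⟨μ, ε, hμ, hε, hμε⟩ : ∃ μ ε : ℂ, μ ≠ 0 ∧ (ε = 0 ∨ ε = 1) ∧ v₀ * (ε * μ ^ l) = e := by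
    by_cases h0 : e = 0
    · exact ⟨1, 0, one_ne_zero, Or.inl rfl, by simp [h0]⟩
    · obtain ⟨μ, hμ, hμ'⟩ := exists_pow_eq_ne_zero (by omega : 1 ≤ l) (div_ne_zero h0 hv)
      exact ⟨μ, 1, hμ, Or.inr rfl, by rw [hμ', one_mul, mul_div_cancel₀ _ hv]⟩
  obtain ⟨κ, hκ, hκ'⟩ := exists_pow_eq_ne_zero (by omega : 1 ≤ d - 1)
    (div_ne_zero hv (pow_ne_zero c hμ))
  have hμκ : μ ^ c * κ ^ (d - 1) = v₀ := by rw [hκ', mul_div_cancel₀ _ (pow_ne_zero c hμ)]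
  have hc : FormalMap.IsCentered ![C μ * X 0, C κ * (X 1 * U)] :=
    isCentered_vec (by simp) (by simp)
  refine ⟨ε, hε, formallyConj_of_resonant_unit hG hG1 hU hUρ hμ hκ ?_ ?_⟩
  · change subst _ (C lam * X 0) = _
    rw [subst_mul hc.hasSubst, subst_C, hc.subst_X, hG0]
    simp
    ring
  · change subst _ (X 0 ^ c * X 1 ^ d * (1 + C ε * X 0 ^ l)) = _
    simp only [subst_mul hc.hasSubst, subst_add hc.hasSubst, subst_pow hc.hasSubst, hc.subst_X,
      hc.subst_one, subst_C]
    rw [hρC, ← hμε, ← hμκ]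
    obtain ⟨d, rfl⟩ : ∃ d', d = d' + 1 := ⟨d - 1, by omega⟩
    simp
    ring

/-- Normalization of the second component when the multiplier is a root of unity. -/
theorem formallyConj_root_of_unity {r : ℕ} (hr : 0 < r) (hlam : IsPrimitiveRoot lam r)
    (hG : G.IsCentered) (hlin : linPart G = !![lam, 0; 0, 0]) {c d : ℕ} (hd : 1 ≤ d)
    {v : Series} (hv : IsUnit v) (hG1 : G 1 = X 0 ^ c * X 1 ^ d * v) :
    ∃ ε : PowerSeries ℂ, PowerSeries.constantCoeff ε ≠ -1 ∧ (2 ≤ d → ε = 0) ∧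
      ∀ g : Series, G 0 = g →
        (∀ Φ : FormalMap, Φ.IsCentered → Φ 0 = X 0 → subst Φ g = g) →
        FormallyConj G ![g, zVar ^ c * wVar ^ d * (1 + PowerSeries.subst (zVar ^ r) ε)] := by
  classical
  rw [isUnit_iff_ne] at hv
  obtain ⟨U, ρ, hU, hρ, hρres, hUρ⟩ := exists_resonant_unit hG hlin hd hv
  set v₀ := constantCoeff v with hv₀
  have hsub : PowerSeries.HasSubst (X 0 ^ r : Series) :=
    PowerSeries.HasSubst.of_constantCoeff_zero (by simp [hr.ne'])
  obtain ⟨κ, ε, hκ, hε, hεd, hκε⟩ : ∃ (κ : ℂ) (ε : PowerSeries ℂ), κ ≠ 0 ∧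
      PowerSeries.constantCoeff ε ≠ -1 ∧ (2 ≤ d → ε = 0) ∧
      C (κ ^ (d - 1)) * (1 + PowerSeries.subst (X 0 ^ r : Series) ε) = ρ := by
    rcases Nat.lt_or_ge 1 d with h | h
    · obtain ⟨κ, hκ, hκ'⟩ := exists_pow_eq_ne_zero (by omega : 1 ≤ d - 1) hv
      refine ⟨κ, 0, hκ, by simp, fun _ => rfl, ?_⟩
      have h0 : PowerSeries.subst (X 0 ^ r : Series) (0 : PowerSeries ℂ) = 0 := by
        rw [← PowerSeries.coe_substAlgHom hsub, map_zero]
      rw [h0, add_zero, mul_one, hκ']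
      ext e
      rw [coeff_C]
      split_ifs with he
      · rw [he]; exact hρ.symm
      · symm
        by_contra hne
        obtain ⟨h1, h0 | h0⟩ := hρres e hne
        · exact he (by ext i; fin_cases i <;> simp [h0, h1])
        · have := congrArg (‖·‖) h0
          simp only [norm_pow, hlam.norm'_eq_one hr.ne', one_pow, Complex.norm_natCast] at this
          exact absurd (Nat.cast_eq_one.1 this.symm) (by omega)
    · have hd1 : d = 1 := by omega
      obtain ⟨f, hf⟩ := eq_subst_X_pow hr (s := ρ) fun e he => by
        obtain ⟨h1, h0 | h0⟩ := hρres e he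
        · exact ⟨h1, h0 ▸ dvd_zero r⟩
        · exact ⟨h1, hlam.dvd_of_pow_eq_one _ (by rw [h0, hd1, Nat.cast_one])⟩
      refine ⟨1, f - 1, one_ne_zero, ?_, by omega, ?_⟩
      · rw [map_sub, map_one, ← constantCoeff_subst_X_pow hr f, ← hf, hρ]
        intro h
        exact hv (by linear_combination h)
      · rw [PowerSeries.subst_sub hsub, ← hf]
        have h1 : PowerSeries.subst (X 0 ^ r : Series) (1 : PowerSeries ℂ) = 1 := by
          rw [← PowerSeries.coe_substAlgHom hsub, map_one]
        rw [h1]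
        simp
  refine ⟨ε, hε, hεd, fun g hg hinv => ?_⟩
  have hc : FormalMap.IsCentered ![C 1 * X 0, C κ * (X 1 * U)] :=
    isCentered_vec (by simp) (by simp)
  refine formallyConj_of_resonant_unit hG hG1 hU hUρ one_ne_zero hκ ?_ ?_
  · change subst _ g = _
    rw [hinv _ hc (by simp), hg]
    simp
  · change subst _ (X 0 ^ c * X 1 ^ d * (1 + PowerSeries.subst (X 0 ^ r : Series) ε)) = _
    simp only [subst_mul hc.hasSubst, subst_add hc.hasSubst, subst_pow hc.hasSubst, hc.subst_X,
      hc.subst_one]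
    rw [subst_powerSeries_subst hc (by simp [hr.ne']), subst_pow hc.hasSubst, hc.subst_X, ← hκε]
    obtain ⟨d, rfl⟩ : ∃ d', d = d' + 1 := ⟨d - 1, by omega⟩
    simp
    ring

/-- When the multiplier is a root of unity of order `r`, the first component of a resonant form `G`
can be reduced to `lam z` or `lam z (1 + z ^ s + β z ^ (2 s))`, and the second component remains a
monomial up to a unit. -/
theorem exists_parabolic_conj {r : ℕ} (hr : 0 < r) (hlam : IsPrimitiveRoot lam r)
    (hG : G.IsCentered) (hlin : linPart G = !![lam, 0; 0, 0])
    (hres : ∀ d, coeff d (G 0) ≠ 0 → d 1 = 0 ∧ lam ^ d 0 = lam) {c d : ℕ} (hcd : 2 ≤ c + d)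
    {v : Series} (hv : IsUnit v) (hG1 : G 1 = X 0 ^ c * X 1 ^ d * v) :
    ∃ (E : FormalMap) (v' : Series), E.IsCentered ∧ linPart E = !![lam, 0; 0, 0] ∧ IsUnit v' ∧
      E 1 = X 0 ^ c * X 1 ^ d * v' ∧ FormallyConj G E ∧
      ((∃ (s : ℕ) (β : ℂ), 1 ≤ s ∧ r ∣ s ∧
        E 0 = C lam * X 0 * (1 + X 0 ^ s + C β * X 0 ^ (2 * s))) ∨ E 0 = C lam * X 0) := by
  have hlam0 : lam ≠ 0 := hlam.ne_zero hr.ne'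
  have hsub : PowerSeries.HasSubst (X 0 ^ r : Series) :=
    PowerSeries.HasSubst.of_constantCoeff_zero (by simp [hr.ne'])
  obtain ⟨g, hg⟩ : X 0 ∣ G 0 := by
    rw [X_dvd_iff]
    intro d hd
    by_contra hne
    have h0 : d = 0 := by ext i; fin_cases i <;> simp [hd, (hres d hne).1]
    subst h0
    exact hne (hG 0)
  obtain ⟨Γ, hΓ⟩ := eq_subst_X_pow hr (s := C lam⁻¹ * g) fun e he => by
    rw [coeff_C_mul] at he
    obtain ⟨h1, h0⟩ := hres (e + Finsupp.single 0 1)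
      (by rw [hg, coeff_add_single_X_mul]; exact right_ne_zero_of_mul he)
    refine ⟨by simpa using h1, hlam.dvd_of_pow_eq_one _ ?_⟩
    simp only [Finsupp.add_apply, Finsupp.single_eq_same, pow_succ] at h0
    exact mul_right_cancel₀ hlam0 (by rw [h0, one_mul])
  have hg0 : constantCoeff g = lam := by
    rw [constantCoeff_eq_coeff_single (i := 0), ← hg, ← linPart_apply, hlin]
    simp
  have hΓ0 : PowerSeries.constantCoeff Γ = 1 := by
    rw [← constantCoeff_subst_X_pow hr Γ, ← hΓ, map_mul, hg0]
    simp [hlam0]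
  have hll : (C lam : Series) * C lam⁻¹ = 1 := by
    rw [← map_mul, mul_inv_cancel₀ hlam0, map_one]
  have hG0 : G 0 = C lam * X 0 * PowerSeries.subst (X 0 ^ r : Series) Γ := by
    rw [← hΓ, hg]
    linear_combination -(X 0 * g) * hll
  by_cases hΓ1 : Γ = 1
  · have h1 : PowerSeries.subst (X 0 ^ r : Series) (1 : PowerSeries ℂ) = 1 := by
      rw [← PowerSeries.coe_substAlgHom hsub, map_one]
    refine ⟨G, v, hG, hlin, hv, hG1, ⟨X, isFormalCoord_of_sub_X_mem (by simp), ?_⟩, Or.inr ?_⟩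
    · funext i
      change subst G (X i) = subst X (G i)
      rw [hG.subst_X, subst_X_eq]
    · rw [hG0, hΓ1, h1, mul_one]
  obtain ⟨S, γ, hS, hΓγ, hγ⟩ : ∃ (S : ℕ) (γ : PowerSeries ℂ), 1 ≤ S ∧
      Γ = 1 + PowerSeries.X ^ S * γ ∧ PowerSeries.constantCoeff γ ≠ 0 := by
    have hne : Γ - 1 ≠ 0 := sub_ne_zero.2 hΓ1
    obtain ⟨γ, hγ⟩ := PowerSeries.X_pow_order_dvd (φ := Γ - 1)
    have hγ0 := PowerSeries.coeff_order hne
    set S := (Γ - 1).order.toNat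
    rw [hγ, PowerSeries.coeff_X_pow_mul', if_pos le_rfl, Nat.sub_self,
      PowerSeries.coeff_zero_eq_constantCoeff_apply] at hγ0
    refine ⟨S, γ, Nat.one_le_iff_ne_zero.2 fun h0 => hγ0 ?_, by rw [← hγ]; ring, hγ0⟩
    rw [h0, pow_zero, one_mul] at hγ
    rw [← hγ, map_sub, hΓ0, map_one, sub_self]
  obtain ⟨H, β, hH, hHeq⟩ := exists_parabolic_form hr hS hΓγ hγ
  set τ : PowerSeries ℂ → Series := PowerSeries.subst (X 0 ^ r : Series) with hτ
  have hτX : τ PowerSeries.X = X 0 ^ r := PowerSeries.subst_X hsub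
  have hτadd : ∀ s t, τ (s + t) = τ s + τ t := fun s t => PowerSeries.subst_add hsub s t
  have hτmul : ∀ s t, τ (s * t) = τ s * τ t := fun s t => PowerSeries.subst_mul hsub s t
  have hτpow : ∀ s n, τ (s ^ n) = τ s ^ n := fun s n => PowerSeries.subst_pow hsub s n
  have hτC : ∀ c : ℂ, τ (PowerSeries.C c) = C c := fun c => PowerSeries.subst_C c
  have hτ1 : τ 1 = 1 := by rw [hτ, ← PowerSeries.coe_substAlgHom hsub, map_one]
  have hHu : IsUnit (τ H) := by
    rw [isUnit_iff_ne, hτ, constantCoeff_subst_X_pow hr]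
    exact hH
  set Φ : FormalMap := ![X 0 * τ H, X 1] with hΦdef
  have hΦ : IsFormalCoord Φ := by
    refine isFormalCoord_vec (by simp) (by simp) ?_
    rw [← constantCoeff_eq_coeff_single (i := 0)]
    simpa [coeff_X, Finsupp.single_left_inj] using isUnit_iff_ne.1 hHu
  have hΦc := hΦ.isCentered
  obtain ⟨k, hk⟩ := hHu.exists_right_inv
  obtain ⟨v', hv'⟩ := hΦ.exists_subst_eq (v * k ^ c)
  have hv'u : IsUnit v' := hΦ.isUnit_of_subst
    (hv' ▸ hv.mul ((IsUnit.of_mul_eq_one_right _ hk).pow c))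
  set E : FormalMap := ![C lam * X 0 * (1 + X 0 ^ (r * S) + C β * X 0 ^ (2 * (r * S))),
    X 0 ^ c * X 1 ^ d * v'] with hE
  have hEc : E.IsCentered := by
    refine isCentered_vec (by simp) ?_
    rcases Nat.eq_zero_or_pos c with rfl | h
    · simp [show d ≠ 0 by omega]
    · simp [show c ≠ 0 by omega]
  have hconj : Φ.comp G = E.comp Φ := by
    refine funext (Fin.forall_fin_two.2 ⟨?_, ?_⟩)
    -- `lam` drops out of the equation in the variable `z ^ r` because `lam ^ r = 1`
    · have hpow : subst G (X 0 ^ r : Series) = τ (PowerSeries.X * Γ ^ r) := by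
        rw [subst_pow hG.hasSubst, hG.subst_X, hG0, hτmul, hτX, hτpow, mul_pow, mul_pow, ← map_pow,
          hlam.pow_eq_one]
        simp
      have e₁ : subst G (τ H) = τ (PowerSeries.subst (PowerSeries.X * Γ ^ r) H) := by
        rw [hτ, subst_powerSeries_subst hG (by simp [hr.ne']), hpow]
        symm
        exact PowerSeries.subst_comp_subst_apply
          (PowerSeries.HasSubst.of_constantCoeff_zero' (by simp)) hsub H
      have e₂ := congrArg τ hHeq
      simp only [hτmul, hτadd, hτpow, hτX, hτC, hτ1] at e₂
      change subst G (X 0 * τ H) =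
        subst Φ (C lam * X 0 * (1 + X 0 ^ (r * S) + C β * X 0 ^ (2 * (r * S))))
      simp only [subst_mul hG.hasSubst, hG.subst_X, e₁, subst_mul hΦc.hasSubst,
        subst_add hΦc.hasSubst, subst_pow hΦc.hasSubst, hΦc.subst_X, hΦc.subst_one, subst_C]
      change G 0 * _ = C lam * (X 0 * τ H) * (1 + (X 0 * τ H) ^ (r * S) +
        C β * (X 0 * τ H) ^ (2 * (r * S)))
      rw [hG0]
      linear_combination C lam * X 0 * e₂
    · change subst G (X 1) = subst Φ (X 0 ^ c * X 1 ^ d * v')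
      simp only [hG.subst_X, subst_mul hΦc.hasSubst, subst_pow hΦc.hasSubst, hΦc.subst_X, hv', hG1]
      change _ = (X 0 * τ H) ^ c * X 1 ^ d * (v * k ^ c)
      have : τ H ^ c * k ^ c = 1 := by rw [← mul_pow, hk, one_pow]
      linear_combination -(X 0 ^ c * X 1 ^ d * v) * this
  refine ⟨E, v', hEc, ?_, hv'u, rfl, ⟨Φ, hΦ, hconj⟩, Or.inl ⟨r * S, β, ?_, dvd_mul_right _ _, rfl⟩⟩
  · refine linPart_eq_of_sub_diagMap_mem (Fin.forall_fin_two.2 ⟨?_, ?_⟩)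
    · have h1 : ∀ n, n ≠ 0 → (X 0 ^ n : Series) ∈ ordIdeal 1 := fun n hn =>
        mem_ordIdeal_one.2 (by simp [hn])
      have hs : r * S ≠ 0 := (Nat.mul_pos hr hS).ne'
      have := mul_mem_ordIdeal (Ideal.mul_mem_left _ (C lam) (X_mem_ordIdeal 0))
        (add_mem (h1 (r * S) hs) (Ideal.mul_mem_left _ (C β) (h1 (2 * (r * S)) (by omega))))
      convert this using 1
      change C lam * X 0 * (1 + X 0 ^ (r * S) + C β * X 0 ^ (2 * (r * S))) - C lam * X 0 = _
      ring
    · have hp : ∀ (i : Fin 2) n, (X i ^ n : Series) ∈ ordIdeal n := fun i n => by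
        rw [mem_ordIdeal, X_pow_eq, order_monomial_of_ne_zero one_ne_zero]
        simp
      have := Ideal.mul_mem_right v' _ (mul_mem_ordIdeal (hp 0 c) (hp 1 d))
      simpa [diagMap, hE] using ordIdeal_anti hcd this
  · exact Nat.mul_pos hr hS

end RigidGerm

namespace RigidGerm
open MvPowerSeries Asymptotics

/-! ### Taylor expansions -/

/-- The value of a polynomial in two variables at a point of `ℂ × ℂ`. -/
def polyEval (P : MvPolynomial (Fin 2) ℂ) (p : ℂ × ℂ) : ℂ := MvPolynomial.eval ![p.1, p.2] P

/-- The power series `s` is the asymptotic expansion of `g` at the origin. -/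
def HasExpansion (g : ℂ × ℂ → ℂ) (s : Series) : Prop :=
  ∀ n : ℕ, ∃ P : MvPolynomial (Fin 2) ℂ, s - (P : Series) ∈ ordIdeal n ∧
    (fun p => g p - polyEval P p) =O[𝓝 0] fun p => ‖p‖ ^ n

theorem isBigO_norm_pow {m n : ℕ} (h : n ≤ m) :
    (fun p : ℂ × ℂ => ‖p‖ ^ m) =O[𝓝 0] fun p => ‖p‖ ^ n := by
  refine IsBigO.of_bound 1 ?_
  filter_upwards [Metric.closedBall_mem_nhds (0 : ℂ × ℂ) one_pos] with p hp
  rw [mem_closedBall_zero_iff] at hp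
  simpa using pow_le_pow_of_le_one (norm_nonneg p) hp h

theorem polyEval_isBigO {P : MvPolynomial (Fin 2) ℂ} {n : ℕ} (h : (P : Series) ∈ ordIdeal n) :
    polyEval P =O[𝓝 0] fun p => ‖p‖ ^ n := by
  have : polyEval P = fun p => ∑ d ∈ P.support, P.coeff d * (p.1 ^ d 0 * p.2 ^ d 1) := by
    funext p
    rw [polyEval, MvPolynomial.eval_eq']
    simp
  rw [this]
  refine IsBigO.fun_sum fun d hd => ?_
  have hdeg : n ≤ d 0 + d 1 := by
    by_contra hlt
    have := mem_ordIdeal_iff.1 h d (by simpa [Finsupp.degree_eq_sum, Fin.sum_univ_two] using hlt)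
    rw [MvPolynomial.coeff_coe] at this
    exact MvPolynomial.mem_support_iff.1 hd this
  refine IsBigO.trans ?_ (isBigO_norm_pow hdeg)
  refine IsBigO.const_mul_left ?_ _
  refine IsBigO.of_bound 1 (Eventually.of_forall fun p => ?_)
  rw [norm_mul, norm_pow, norm_pow, one_mul, norm_pow, norm_norm, pow_add]
  exact mul_le_mul (pow_le_pow_left₀ (norm_nonneg _) (norm_fst_le p) _)
    (pow_le_pow_left₀ (norm_nonneg _) (norm_snd_le p) _) (by positivity) (by positivity)

theorem polyEval_isBigO_one (P : MvPolynomial (Fin 2) ℂ) :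
    polyEval P =O[𝓝 0] fun _ => (1 : ℝ) := by
  simpa using polyEval_isBigO (mem_ordIdeal_zero (P : Series))

namespace HasExpansion

variable {g h : ℂ × ℂ → ℂ} {s t : Series}

theorem congr (hg : HasExpansion g s) (e : g =ᶠ[𝓝 0] h) : HasExpansion h s := fun n => by
  obtain ⟨P, h₁, h₂⟩ := hg n
  refine ⟨P, h₁, h₂.congr' ?_ EventuallyEq.rfl⟩
  filter_upwards [e] with p hp
  rw [hp]

theorem of_polyEval (P : MvPolynomial (Fin 2) ℂ) : HasExpansion (polyEval P) P := fun n =>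
  ⟨P, by simp, by simpa using isBigO_zero _ _⟩

theorem isBigO_one (hg : HasExpansion g s) : g =O[𝓝 0] fun _ => (1 : ℝ) := by
  obtain ⟨P, -, h⟩ := hg 0
  simp only [pow_zero] at h
  exact (h.add (polyEval_isBigO_one P)).congr_left fun p => sub_add_cancel _ _

theorem isBigO (hg : HasExpansion g s) {n : ℕ} (hs : s ∈ ordIdeal n) :
    g =O[𝓝 0] fun p => ‖p‖ ^ n := by
  obtain ⟨P, h₁, h⟩ := hg n
  have hP : (P : Series) ∈ ordIdeal n := by simpa using sub_mem hs h₁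
  simpa using h.add (polyEval_isBigO hP)

theorem add (hg : HasExpansion g s) (hh : HasExpansion h t) :
    HasExpansion (fun p => g p + h p) (s + t) := fun n => by
  obtain ⟨P, h₁, h₂⟩ := hg n
  obtain ⟨Q, h₃, h₄⟩ := hh n
  refine ⟨P + Q, ?_, ?_⟩
  · rw [MvPolynomial.coe_add, add_sub_add_comm]
    exact add_mem h₁ h₃
  · refine (h₂.add h₄).congr_left fun p => ?_
    simp only [polyEval, map_add]
    ring

theorem mul (hg : HasExpansion g s) (hh : HasExpansion h t) :
    HasExpansion (fun p => g p * h p) (s * t) := fun n => by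
  obtain ⟨P, h₁, h₂⟩ := hg n
  obtain ⟨Q, h₃, h₄⟩ := hh n
  refine ⟨P * Q, ?_, ?_⟩
  · rw [MvPolynomial.coe_mul, show s * t - (P : Series) * Q = (s - P) * t + P * (t - Q) by ring]
    exact add_mem (Ideal.mul_mem_right _ _ h₁) (Ideal.mul_mem_left _ _ h₃)
  · have e₁ := h₂.mul hh.isBigO_one
    have e₂ := (polyEval_isBigO_one P).mul h₄
    simp only [mul_one, one_mul] at e₁ e₂
    refine (e₁.add e₂).congr_left fun p => ?_
    simp only [polyEval, map_mul]
    ring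

theorem const (c : ℂ) : HasExpansion (fun _ => c) (C c) := by
  have h := of_polyEval (MvPolynomial.C c)
  rw [MvPolynomial.coe_C] at h
  exact h.congr (Eventually.of_forall fun p => by simp [polyEval])

theorem sub (hg : HasExpansion g s) (hh : HasExpansion h t) :
    HasExpansion (fun p => g p - h p) (s - t) := by
  have := hg.add ((const (-1)).mul hh)
  convert this using 1
  · funext p; ring
  · rw [map_neg, map_one]; ring

theorem comp {f : ℂ × ℂ → ℂ × ℂ} {F : FormalMap} (hg : HasExpansion g s)
    (h0 : HasExpansion (fun p => (f p).1) (F 0)) (h1 : HasExpansion (fun p => (f p).2) (F 1))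
    (hF : F.IsCentered) : HasExpansion (g ∘ f) (subst F s) := fun n => by
  have hf : f =O[𝓝 0] fun p => ‖p‖ := by
    have a := h0.isBigO (hF.mem 0)
    have b := h1.isBigO (hF.mem 1)
    simp only [pow_one] at a b
    exact a.prod_left b
  have hf0 : Tendsto f (𝓝 0) (𝓝 0) := hf.trans_tendsto (by
    simpa using (continuous_norm (E := ℂ × ℂ)).tendsto 0)
  have hpoly : ∀ P : MvPolynomial (Fin 2) ℂ,
      HasExpansion (polyEval P ∘ f) (subst F (P : Series)) := by
    intro P
    rw [subst_coe]
    induction P using MvPolynomial.induction_on with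
    | C c =>
      simpa [polyEval, Function.comp_def, MvPowerSeries.algebraMap_apply] using HasExpansion.const c
    | add P Q hP hQ => simpa [polyEval, Function.comp_def] using hP.add hQ
    | mul_X P i hP =>
      have hX : HasExpansion (fun p => ![(f p).1, (f p).2] i) (F i) := by
        fin_cases i
        exacts [h0, h1]
      simpa [polyEval, Function.comp_def] using hP.mul hX
  obtain ⟨P, h₁, h₂⟩ := hg n
  obtain ⟨Q, h₃, h₄⟩ := hpoly P n
  refine ⟨Q, ?_, ?_⟩
  · have := add_mem (subst_mem_ordIdeal hF h₁) h₃
    rw [subst_sub hF.hasSubst] at this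
    simpa using this
  · have := (h₂.comp_tendsto hf0).trans ((hf.norm_left).pow n)
    refine (this.add h₄).congr_left fun p => ?_
    simp

/-- By induction on `n`, a polynomial approximating `s` to order `n + 1` has no terms of degree less
than `n`, and its homogeneous part of degree `n` vanishes since it is `O(t ^ (n + 1))` on every
line. -/
theorem eq_zero (h : HasExpansion (fun _ => 0) s) : s = 0 := by
  apply eq_zero_of_forall_mem_ordIdeal
  intro n
  induction n with
  | zero => exact mem_ordIdeal_zero _
  | succ n ih =>
    obtain ⟨P, h₁, h₂⟩ := h (n + 1)
    have hP : (P : Series) ∈ ordIdeal n := by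
      simpa using sub_mem ih (ordIdeal_anti (Nat.le_succ n) h₁)
    have hP' : polyEval P =O[𝓝 0] fun p => ‖p‖ ^ (n + 1) := by simpa using h₂
    set Q := MvPolynomial.homogeneousComponent n P with hQ
    have hQh : Q.IsHomogeneous n := MvPolynomial.homogeneousComponent_isHomogeneous n P
    have hPQ : ((P - Q : MvPolynomial (Fin 2) ℂ) : Series) ∈ ordIdeal (n + 1) := by
      rw [mem_ordIdeal_iff] at hP ⊢
      intro d hd
      rw [MvPolynomial.coeff_coe, MvPolynomial.coeff_sub, hQ,
        MvPolynomial.coeff_homogeneousComponent]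
      split_ifs with hdn
      · simp
      · have := hP d (by omega)
        rw [MvPolynomial.coeff_coe] at this
        simp [this]
    have hQO : polyEval Q =O[𝓝 0] fun p => ‖p‖ ^ (n + 1) := by
      refine (hP'.sub (polyEval_isBigO hPQ)).congr_left fun p => ?_
      simp [polyEval]
    have hQ0 : Q = 0 := by
      refine MvPolynomial.funext fun x => ?_
      rw [map_zero]
      have hline : Tendsto (fun t : ℂ => t • ((x 0, x 1) : ℂ × ℂ)) (𝓝[≠] 0) (𝓝 0) := by
        have : Continuous fun t : ℂ => t • ((x 0, x 1) : ℂ × ℂ) := by fun_prop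
        simpa using (this.tendsto 0).mono_left nhdsWithin_le_nhds
      have hx : ![x 0, x 1] = x := by funext i; fin_cases i <;> rfl
      have e : ∀ t : ℂ, polyEval Q (t • ((x 0, x 1) : ℂ × ℂ)) = t ^ n * MvPolynomial.eval x Q := by
        intro t
        rw [polyEval, show ![(t • ((x 0, x 1) : ℂ × ℂ)).1, (t • ((x 0, x 1) : ℂ × ℂ)).2] = t • x by
          funext i; fin_cases i <;> simp]
        rw [MvPolynomial.eval_eq', MvPolynomial.eval_eq', Finset.mul_sum]
        refine Finset.sum_congr rfl fun d hd => ?_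
        have hdeg := hQh (MvPolynomial.mem_support_iff.1 hd)
        simp only [Pi.smul_apply, smul_eq_mul, mul_pow, Finset.prod_mul_distrib,
          Finset.prod_pow_eq_pow_sum]
        rw [show ∑ i, d i = n by rw [← hdeg]; simp [Finsupp.weight_apply, Finsupp.sum_fintype]]
        ring
      have hO := hQO.comp_tendsto hline
      simp only [Function.comp_def, e] at hO
      have hO' : (fun _ : ℂ => MvPolynomial.eval x Q) =O[𝓝[≠] 0] fun t : ℂ => t := by
        have h3 := (isBigO_refl (fun t : ℂ => (t ^ n)⁻¹) (𝓝[≠] 0)).norm_right.mul hO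
        refine (h3.congr' ?_ EventuallyEq.rfl).trans ?_
        · filter_upwards [self_mem_nhdsWithin] with t ht
          rw [← mul_assoc, inv_mul_cancel₀ (pow_ne_zero _ ht), one_mul]
        · refine IsBigO.of_bound (‖((x 0, x 1) : ℂ × ℂ)‖ ^ (n + 1)) ?_
          filter_upwards [self_mem_nhdsWithin] with t ht
          have ht' : ‖t‖ ≠ 0 := norm_ne_zero_iff.2 ht
          simp only [norm_mul, norm_norm, norm_inv, norm_pow, norm_smul, mul_pow]
          apply le_of_eq
          field_simp
          ring
      have hlim : Tendsto (fun _ : ℂ => MvPolynomial.eval x Q) (𝓝[≠] 0) (𝓝 0) :=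
        hO'.trans_tendsto (tendsto_id.mono_left nhdsWithin_le_nhds)
      exact tendsto_nhds_unique tendsto_const_nhds hlim
    rw [hQ0, sub_zero] at hPQ
    simpa using add_mem h₁ hPQ

theorem unique (hs : HasExpansion g s) (ht : HasExpansion g t) : s = t := by
  have := hs.sub ht
  simp only [sub_self] at this
  exact sub_eq_zero.1 this.eq_zero

end HasExpansion

end RigidGerm

namespace RigidGerm
open MvPowerSeries Asymptotics
open scoped ContDiff

/-! ### Taylor series of analytic functions -/

/-- The value of the `n`-th derivative of `g` at the origin on `i` copies of `∂/∂z` followed by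
copies of `∂/∂w`. -/
def mixedDeriv (g : ℂ × ℂ → ℂ) (n i : ℕ) : ℂ :=
  iteratedFDeriv ℂ n g 0 (fun k : Fin n => if k.val < i then ((1, 0) : ℂ × ℂ) else (0, 1))

theorem taylorCoeff_eq (g : ℂ × ℂ → ℂ) {n i j : ℕ} (h : i + j = n) :
    taylorCoeff g i j = mixedDeriv g n i / (i.factorial * j.factorial) := by
  subst h; rfl

/-- The exponent of the monomial `z ^ i w ^ j`. -/
def expo (i j : ℕ) : Fin 2 →₀ ℕ := Finsupp.single 0 i + Finsupp.single 1 j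

@[simp] theorem expo_zero (i j : ℕ) : expo i j 0 = i := by simp [expo]

@[simp] theorem expo_one (i j : ℕ) : expo i j 1 = j := by simp [expo]

theorem expo_eq_iff {i j : ℕ} {d : Fin 2 →₀ ℕ} : expo i j = d ↔ i = d 0 ∧ j = d 1 := by
  constructor
  · rintro rfl; simp
  · rintro ⟨rfl, rfl⟩; ext k; fin_cases k <;> simp

theorem degree_eq (d : Fin 2 →₀ ℕ) : d.degree = d 0 + d 1 := by
  simp [Finsupp.degree_eq_sum, Fin.sum_univ_two]

theorem coeff_taylorSeries (g : ℂ × ℂ → ℂ) (d : Fin 2 →₀ ℕ) :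
    coeff d (taylorSeries g) = taylorCoeff g (d 0) (d 1) := rfl

variable {g : ℂ × ℂ → ℂ}

/-- By symmetry of higher derivatives, a mixed derivative only depends on the number of directions
of each type. -/
theorem iteratedFDeriv_ite (hg : AnalyticAt ℂ g 0) {n : ℕ} (s : Finset (Fin n)) :
    iteratedFDeriv ℂ n g 0 (fun k => if k ∈ s then ((1, 0) : ℂ × ℂ) else (0, 1)) =
      mixedDeriv g n s.card := by
  have hs : s.card ≤ n := by simpa using s.card_le_univ
  let e₀ : {k // k ∈ s} ≃ {k : Fin n // k.val < s.card} := Fintype.equivOfCardEq (by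
    rw [Fintype.card_coe, Fintype.card_subtype, Fin.card_filter_val_lt, min_eq_right hs])
  have hsymm := (hg.contDiffAt (n := ω)).iteratedFDeriv_comp_perm
    (fun k : Fin n => if k.val < s.card then ((1, 0) : ℂ × ℂ) else (0, 1)) e₀.extendSubtype
  rw [mixedDeriv, ← hsymm]
  congr 1
  funext k
  by_cases hk : k ∈ s
  · have := e₀.extendSubtype_mem k hk
    simp only [Function.comp_apply, if_pos hk, if_pos this]
  · have := e₀.extendSubtype_not_mem k hk
    simp only [Function.comp_apply, if_neg hk, if_neg this]

/-- The homogeneous terms of the Taylor expansion, from multilinearity and the symmetry of the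
derivatives. -/
theorem iteratedFDeriv_diag (hg : AnalyticAt ℂ g 0) (n : ℕ) (p : ℂ × ℂ) :
    (n.factorial : ℂ)⁻¹ • iteratedFDeriv ℂ n g 0 (fun _ => p) =
      ∑ ij ∈ Finset.HasAntidiagonal.antidiagonal n,
        taylorCoeff g ij.1 ij.2 * (p.1 ^ ij.1 * p.2 ^ ij.2) := by
  have h1 : iteratedFDeriv ℂ n g 0 (fun _ => p) =
      ∑ s : Finset (Fin n), p.1 ^ s.card * p.2 ^ (n - s.card) * mixedDeriv g n s.card := by
    have hp : (fun _ : Fin n => p) = (fun _ => p.1 • ((1, 0) : ℂ × ℂ)) + fun _ => p.2 • (0, 1) := by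
      funext k; ext <;> simp
    rw [hp, ContinuousMultilinearMap.map_add_univ]
    refine Finset.sum_congr rfl fun s _ => ?_
    have : s.piecewise (fun _ : Fin n => p.1 • ((1, 0) : ℂ × ℂ)) (fun _ => p.2 • (0, 1)) =
        fun k => (if k ∈ s then p.1 else p.2) • if k ∈ s then ((1, 0) : ℂ × ℂ) else (0, 1) := by
      funext k
      by_cases hk : k ∈ s <;> simp [hk]
    rw [this, ContinuousMultilinearMap.map_smul_univ, iteratedFDeriv_ite hg, Finset.prod_ite,
      Finset.prod_const, Finset.prod_const, smul_eq_mul]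
    congr 3
    · simp
    · rw [Finset.filter_not]
      simp [Finset.card_sdiff]
  have h2 := Finset.sum_powerset_apply_card
    (x := (Finset.univ : Finset (Fin n)))
    (fun i => p.1 ^ i * p.2 ^ (n - i) * mixedDeriv g n i)
  rw [Finset.powerset_univ, Finset.card_univ, Fintype.card_fin] at h2
  rw [h1, h2, Finset.Nat.sum_antidiagonal_eq_sum_range_succ_mk, Finset.smul_sum]
  refine Finset.sum_congr rfl fun i hi => ?_
  have hi' : i ≤ n := Nat.lt_succ_iff.1 (Finset.mem_range.1 hi)
  rw [taylorCoeff_eq g (Nat.add_sub_cancel' hi'), nsmul_eq_mul, smul_eq_mul,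
    Nat.cast_choose ℂ hi']
  have := Nat.cast_ne_zero (R := ℂ).2 n.factorial_ne_zero
  field_simp

/-- The Taylor series is the asymptotic expansion of an analytic function. -/
theorem hasExpansion_taylorSeries (hg : AnalyticAt ℂ g 0) : HasExpansion g (taylorSeries g) := by
  intro n
  obtain ⟨p, hp⟩ := hg
  obtain ⟨r, hpr⟩ := hp
  refine ⟨∑ k ∈ Finset.range n, ∑ ij ∈ Finset.HasAntidiagonal.antidiagonal k,
    MvPolynomial.monomial (expo ij.1 ij.2) (taylorCoeff g ij.1 ij.2), ?_, ?_⟩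
  · rw [mem_ordIdeal_iff]
    intro d hd
    rw [map_sub, coeff_taylorSeries, MvPolynomial.coeff_coe, MvPolynomial.coeff_sum]
    simp only [MvPolynomial.coeff_sum, MvPolynomial.coeff_monomial]
    rw [Finset.sum_eq_single (d 0 + d 1), Finset.sum_eq_single (d 0, d 1)]
    · rw [if_pos (expo_eq_iff.2 ⟨rfl, rfl⟩), sub_self]
    · rintro ⟨i, j⟩ - hne
      rw [if_neg]
      rw [expo_eq_iff]
      rintro ⟨rfl, rfl⟩
      exact hne rfl
    · simp
    · intro k _ hne
      refine Finset.sum_eq_zero fun ij hij => if_neg ?_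
      rw [expo_eq_iff]
      rintro ⟨h1, h2⟩
      rw [Finset.HasAntidiagonal.mem_antidiagonal] at hij
      omega
    · rw [degree_eq] at hd
      simp [hd]
  · have h := hpr.hasFPowerSeriesAt.isBigO_sub_partialSum_pow n
    simp only [zero_add] at h
    refine h.congr_left fun q => ?_
    congr 1
    rw [polyEval, map_sum, FormalMultilinearSeries.partialSum]
    refine Finset.sum_congr rfl fun k _ => ?_
    have hk := hpr.factorial_smul q k
    have hk' : p k (fun _ => q) = (k.factorial : ℂ)⁻¹ • iteratedFDeriv ℂ k g 0 (fun _ => q) := by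
      rw [← hk, nsmul_eq_mul, smul_eq_mul, ← mul_assoc, inv_mul_cancel₀, one_mul]
      exact Nat.cast_ne_zero.2 k.factorial_ne_zero
    rw [hk', iteratedFDeriv_diag hpr.analyticAt, map_sum]
    refine Finset.sum_congr rfl fun ij _ => ?_
    rw [MvPolynomial.eval_monomial, Finsupp.prod_fintype _ _ (by simp)]
    simp

theorem HasExpansion.eq_taylorSeries {s : Series} (hg : AnalyticAt ℂ g 0) (h : HasExpansion g s) :
    taylorSeries g = s := (hasExpansion_taylorSeries hg).unique h

theorem mixedDeriv_fderiv (hg : AnalyticAt ℂ g 0) (n : ℕ) (e : ℂ × ℂ)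
    (m : Fin n → ℂ × ℂ) : iteratedFDeriv ℂ n (fun p => fderiv ℂ g p e) 0 m =
      iteratedFDeriv ℂ (n + 1) g 0 (Fin.snoc m e : Fin (n + 1) → ℂ × ℂ) := by
  rw [iteratedFDeriv_succ_apply_right]
  have h := ContinuousLinearMap.iteratedFDeriv_comp_left
    (ContinuousLinearMap.apply ℂ ℂ e : (ℂ × ℂ →L[ℂ] ℂ) →L[ℂ] ℂ)
    (hg.fderiv.contDiffAt (n := ω)) (i := n) (by exact_mod_cast le_top)
  have : (fun p => fderiv ℂ g p e) =
    (ContinuousLinearMap.apply ℂ ℂ e : (ℂ × ℂ →L[ℂ] ℂ) →L[ℂ] ℂ) ∘ fderiv ℂ g := rfl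
  rw [this, h]
  simp

/-- The Taylor series of `∂g/∂z`. -/
theorem taylorSeries_fderiv_zero (hg : AnalyticAt ℂ g 0) :
    taylorSeries (fun p => fderiv ℂ g p (1, 0)) = pderiv ℂ 0 (taylorSeries g) := by
  ext d
  rw [coeff_pderiv, coeff_taylorSeries, coeff_taylorSeries]
  simp only [Finsupp.add_apply, Finsupp.single_eq_same]
  rw [show (Finsupp.single 0 1 : Fin 2 →₀ ℕ) 1 = 0 by simp, add_zero,
    taylorCoeff_eq _ rfl, taylorCoeff_eq g (n := d 0 + d 1 + 1) (by ring), mixedDeriv,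
    mixedDeriv_fderiv hg]
  have hs : (Fin.snoc (fun k : Fin (d 0 + d 1) => if k.val < d 0 then ((1, 0) : ℂ × ℂ) else (0, 1))
      (1, 0) : Fin (d 0 + d 1 + 1) → ℂ × ℂ) = fun k => if k ∈ (Finset.univ.filter fun k :
        Fin (d 0 + d 1 + 1) => k.val < d 0 ∨ k = Fin.last _) then (1, 0) else (0, 1) := by
    funext k
    refine Fin.lastCases ?_ (fun k => ?_) k
    · simp
    · simp [Fin.snoc_castSucc, (Fin.castSucc_lt_last k).ne]
  have hcard : (Finset.univ.filter fun k :
        Fin (d 0 + d 1 + 1) => k.val < d 0 ∨ k = Fin.last _).card = d 0 + 1 := by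
    rw [Finset.filter_or, Finset.card_union_of_disjoint]
    · rw [Fin.card_filter_val_lt, Finset.filter_eq', if_pos (Finset.mem_univ _),
        Finset.card_singleton, min_eq_right (by omega)]
    · rw [Finset.disjoint_filter]
      rintro k - hk rfl
      simp at hk
  rw [hs, iteratedFDeriv_ite hg, hcard, Nat.factorial_succ]
  have h1 := Nat.cast_ne_zero (R := ℂ).2 (d 0).factorial_ne_zero
  have h2 := Nat.cast_ne_zero (R := ℂ).2 (d 1).factorial_ne_zero
  have h3 : ((d 0 : ℂ) + 1) ≠ 0 := Nat.cast_add_one_ne_zero _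
  push_cast
  field_simp

/-- The Taylor series of `∂g/∂w`. -/
theorem taylorSeries_fderiv_one (hg : AnalyticAt ℂ g 0) :
    taylorSeries (fun p => fderiv ℂ g p (0, 1)) = pderiv ℂ 1 (taylorSeries g) := by
  ext d
  rw [coeff_pderiv, coeff_taylorSeries, coeff_taylorSeries]
  simp only [Finsupp.add_apply, Finsupp.single_eq_same]
  rw [show (Finsupp.single 1 1 : Fin 2 →₀ ℕ) 0 = 0 by simp, add_zero,
    taylorCoeff_eq _ rfl, taylorCoeff_eq g (n := d 0 + d 1 + 1) (by ring), mixedDeriv,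
    mixedDeriv_fderiv hg]
  have hs : (Fin.snoc (fun k : Fin (d 0 + d 1) => if k.val < d 0 then ((1, 0) : ℂ × ℂ) else (0, 1))
      (0, 1) : Fin (d 0 + d 1 + 1) → ℂ × ℂ) =
        fun k => if k.val < d 0 then ((1, 0) : ℂ × ℂ) else (0, 1) := by
    funext k
    refine Fin.lastCases ?_ (fun k => ?_) k
    · simp
    · simp [Fin.snoc_castSucc]
  rw [hs, Nat.factorial_succ, ← mixedDeriv]
  have h1 := Nat.cast_ne_zero (R := ℂ).2 (d 0).factorial_ne_zero
  have h2 := Nat.cast_ne_zero (R := ℂ).2 (d 1).factorial_ne_zero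
  have h3 : ((d 1 : ℂ) + 1) ≠ 0 := Nat.cast_add_one_ne_zero _
  push_cast
  field_simp

end RigidGerm

namespace RigidGerm
open MvPowerSeries Asymptotics

/-! ### Convergent power series -/

/-- The coefficients of `s` grow at most geometrically. The rate `R` is explicit since
it bounds the domain of convergence from below. -/
def IsConvergent (R : ℝ) (s : Series) : Prop :=
  ∃ K : ℝ, 0 ≤ K ∧ ∀ d : Fin 2 →₀ ℕ, ‖coeff d s‖ ≤ K * R ^ d.degree

/-- The term of index `(i, j)` of a power series at the point `p`. -/
def seriesTerm (s : Series) (ij : ℕ × ℕ) (p : ℂ × ℂ) : ℂ :=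
  coeff (expo ij.1 ij.2) s * (p.1 ^ ij.1 * p.2 ^ ij.2)

/-- The sum of a power series at the point `p` (zero if it does not converge absolutely). -/
def seriesSum (s : Series) (p : ℂ × ℂ) : ℂ := ∑' ij, seriesTerm s ij p

variable {R : ℝ} {s t : Series}

theorem degree_expo (i j : ℕ) : (expo i j).degree = i + j := by simp [degree_eq]

theorem summable_half_pow : Summable fun ij : ℕ × ℕ => (1 / 2 : ℝ) ^ ij.1 * (1 / 2 : ℝ) ^ ij.2 :=
  Summable.mul_of_nonneg (f := fun i : ℕ => (1 / 2 : ℝ) ^ i) (g := fun i : ℕ => (1 / 2 : ℝ) ^ i)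
    summable_geometric_two summable_geometric_two (fun i => by positivity) (fun i => by positivity)

theorem IsConvergent.exists_bound (hs : IsConvergent R s) (hR : 0 < R) :
    ∃ K : ℝ, ∀ (ij : ℕ × ℕ) (p : ℂ × ℂ), ‖p‖ ≤ 1 / (2 * R) →
      ‖seriesTerm s ij p‖ ≤ K * ((1 / 2 : ℝ) ^ ij.1 * (1 / 2 : ℝ) ^ ij.2) := by
  obtain ⟨K, hK, h⟩ := hs
  refine ⟨K, fun ij p hp => ?_⟩
  have h1 : R * ‖p‖ ≤ 1 / 2 := by
    calc R * ‖p‖ ≤ R * (1 / (2 * R)) := by gcongr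
      _ = 1 / 2 := by field_simp
  rw [seriesTerm, norm_mul, norm_mul, norm_pow, norm_pow]
  calc ‖coeff (expo ij.1 ij.2) s‖ * (‖p.1‖ ^ ij.1 * ‖p.2‖ ^ ij.2)
      ≤ (K * R ^ (ij.1 + ij.2)) * (‖p‖ ^ ij.1 * ‖p‖ ^ ij.2) := by
        have := h (expo ij.1 ij.2)
        rw [degree_expo] at this
        gcongr
        · exact norm_fst_le p
        · exact norm_snd_le p
    _ = K * ((R * ‖p‖) ^ ij.1 * (R * ‖p‖) ^ ij.2) := by ring
    _ ≤ _ := by gcongr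

theorem IsConvergent.summable (hs : IsConvergent R s) (hR : 0 < R) {p : ℂ × ℂ}
    (hp : ‖p‖ ≤ 1 / (2 * R)) : Summable fun ij => seriesTerm s ij p := by
  obtain ⟨K, hK⟩ := hs.exists_bound hR
  exact Summable.of_norm_bounded (summable_half_pow.mul_left K) fun ij => hK ij p hp

theorem IsConvergent.continuousOn (hs : IsConvergent R s) (hR : 0 < R) :
    ContinuousOn (seriesSum s) (Metric.closedBall 0 (1 / (2 * R))) := by
  obtain ⟨K, hK⟩ := hs.exists_bound hR
  refine continuousOn_tsum (fun ij => ?_) (summable_half_pow.mul_left K) fun ij p hp =>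
    hK ij p (by simpa using hp)
  unfold seriesTerm
  fun_prop

theorem IsConvergent.differentiableOn (hs : IsConvergent R s) (hR : 0 < R) {x : ℂ}
    (hx : ‖x‖ ≤ 1 / (2 * R)) :
    DifferentiableOn ℂ (fun y => seriesSum s (x, y)) (Metric.ball 0 (1 / (2 * R))) := by
  obtain ⟨K, hK⟩ := hs.exists_bound hR
  refine Complex.differentiableOn_tsum_of_summable_norm (summable_half_pow.mul_left K)
    (fun ij => ?_) Metric.isOpen_ball fun ij y hy => hK ij (x, y) ?_
  · unfold seriesTerm
    fun_prop
  · rw [mem_ball_zero_iff] at hy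
    exact (Prod.norm_mk _ _).trans_le (max_le hx hy.le)

theorem seriesSum_zero (s : Series) : seriesSum s 0 = constantCoeff s := by
  rw [seriesSum, tsum_eq_single (0, 0)]
  · simp [seriesTerm, expo]
  · rintro ⟨i, j⟩ hne
    rcases Nat.eq_zero_or_pos i with rfl | hi
    · have : j ≠ 0 := by rintro rfl; exact hne rfl
      simp [seriesTerm, this]
    · simp [seriesTerm, hi.ne']

theorem coeff_expo_add_X_mul (a b : ℕ) (d : Fin 2 →₀ ℕ) (t : Series) :
    coeff (d + expo a b) (X 0 ^ a * X 1 ^ b * t) = coeff d t := by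
  rw [X_pow_eq, X_pow_eq, monomial_mul_monomial, one_mul, mul_comm, expo, coeff_add_mul_monomial,
    mul_one]

/-- Dividing a convergent power series by a monomial. -/
theorem IsConvergent.of_monomial_mul (hR : 0 < R) {a b : ℕ}
    (hs : IsConvergent R (X 0 ^ a * X 1 ^ b * t)) :
    IsConvergent R t ∧ ∀ p, ‖p‖ ≤ 1 / (2 * R) →
      seriesSum (X 0 ^ a * X 1 ^ b * t) p = p.1 ^ a * p.2 ^ b * seriesSum t p := by
  have ht : IsConvergent R t := by
    obtain ⟨K, hK, h⟩ := hs
    refine ⟨K * R ^ (a + b), by positivity, fun d => ?_⟩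
    have := h (d + expo a b)
    rw [coeff_expo_add_X_mul, map_add, degree_expo] at this
    exact this.trans_eq (by ring)
  refine ⟨ht, fun p hp => ?_⟩
  have h1 := (ht.summable hR hp).hasSum.mul_left (p.1 ^ a * p.2 ^ b)
  let e : ℕ × ℕ → ℕ × ℕ := fun ij => (ij.1 + a, ij.2 + b)
  have he : Function.Injective e := fun x y h => by
    simp only [e, Prod.mk.injEq, add_left_inj] at h
    exact Prod.ext h.1 h.2
  have h2 : HasSum (fun ij => seriesTerm (X 0 ^ a * X 1 ^ b * t) ij p)
      (p.1 ^ a * p.2 ^ b * seriesSum t p) := by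
    refine (he.hasSum_iff ?_).1 ?_
    · rintro ⟨i, j⟩ hij
      have hc : coeff (expo i j) (X 0 ^ a * X 1 ^ b * t) = 0 := by
        by_cases hi : i < a
        · exact (X_pow_dvd_iff (s := (0 : Fin 2)) (n := a)).1
            (Dvd.intro (X 1 ^ b * t) (by ring)) _ (by simpa using hi)
        · by_cases hj : j < b
          · exact (X_pow_dvd_iff (s := (1 : Fin 2)) (n := b)).1
              (Dvd.intro (X 0 ^ a * t) (by ring)) _ (by simpa using hj)
          · refine absurd ⟨(i - a, j - b), ?_⟩ hij
            simp only [e]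
            congr 1 <;> omega
      simp [seriesTerm, hc]
    · refine h1.congr_fun fun ij => ?_
      have hexp : expo (ij.1 + a) (ij.2 + b) = expo ij.1 ij.2 + expo a b := by
        rw [expo_eq_iff]
        simp
      simp only [Function.comp_apply, seriesTerm, e, hexp, coeff_expo_add_X_mul]
      ring
  exact h2.tsum_eq

/-- Every non-zero power series is a monomial times a series divisible by none of the variables. -/
theorem exists_eq_monomial_mul (hs : s ≠ 0) :
    ∃ (a b : ℕ) (t : Series), s = X 0 ^ a * X 1 ^ b * t ∧ ¬X 0 ∣ t ∧ ¬X 1 ∣ t := by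
  have fin : ∀ (i : Fin 2) (s : Series), s ≠ 0 → FiniteMultiplicity (X i) s := fun i s hs => by
    obtain ⟨d, hd⟩ : ∃ d, coeff d s ≠ 0 := by
      by_contra! h
      exact hs (MvPowerSeries.ext h)
    exact ⟨d i, fun h => hd (X_pow_dvd_iff.1 h d (Nat.lt_succ_self _))⟩
  obtain ⟨t, ht, h0⟩ := (fin 0 s hs).exists_eq_pow_mul_and_not_dvd
  have ht0 : t ≠ 0 := by rintro rfl; exact h0 (dvd_zero _)
  obtain ⟨u, hu, h1⟩ := (fin 1 t ht0).exists_eq_pow_mul_and_not_dvd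
  generalize multiplicity (X 0) s = a at ht
  generalize multiplicity (X 1) t = b at hu
  subst hu
  exact ⟨a, b, u, by rw [ht, mul_assoc], fun h => h0 (h.mul_left _), h1⟩

/-- A convergent power series that does not vanish identically on a coordinate axis has no zeros on
this axis near the origin, except perhaps the origin itself. The axis is the image of
`p ↦ (α p.1, β p.2)` with `(α, β)` one of `(0, 1)` and `(1, 0)`. -/
theorem IsConvergent.eventually_ne_zero_on_axis (hs : IsConvergent R s) (hR : 0 < R) {α β : ℂ}
    (h : (α = 0 ∧ β = 1 ∧ ¬X 0 ∣ s) ∨ (α = 1 ∧ β = 0 ∧ ¬X 1 ∣ s)) :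
    ∀ᶠ p in 𝓝 (0 : ℂ × ℂ), α * p.1 + β * p.2 ≠ 0 → seriesSum s (α * p.1, β * p.2) ≠ 0 := by
  set s₀ := subst (![C α * X 0, C β * X 1] : FormalMap) s with hs₀
  have hcoeff : ∀ d, coeff d s₀ = α ^ d 0 * β ^ d 1 * coeff d s := coeff_subst_diag α β s
  have hs₀0 : s₀ ≠ 0 := by
    intro h0
    rcases h with ⟨rfl, rfl, h⟩ | ⟨rfl, rfl, h⟩
    · exact h (X_zero_dvd_of_subst_eq_zero (by simpa [hs₀] using h0))
    · exact h (X_one_dvd_of_subst_eq_zero (by simpa [hs₀] using h0))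
  have hαβ : ‖α‖ ≤ 1 ∧ ‖β‖ ≤ 1 := by
    rcases h with ⟨rfl, rfl, -⟩ | ⟨rfl, rfl, -⟩ <;> simp
  have hs₀c : IsConvergent R s₀ := by
    obtain ⟨K, hK, hb⟩ := hs
    refine ⟨K, hK, fun d => le_trans ?_ (hb d)⟩
    rw [hcoeff, norm_mul, norm_mul, norm_pow, norm_pow]
    exact mul_le_of_le_one_left (norm_nonneg _)
      (mul_le_one₀ (pow_le_one₀ (norm_nonneg _) hαβ.1) (by positivity)
        (pow_le_one₀ (norm_nonneg _) hαβ.2))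
  have hsum : ∀ p, seriesSum s₀ p = seriesSum s (α * p.1, β * p.2) := fun p => by
    unfold seriesSum
    congr 1
    funext ij
    simp only [seriesTerm, hcoeff, expo_zero, expo_one]
    ring
  obtain ⟨a, b, t, ht, h0, h1⟩ := exists_eq_monomial_mul hs₀0
  have hsupp : ∀ d, coeff d t ≠ 0 → (α = 0 → d 0 = 0 ∧ a = 0) ∧ (β = 0 → d 1 = 0 ∧ b = 0) := by
    intro d hd
    rw [← coeff_expo_add_X_mul a b, ← ht, hcoeff] at hd
    simp only [Finsupp.add_apply, expo_zero, expo_one] at hd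
    constructor
    · rintro rfl
      by_contra hne
      exact hd (by rw [zero_pow (by omega)]; ring)
    · rintro rfl
      by_contra hne
      exact hd (by rw [zero_pow (by omega)]; ring)
  have ht0 : constantCoeff t ≠ 0 := by
    rw [X_dvd_iff] at h0 h1
    push Not at h0 h1
    obtain ⟨d, hd, hd'⟩ := h0
    obtain ⟨e, he, he'⟩ := h1
    rcases h with ⟨hα, -, -⟩ | ⟨-, hβ, -⟩
    · have : e = 0 := by
        ext i; fin_cases i
        · simpa using ((hsupp e he').1 hα).1
        · simpa using he
      rwa [this] at he'
    · have : d = 0 := by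
        ext i; fin_cases i
        · simpa using hd
        · simpa using ((hsupp d hd').2 hβ).1
      rwa [this] at hd'
  rw [ht] at hs₀c
  obtain ⟨htc, hmul⟩ := hs₀c.of_monomial_mul hR
  have hpos : 0 < 1 / (2 * R) := by positivity
  have hcont : ContinuousAt (seriesSum t) 0 :=
    (htc.continuousOn hR).continuousAt (Metric.closedBall_mem_nhds _ hpos)
  filter_upwards [hcont.eventually_ne (by rwa [seriesSum_zero]),
    Metric.closedBall_mem_nhds (0 : ℂ × ℂ) hpos] with p hp hpR hne
  rw [← hsum, ht, hmul p (by simpa using hpR)]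
  refine mul_ne_zero ?_ hp
  have hex : ∃ d, coeff d t ≠ 0 := ⟨0, by rwa [coeff_zero_eq_constantCoeff_apply]⟩
  obtain ⟨d, hd⟩ := hex
  rcases h with ⟨rfl, rfl, -⟩ | ⟨rfl, rfl, -⟩
  · rw [((hsupp d hd).1 rfl).2, pow_zero, one_mul]
    exact pow_ne_zero _ (by simpa using hne)
  · rw [((hsupp d hd).2 rfl).2, pow_zero, mul_one]
    exact pow_ne_zero _ (by simpa using hne)

/-- A convergent power series without constant term that is divisible by none of the variables has
zeros outside the coordinate axes, arbitrarily close to the origin. Otherwise its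
restrictions to the discs `{x} × {|y| ≤ δ}`, `x ≠ 0`, would have no zeros, and the minimum modulus
principle would bound the series away from zero near the origin. -/
theorem IsConvergent.constantCoeff_ne_zero (hs : IsConvergent R s) (hR : 0 < R)
    (h0 : ¬X 0 ∣ s) (h1 : ¬X 1 ∣ s)
    (hz : ∀ᶠ p in 𝓝 (0 : ℂ × ℂ), seriesSum s p = 0 → p.1 * p.2 = 0) :
    constantCoeff s ≠ 0 := by
  intro hconst
  have hpos : 0 < 1 / (2 * R) := by positivity
  have hall := (hz.and ((hs.eventually_ne_zero_on_axis hR (Or.inl ⟨rfl, rfl, h0⟩)).and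
    (hs.eventually_ne_zero_on_axis hR (Or.inr ⟨rfl, rfl, h1⟩)))).and
    (Metric.ball_mem_nhds (0 : ℂ × ℂ) hpos)
  obtain ⟨δ, hδ, hball⟩ := Metric.nhds_basis_closedBall.eventually_iff.1 hall
  -- the origin is the only zero in the closed polydisc of radius `δ`
  have hne : ∀ p : ℂ × ℂ, ‖p‖ ≤ δ → p ≠ 0 → seriesSum s p ≠ 0 := by
    intro p hp hp0 hs0
    obtain ⟨⟨hA, hB, hC⟩, -⟩ := hball (by simpa using hp)
    obtain ⟨x, y⟩ := p
    rcases mul_eq_zero.1 (hA hs0) with hx | hy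
    · simp only at hx
      subst hx
      refine hB ?_ (by simpa using hs0)
      simpa using hp0
    · simp only at hy
      subst hy
      refine hC ?_ (by simpa using hs0)
      simpa using hp0
  have hδR : δ < 1 / (2 * R) := by
    have := (hball (x := ((δ : ℂ), 0)) (by simp [abs_of_pos hδ, hδ.le])).2
    rw [dist_zero_right] at this
    exact (le_trans (by simp [abs_of_pos hδ]) (norm_fst_le _)).trans_lt this
  have hcont : ContinuousOn (seriesSum s) (Metric.closedBall 0 δ) :=
    (hs.continuousOn hR).mono (Metric.closedBall_subset_closedBall hδR.le)
  set K : Set (ℂ × ℂ) := Metric.closedBall 0 δ ×ˢ Metric.sphere 0 δ with hK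
  have hKsub : K ⊆ Metric.closedBall 0 δ := by
    rintro ⟨x, y⟩ ⟨hx, hy⟩
    simp only [mem_closedBall_zero_iff, mem_sphere_zero_iff_norm] at hx hy ⊢
    exact (Prod.norm_mk _ _).trans_le (max_le hx hy.le)
  have hKc : IsCompact K := (isCompact_closedBall 0 δ).prod (isCompact_sphere 0 δ)
  obtain ⟨q, hqK, hq⟩ := hKc.exists_isMinOn
    ⟨(0, (δ : ℂ)), by simp [hK, abs_of_pos hδ, hδ.le]⟩ (hcont.mono hKsub).norm
  set m := ‖seriesSum s q‖ with hm
  have hm0 : 0 < m := by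
    refine norm_pos_iff.2 (hne q (by simpa using hKsub hqK) ?_)
    rintro rfl
    have := hqK.2
    simp only [Prod.snd_zero, mem_sphere_zero_iff_norm, norm_zero] at this
    exact hδ.ne this
  have hlow : ∀ x : ℂ, x ≠ 0 → ‖x‖ ≤ δ → m ≤ ‖seriesSum s (x, 0)‖ := by
    intro x hx hxδ
    have hnez : ∀ y : ℂ, ‖y‖ ≤ δ → seriesSum s (x, y) ≠ 0 := fun y hy =>
      hne _ ((Prod.norm_mk _ _).trans_le (max_le hxδ hy)) fun h => hx (congrArg Prod.fst h)
    have hdiff : DifferentiableOn ℂ (fun y => (seriesSum s (x, y))⁻¹) (Metric.closedBall 0 δ) :=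
      ((hs.differentiableOn hR (hxδ.trans hδR.le)).mono
        (Metric.closedBall_subset_ball hδR)).inv fun y hy => hnez y (by simpa using hy)
    have hcl : DiffContOnCl ℂ (fun y => (seriesSum s (x, y))⁻¹) (Metric.ball 0 δ) :=
      (hdiff.mono Metric.closure_ball_subset_closedBall).diffContOnCl
    have := Complex.norm_le_of_forall_mem_frontier_norm_le Metric.isBounded_ball hcl (C := m⁻¹)
      (z := 0) (fun y hy => by
        rw [frontier_ball _ hδ.ne'] at hy
        rw [norm_inv]
        exact inv_anti₀ hm0 (hq ⟨by simpa using hxδ, hy⟩))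
      (subset_closure (Metric.mem_ball_self hδ))
    rw [norm_inv] at this
    exact (inv_le_inv₀ (norm_pos_iff.2 (hnez 0 (by simpa using hδ.le))) hm0).1 this
  have hcont0 : ContinuousAt (seriesSum s) 0 :=
    hcont.continuousAt (Metric.closedBall_mem_nhds _ hδ)
  have hlim : Tendsto (fun x : ℂ => ‖seriesSum s (x, 0)‖) (𝓝[≠] 0) (𝓝 0) := by
    have h1 : Tendsto (fun x : ℂ => ((x, 0) : ℂ × ℂ)) (𝓝[≠] 0) (𝓝 0) := by
      have : Continuous fun x : ℂ => ((x, 0) : ℂ × ℂ) := by fun_prop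
      exact (this.tendsto 0).mono_left nhdsWithin_le_nhds
    have := (hcont0.tendsto.comp h1).norm
    rwa [seriesSum_zero, hconst, norm_zero] at this
  refine absurd (ge_of_tendsto hlim ?_) (not_le.2 hm0)
  filter_upwards [self_mem_nhdsWithin,
    nhdsWithin_le_nhds (Metric.closedBall_mem_nhds (0 : ℂ) hδ)] with x hx hxδ
  exact hlow x hx (by simpa using hxδ)

/-! ### Analytic functions whose zeros lie on the coordinate axes -/

variable {g : ℂ × ℂ → ℂ}

theorem exists_isConvergent_of_hasFPowerSeriesOnBall {q : FormalMultilinearSeries ℂ (ℂ × ℂ) ℂ}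
    {r : ENNReal} (hq : HasFPowerSeriesOnBall g q 0 r) :
    ∃ R, 0 < R ∧ IsConvergent R (taylorSeries g) := by
  obtain ⟨K, A, hK, hA, hbound⟩ := q.le_mul_pow_of_radius_pos (hq.r_pos.trans_le hq.r_le)
  refine ⟨2 * A, by positivity, K, hK.le, fun d => ?_⟩
  rw [coeff_taylorSeries, degree_eq, taylorCoeff_eq g rfl]
  set n := d 0 + d 1 with hn
  have h1 : ‖mixedDeriv g n (d 0)‖ ≤ n.factorial * (K * A ^ n) := by
    rw [mixedDeriv, hq.iteratedFDeriv_eq_sum_of_completeSpace]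
    refine (norm_sum_le _ _).trans ((Finset.sum_le_card_nsmul _ _ (K * A ^ n) fun σ _ => ?_).trans
      (by rw [Finset.card_univ, Fintype.card_perm, Fintype.card_fin, nsmul_eq_mul]))
    refine ((q n).le_opNorm _).trans ((mul_le_of_le_one_right (norm_nonneg _) ?_).trans (hbound n))
    refine Finset.prod_le_one (fun _ _ => norm_nonneg _) fun i _ => ?_
    split_ifs <;> simp
  have h2 : (n.factorial : ℝ) ≤ 2 ^ n * ((d 0).factorial * (d 1).factorial) := by
    have h3 : n.choose (d 0) * ((d 0).factorial * (d 1).factorial) = n.factorial := by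
      rw [← mul_assoc, ← Nat.choose_mul_factorial_mul_factorial (n := n) (k := d 0) (by omega)]
      congr 2
      omega
    rw [← h3]
    exact_mod_cast Nat.mul_le_mul_right _ (Nat.choose_le_two_pow n (d 0))
  rw [norm_div, norm_mul, Complex.norm_natCast, Complex.norm_natCast, div_le_iff₀ (by positivity)]
  calc _ ≤ n.factorial * (K * A ^ n) := h1
    _ ≤ 2 ^ n * ((d 0).factorial * (d 1).factorial) * (K * A ^ n) := by gcongr
    _ = _ := by ring

/-- The Taylor series of an analytic function converges to it. -/
theorem exists_isConvergent_taylorSeries (hg : AnalyticAt ℂ g 0) :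
    ∃ R, 0 < R ∧ IsConvergent R (taylorSeries g) ∧
      ∀ᶠ p in 𝓝 (0 : ℂ × ℂ), g p = seriesSum (taylorSeries g) p := by
  obtain ⟨q, r, hq⟩ := id hg
  obtain ⟨R, hR, hconv⟩ := exists_isConvergent_of_hasFPowerSeriesOnBall hq
  refine ⟨R, hR, hconv, ?_⟩
  have hpos : 0 < 1 / (2 * R) := by positivity
  filter_upwards [Metric.closedBall_mem_nhds (0 : ℂ × ℂ) hpos,
    Metric.eball_mem_nhds (0 : ℂ × ℂ) hq.r_pos] with p hp hpr
  have hsum := hq.hasSum_iteratedFDeriv (y := p) hpr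
  simp only [iteratedFDeriv_diag hg] at hsum
  have hs := (hconv.summable hR (p := p) (by simpa using hp)).hasSum
  rw [← (Finset.HasAntidiagonal.sigmaAntidiagonalEquivProd (A := ℕ)).hasSum_iff] at hs
  have h3 := hs.sigma (fun n => Finset.hasSum (Finset.HasAntidiagonal.antidiagonal n)
    fun ij : ℕ × ℕ => seriesTerm (taylorSeries g) ij p)
  rw [zero_add] at hsum
  refine hsum.unique (h3.congr_fun fun n => Finset.sum_congr rfl fun ij _ => ?_)
  simp [seriesTerm, coeff_taylorSeries]

/-- An analytic function whose zeros lie on the coordinate axes is a monomial times a unit. -/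
theorem exists_taylorSeries_eq_monomial_mul (hg : AnalyticAt ℂ g 0)
    (hz : ∀ᶠ p in 𝓝 (0 : ℂ × ℂ), g p = 0 → p.1 * p.2 = 0) :
    ∃ (a b : ℕ) (u : Series), IsUnit u ∧ taylorSeries g = X 0 ^ a * X 1 ^ b * u ∧
      (1 ≤ b → ∀ᶠ p in 𝓝 (0 : ℂ × ℂ), p.2 = 0 → g p = 0) := by
  obtain ⟨R, hR, hconv, hgs⟩ := exists_isConvergent_taylorSeries hg
  have hne : taylorSeries g ≠ 0 := by
    intro h0
    have h1 : ∀ᶠ p in 𝓝 (0 : ℂ × ℂ), p.1 * p.2 = 0 := by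
      filter_upwards [hz, hgs] with p hp hp'
      exact hp (by rw [hp', h0]; simp [seriesSum, seriesTerm])
    obtain ⟨δ, hδ, hball⟩ := Metric.nhds_basis_closedBall.eventually_iff.1 h1
    have := hball (x := ((δ : ℂ), (δ : ℂ))) (by simp [abs_of_pos hδ])
    simp [hδ.ne'] at this
  obtain ⟨a, b, u, hu, h0, h1⟩ := exists_eq_monomial_mul hne
  rw [hu] at hconv
  obtain ⟨huc, hmul⟩ := hconv.of_monomial_mul hR
  have hpos : 0 < 1 / (2 * R) := by positivity
  have hgs' : ∀ᶠ p in 𝓝 (0 : ℂ × ℂ), g p = p.1 ^ a * p.2 ^ b * seriesSum u p := by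
    filter_upwards [hgs, Metric.closedBall_mem_nhds (0 : ℂ × ℂ) hpos] with p hp hpR
    rw [hp, hu, hmul p (by simpa using hpR)]
  refine ⟨a, b, u, isUnit_iff_ne.2 (huc.constantCoeff_ne_zero hR h0 h1 ?_), hu, fun hb => ?_⟩
  · filter_upwards [hz, hgs'] with p hp hp' hp0
    exact hp (by rw [hp', hp0, mul_zero])
  · filter_upwards [hgs'] with p hp hp2
    rw [hp, hp2, zero_pow (by omega)]
    ring

end RigidGerm

namespace RigidGerm
open MvPowerSeries Asymptotics
open scoped ContDiff

/-! ### Taylor series of analytic germs -/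

variable {f g ψ χ : ℂ × ℂ → ℂ × ℂ} {h k : ℂ × ℂ → ℂ} {p : ℂ × ℂ}

theorem constantCoeff_taylorSeries (h : ℂ × ℂ → ℂ) : constantCoeff (taylorSeries h) = h 0 := by
  rw [← coeff_zero_eq_constantCoeff_apply, coeff_taylorSeries]
  simp [taylorCoeff]

theorem analyticAt_fst_comp (hf : AnalyticAt ℂ f p) : AnalyticAt ℂ (fun q => (f q).1) p :=
  analyticAt_fst.comp hf

theorem analyticAt_snd_comp (hf : AnalyticAt ℂ f p) : AnalyticAt ℂ (fun q => (f q).2) p :=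
  analyticAt_snd.comp hf

theorem isCentered_toFormal (h0 : f 0 = 0) : (toFormal f).IsCentered :=
  isCentered_vec (by simp [constantCoeff_taylorSeries, h0])
    (by simp [constantCoeff_taylorSeries, h0])

theorem taylorSeries_congr (hh : AnalyticAt ℂ h 0) (e : h =ᶠ[𝓝 0] k) :
    taylorSeries h = taylorSeries k :=
  (((hasExpansion_taylorSeries hh).congr e).eq_taylorSeries (hh.congr e)).symm

theorem analyticAt_comp_zero {E : Type*} [NormedAddCommGroup E] [NormedSpace ℂ E]
    {h : ℂ × ℂ → E} (hh : AnalyticAt ℂ h 0) (hf : AnalyticAt ℂ f 0) (h0 : f 0 = 0) :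
    AnalyticAt ℂ (h ∘ f) 0 := AnalyticAt.comp (by rwa [h0]) hf

theorem taylorSeries_comp (hh : AnalyticAt ℂ h 0) (hf : AnalyticAt ℂ f 0) (h0 : f 0 = 0) :
    taylorSeries (h ∘ f) = subst (toFormal f) (taylorSeries h) :=
  HasExpansion.eq_taylorSeries (analyticAt_comp_zero hh hf h0)
    ((hasExpansion_taylorSeries hh).comp (F := toFormal f)
      (hasExpansion_taylorSeries (analyticAt_fst_comp hf))
      (hasExpansion_taylorSeries (analyticAt_snd_comp hf)) (isCentered_toFormal h0))

theorem toFormal_comp (hg : AnalyticAt ℂ g 0) (hf : AnalyticAt ℂ f 0) (h0 : f 0 = 0) :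
    toFormal (g ∘ f) = (toFormal g).comp (toFormal f) := by
  funext i
  fin_cases i
  · exact taylorSeries_comp (analyticAt_fst_comp hg) hf h0
  · exact taylorSeries_comp (analyticAt_snd_comp hg) hf h0

theorem toFormal_congr (hf : AnalyticAt ℂ f 0) (e : f =ᶠ[𝓝 0] g) : toFormal f = toFormal g := by
  funext i
  fin_cases i
  · exact taylorSeries_congr (analyticAt_fst_comp hf) (e.fun_comp Prod.fst)
  · exact taylorSeries_congr (analyticAt_snd_comp hf) (e.fun_comp Prod.snd)

/-- An analytic function that vanishes on the `y`-axis is formally divisible by `x`. -/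
theorem X_zero_dvd_taylorSeries (hh : AnalyticAt ℂ h 0)
    (hz : ∀ᶠ p in 𝓝 (0 : ℂ × ℂ), p.1 = 0 → h p = 0) : X 0 ∣ taylorSeries h := by
  refine X_zero_dvd_of_subst_eq_zero ?_
  have hX := HasExpansion.of_polyEval (MvPolynomial.X 1)
  rw [MvPolynomial.coe_X] at hX
  have h1 := (hasExpansion_taylorSeries hh).comp (f := fun p => (0, p.2)) (F := ![0, X 1])
    (by simpa using HasExpansion.const 0)
    (hX.congr (Eventually.of_forall fun p => by simp [polyEval]))
    (isCentered_vec (by simp) (by simp))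
  have ht : Tendsto (fun p : ℂ × ℂ => ((0, p.2) : ℂ × ℂ)) (𝓝 0) (𝓝 0) := by
    have : Continuous fun p : ℂ × ℂ => ((0, p.2) : ℂ × ℂ) := by fun_prop
    exact this.tendsto 0
  refine HasExpansion.eq_zero (h1.congr ?_)
  filter_upwards [ht.eventually hz] with p hp
  exact hp rfl

/-- An analytic function that vanishes on the `x`-axis is formally divisible by `y`. -/
theorem X_one_dvd_taylorSeries (hh : AnalyticAt ℂ h 0)
    (hz : ∀ᶠ p in 𝓝 (0 : ℂ × ℂ), p.2 = 0 → h p = 0) : X 1 ∣ taylorSeries h := by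
  refine X_one_dvd_of_subst_eq_zero ?_
  have hX := HasExpansion.of_polyEval (MvPolynomial.X 0)
  rw [MvPolynomial.coe_X] at hX
  have h1 := (hasExpansion_taylorSeries hh).comp (f := fun p => (p.1, 0)) (F := ![X 0, 0])
    (hX.congr (Eventually.of_forall fun p => by simp [polyEval]))
    (by simpa using HasExpansion.const 0)
    (isCentered_vec (by simp) (by simp))
  have ht : Tendsto (fun p : ℂ × ℂ => ((p.1, 0) : ℂ × ℂ)) (𝓝 0) (𝓝 0) := by
    have : Continuous fun p : ℂ × ℂ => ((p.1, 0) : ℂ × ℂ) := by fun_prop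
    exact this.tendsto 0
  refine HasExpansion.eq_zero (h1.congr ?_)
  filter_upwards [ht.eventually hz] with p hp
  exact hp rfl

/-! ### Jacobian determinants -/

theorem det_eq (A : ℂ × ℂ →L[ℂ] ℂ × ℂ) :
    A.det = (A (1, 0)).1 * (A (0, 1)).2 - (A (0, 1)).1 * (A (1, 0)).2 := by
  rw [ContinuousLinearMap.det, ← LinearMap.det_toMatrix (Module.Basis.finTwoProd ℂ),
    Matrix.det_fin_two]
  simp [LinearMap.toMatrix_apply]

theorem fderiv_fst_comp (hf : DifferentiableAt ℂ f p) (v : ℂ × ℂ) :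
    fderiv ℂ (fun q => (f q).1) p v = (fderiv ℂ f p v).1 := by
  rw [fderiv.fst hf]
  rfl

theorem fderiv_snd_comp (hf : DifferentiableAt ℂ f p) (v : ℂ × ℂ) :
    fderiv ℂ (fun q => (f q).2) p v = (fderiv ℂ f p v).2 := by
  rw [fderiv.snd hf]
  rfl

theorem analyticAt_fderiv_apply (hh : AnalyticAt ℂ h 0) (v : ℂ × ℂ) :
    AnalyticAt ℂ (fun p => fderiv ℂ h p v) 0 :=
  (ContinuousLinearMap.apply ℂ ℂ v).analyticAt _ |>.comp hh.fderiv

theorem jac_eventuallyEq (hf : AnalyticAt ℂ f 0) :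
    (fun p => fderiv ℂ (fun q => (f q).1) p (1, 0) * fderiv ℂ (fun q => (f q).2) p (0, 1) -
      fderiv ℂ (fun q => (f q).1) p (0, 1) * fderiv ℂ (fun q => (f q).2) p (1, 0))
      =ᶠ[𝓝 0] jac f := by
  filter_upwards [hf.eventually_analyticAt] with p hp
  have hd := hp.differentiableAt
  rw [jac, det_eq, fderiv_fst_comp hd, fderiv_fst_comp hd, fderiv_snd_comp hd, fderiv_snd_comp hd]

theorem analyticAt_jac (hf : AnalyticAt ℂ f 0) : AnalyticAt ℂ (jac f) 0 := by
  have h0 := analyticAt_fderiv_apply (analyticAt_fst_comp hf)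
  have h1 := analyticAt_fderiv_apply (analyticAt_snd_comp hf)
  exact (((h0 _).mul (h1 _)).sub ((h0 _).mul (h1 _))).congr (jac_eventuallyEq hf)

theorem taylorSeries_jac (hf : AnalyticAt ℂ f 0) :
    taylorSeries (jac f) = formalJac (toFormal f) := by
  have h0 := analyticAt_fst_comp hf
  have h1 := analyticAt_snd_comp hf
  have e := fun {k : ℂ × ℂ → ℂ} (hk : AnalyticAt ℂ k 0) v =>
    hasExpansion_taylorSeries (analyticAt_fderiv_apply hk v)
  refine HasExpansion.eq_taylorSeries (analyticAt_jac hf)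
    (HasExpansion.congr ?_ (jac_eventuallyEq hf))
  have := ((e h0 (1, 0)).mul (e h1 (0, 1))).sub ((e h0 (0, 1)).mul (e h1 (1, 0)))
  rwa [taylorSeries_fderiv_zero h0, taylorSeries_fderiv_one h0, taylorSeries_fderiv_zero h1,
    taylorSeries_fderiv_one h1] at this

theorem det_linPart_toFormal (hf : AnalyticAt ℂ f 0) : (linPart (toFormal f)).det = jac f 0 := by
  rw [← constantCoeff_formalJac, ← taylorSeries_jac hf, constantCoeff_taylorSeries]

theorem trace_linPart_toFormal (hf : AnalyticAt ℂ f 0) :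
    (linPart (toFormal f)).trace = (fderiv ℂ f 0 (1, 0)).1 + (fderiv ℂ f 0 (0, 1)).2 := by
  have hd := hf.differentiableAt
  rw [Matrix.trace_fin_two, linPart_apply, linPart_apply, ← constantCoeff_pderiv,
    ← constantCoeff_pderiv]
  change constantCoeff (pderiv ℂ 0 (taylorSeries _)) +
    constantCoeff (pderiv ℂ 1 (taylorSeries _)) = _
  rw [← taylorSeries_fderiv_zero (analyticAt_fst_comp hf),
    ← taylorSeries_fderiv_one (analyticAt_snd_comp hf), constantCoeff_taylorSeries,
    constantCoeff_taylorSeries, fderiv_fst_comp hd, fderiv_snd_comp hd]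

theorem det_eq_zero_of_mem_spectrum {A : ℂ × ℂ →L[ℂ] ℂ × ℂ} {μ : ℂ} (h : μ ∈ spectrum ℂ A) :
    (μ • (1 : ℂ × ℂ →L[ℂ] ℂ × ℂ) - A).det = 0 := by
  by_contra hne
  refine h ?_
  rw [spectrum.mem_resolventSet_iff, Algebra.algebraMap_eq_smul_one]
  exact ⟨(ContinuousLinearEquiv.unitsEquiv ℂ (ℂ × ℂ)).symm
    (ContinuousLinearMap.toContinuousLinearEquivOfDetNeZero _ hne), rfl⟩

/-- The linear part of a semi-superattracting germ has determinant zero and trace `lam`. -/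
theorem IsSemiSuperattracting.det_trace {lam : ℂ} (h : IsSemiSuperattracting f lam)
    (hf : AnalyticAt ℂ f 0) :
    (linPart (toFormal f)).det = 0 ∧ (linPart (toFormal f)).trace = lam := by
  obtain ⟨hlam, hspec⟩ := h
  have h0 := det_eq_zero_of_mem_spectrum (A := fderiv ℂ f 0) (μ := 0) (by rw [hspec]; simp)
  have h1 := det_eq_zero_of_mem_spectrum (A := fderiv ℂ f 0) (μ := lam) (by rw [hspec]; simp)
  rw [det_linPart_toFormal hf, trace_linPart_toFormal hf, jac]
  rw [det_eq] at *
  simp at h0 h1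
  refine ⟨by linear_combination h0, ?_⟩
  refine mul_left_cancel₀ hlam ?_
  linear_combination h0 - h1

theorem jac_comp (hg : DifferentiableAt ℂ g (f p)) (hf : DifferentiableAt ℂ f p) :
    jac (g ∘ f) p = jac g (f p) * jac f p := by
  rw [jac, fderiv_comp p hg hf]
  exact LinearMap.det_comp _ _

theorem IsLocalCoord.isFormalCoord (hψ : IsLocalCoord ψ) : IsFormalCoord (toFormal ψ) :=
  isFormalCoord_iff.2 ⟨isCentered_toFormal hψ.map_zero,
    by rw [det_linPart_toFormal hψ.analyticAt]; exact hψ.jac_ne_zero⟩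

theorem IsLocalCoord.exists_inverse (hψ : IsLocalCoord ψ) :
    ∃ χ, IsLocalCoord χ ∧ (∀ᶠ p in 𝓝 0, χ (ψ p) = p) ∧ ∀ᶠ p in 𝓝 0, ψ (χ p) = p := by
  have hc : ContDiffAt ℂ ω ψ 0 := hψ.analyticAt.contDiffAt
  let A := ContinuousLinearMap.toContinuousLinearEquivOfDetNeZero (fderiv ℂ ψ 0) hψ.jac_ne_zero
  have hd : HasFDerivAt ψ (A : ℂ × ℂ →L[ℂ] ℂ × ℂ) 0 :=
    hψ.analyticAt.differentiableAt.hasFDerivAt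
  have hs := hc.hasStrictFDerivAt' hd (by simp)
  set χ := hs.localInverse ψ A 0 with hχ
  have hanal : AnalyticAt ℂ χ 0 := by
    have := hc.to_localInverse hd (by simp)
    rw [hψ.map_zero] at this
    exact this.analyticAt
  have hleft : ∀ᶠ p in 𝓝 0, χ (ψ p) = p := hs.eventually_left_inverse
  have hright : ∀ᶠ p in 𝓝 0, ψ (χ p) = p := hψ.map_zero ▸ hs.eventually_right_inverse
  have h0 : χ 0 = 0 := by simpa [hψ.map_zero] using hleft.self_of_nhds
  refine ⟨χ, ⟨hanal, h0, fun hj => ?_⟩, hleft, hright⟩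
  have h1 : jac (ψ ∘ χ) 0 = 1 := by
    rw [jac, (show ψ ∘ χ =ᶠ[𝓝 0] id from hright).fderiv_eq, fderiv_id]
    simp [ContinuousLinearMap.det]
  rw [jac_comp (h0.symm ▸ hψ.analyticAt.differentiableAt) hanal.differentiableAt, hj,
    mul_zero] at h1
  exact zero_ne_one h1

end RigidGerm

namespace RigidGerm
open MvPowerSeries

/-! ### Rigid germs in adapted coordinates -/

variable {f g : ℂ × ℂ → ℂ × ℂ} {lam : ℂ} {F : FormalMap}

/-- In the coordinates in which the generalized critical set is the curve `W`, the critical set is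
contained in `W`, and `W` is totally invariant. -/
structure IsAdapted (g : ℂ × ℂ → ℂ × ℂ) (W : Set (ℂ × ℂ)) : Prop where
  holomorphic : IsHolomorphicGerm g
  crit : ∀ᶠ p in 𝓝 (0 : ℂ × ℂ), jac g p = 0 → p ∈ W
  backward : ∀ᶠ p in 𝓝 (0 : ℂ × ℂ), g p ∈ W → p ∈ W
  forward : ∀ᶠ p in 𝓝 (0 : ℂ × ℂ), p ∈ W → g p ∈ W

theorem IsHolomorphicGerm.tendsto (hf : IsHolomorphicGerm f) : Tendsto f (𝓝 0) (𝓝 0) := by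
  have := hf.analyticAt.continuousAt.tendsto
  rwa [hf.map_zero] at this

/-- The generalized critical set is backward invariant: it is covered by finitely many of the
preimages of the critical set and contains the next ones. -/
theorem IsGenCritSet.backward {V : Set (ℂ × ℂ)} (hV : IsGenCritSet f V)
    (hf : IsHolomorphicGerm f) : ∀ᶠ p in 𝓝 (0 : ℂ × ℂ), f p ∈ V → p ∈ V := by
  obtain ⟨h, N, hN⟩ := hV
  have hall : ∀ᶠ p in 𝓝 (0 : ℂ × ℂ), ∀ n ∈ Finset.range (N + 2), f^[n] p ∈ critSet f → p ∈ V :=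
    (Finset.eventually_all _).2 fun n _ => h n
  filter_upwards [hall, hf.tendsto.eventually hN] with p hp hNp hfp
  obtain ⟨n, hn, hmem⟩ := Set.mem_iUnion₂.1 (hNp hfp)
  exact hp (n + 1) (by simpa using hn) hmem

/-- Straightening the generalized critical set. -/
theorem exists_isAdapted (hf : IsHolomorphicGerm f) {V W : Set (ℂ × ℂ)} (hV : IsGenCritSet f V)
    (hfV : ∀ᶠ p in 𝓝 (0 : ℂ × ℂ), p ∈ V → f p ∈ V) {ψ : ℂ × ℂ → ℂ × ℂ} (hψ : IsLocalCoord ψ)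
    (hVW : V =ᶠ[𝓝 0] ψ ⁻¹' W) :
    ∃ g, IsAdapted g W ∧ FormallyConj (toFormal f) (toFormal g) := by
  obtain ⟨χ, hχ, hleft, hright⟩ := hψ.exists_inverse
  have hχg : IsHolomorphicGerm χ := ⟨hχ.analyticAt, hχ.map_zero⟩
  have hψg : IsHolomorphicGerm ψ := ⟨hψ.analyticAt, hψ.map_zero⟩
  have hfχ : AnalyticAt ℂ (f ∘ χ) 0 := analyticAt_comp_zero hf.analyticAt hχ.analyticAt hχ.map_zero
  have hfχ0 : (f ∘ χ) 0 = 0 := by simp [hχ.map_zero, hf.map_zero]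
  have hg : IsHolomorphicGerm (ψ ∘ f ∘ χ) :=
    ⟨analyticAt_comp_zero hψ.analyticAt hfχ hfχ0, by simp [hχ.map_zero, hf.map_zero, hψ.map_zero]⟩
  have hVW' : ∀ᶠ p in 𝓝 (0 : ℂ × ℂ), p ∈ V ↔ ψ p ∈ W := hVW.mem_iff
  refine ⟨ψ ∘ f ∘ χ, ⟨hg, ?_, ?_, ?_⟩, toFormal ψ, hψ.isFormalCoord, ?_⟩
  · have hjψ : ∀ᶠ p in 𝓝 (0 : ℂ × ℂ), jac ψ p ≠ 0 :=
      (analyticAt_jac hψ.analyticAt).continuousAt.eventually_ne hψ.jac_ne_zero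
    have hjχ : ∀ᶠ p in 𝓝 (0 : ℂ × ℂ), jac χ p ≠ 0 :=
      (analyticAt_jac hχ.analyticAt).continuousAt.eventually_ne hχ.jac_ne_zero
    have hfχt := hf.tendsto.comp hχg.tendsto
    filter_upwards [hχg.tendsto.eventually (hV.1 0), hχg.tendsto.eventually hVW', hright,
      hfχt.eventually hjψ, hjχ, hfχt.eventually hψ.analyticAt.eventually_analyticAt,
      hχg.tendsto.eventually hf.analyticAt.eventually_analyticAt,
      hχ.analyticAt.eventually_analyticAt] with p h1 h2 h3 h4 h5 h6 h7 h8 hjac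
    have hd := h7.differentiableAt.comp p h8.differentiableAt
    rw [jac_comp h6.differentiableAt hd, jac_comp h7.differentiableAt h8.differentiableAt] at hjac
    have : jac f (χ p) = 0 := by
      rcases mul_eq_zero.1 hjac with h | h
      · exact absurd h h4
      · exact (mul_eq_zero.1 h).resolve_right h5
    rw [← h3]
    exact h2.1 (h1 this)
  · filter_upwards [hχg.tendsto.eventually (hV.backward hf), hχg.tendsto.eventually hVW', hright,
      (hf.tendsto.comp hχg.tendsto).eventually hVW'] with p h1 h2 h3 h4 hp
    rw [← h3]
    exact h2.1 (h1 (h4.2 hp))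
  · filter_upwards [hχg.tendsto.eventually hfV, hχg.tendsto.eventually hVW', hright,
      (hf.tendsto.comp hχg.tendsto).eventually hVW'] with p h1 h2 h3 h4 hp
    rw [← h3] at hp
    exact h4.1 (h1 (h2.2 hp))
  · rw [← toFormal_comp hψ.analyticAt hf.analyticAt hf.map_zero,
      ← toFormal_comp hg.analyticAt hψ.analyticAt hψ.map_zero]
    refine toFormal_congr (analyticAt_comp_zero hψ.analyticAt hf.analyticAt hf.map_zero) ?_
    filter_upwards [hleft] with p hp
    simp [hp]

/-- Exchanging the two coordinates conjugates `F` to a map with the roles of the axes reversed. -/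
theorem exists_swap (hF : F.IsCentered) : ∃ E, E.IsCentered ∧ FormallyConj F E ∧
    (linPart E 0 0 = linPart F 1 1 ∧ linPart E 0 1 = linPart F 1 0 ∧
      linPart E 1 0 = linPart F 0 1 ∧ linPart E 1 1 = linPart F 0 0) ∧
    (∀ a b, Associated (X 0 ^ a * X 1 ^ b) (formalJac F) →
      Associated (X 0 ^ b * X 1 ^ a) (formalJac E)) ∧
    (X 0 ∣ F 0 → X 1 ∣ E 1) ∧ (X 1 ∣ F 1 → X 0 ∣ E 0) := by
  set σ : FormalMap := ![X 1, X 0] with hσ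
  have hσc : IsFormalCoord σ := isFormalCoord_vec (by simp) (by simp)
    (by simp [coeff_X, Finsupp.single_left_inj])
  obtain ⟨E, hE, h⟩ := hσc.exists_comp_eq hF
  have hs := hσc.isCentered.hasSubst
  have hX0 : subst σ (X 0 : Series) = X 1 := subst_X hs 0
  have hX1 : subst σ (X 1 : Series) = X 0 := subst_X hs 1
  have hσσ : σ.comp σ = X := by
    funext i
    fin_cases i
    exacts [hX1, hX0]
  have hinv : ∀ s : Series, subst σ (subst σ s) = s := fun s => by
    rw [subst_subst hσc.isCentered hσc.isCentered, hσσ, subst_X_eq]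
  have hdvd : ∀ {s t : Series}, s ∣ t → subst σ s ∣ subst σ t := by
    rintro s _ ⟨c, rfl⟩
    rw [subst_mul hs]
    exact dvd_mul_right _ _
  have hE0 : E 0 = subst σ (F 1) := by
    rw [← hinv (E 0)]
    congr 1
    have := congrFun h 0
    simpa [FormalMap.comp, hσ, subst_X hF.hasSubst] using this.symm
  have hE1 : E 1 = subst σ (F 0) := by
    rw [← hinv (E 1)]
    congr 1
    have := congrFun h 1
    simpa [FormalMap.comp, hσ, subst_X hF.hasSubst] using this.symm
  have hlin := linPart_mul_of_comp_eq hσc.isCentered hF h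
  have hentry : ∀ i j, (linPart σ * linPart F) i j = (linPart E * linPart σ) i j := fun i j => by
    rw [hlin]
  have hσl : linPart σ = !![0, 1; 1, 0] := by
    ext i j
    fin_cases i <;> fin_cases j <;>
      simp [linPart_apply, hσ, coeff_X, Finsupp.single_left_inj]
  simp only [hσl, Matrix.mul_apply, Fin.sum_univ_two] at hentry
  refine ⟨E, hE, ⟨σ, hσc, h⟩, ⟨?_, ?_, ?_, ?_⟩, fun a b hab => ?_, fun h0 => ?_, fun h1 => ?_⟩
  · simpa using (hentry 0 1).symm
  · simpa using (hentry 0 0).symm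
  · simpa using (hentry 1 1).symm
  · simpa using (hentry 1 0).symm
  · have h1 := hab.trans (subst_formalJac_associated hσc hF h).symm
    obtain ⟨u, hu⟩ := h1
    have h2 := congrArg (subst σ) hu
    rw [hinv, subst_mul hs, subst_mul hs, subst_pow hs, subst_pow hs, hX0, hX1] at h2
    rw [← h2, mul_comm (X 0 ^ b)]
    exact (associated_mul_unit_right _ _ (isUnit_subst hσc.isCentered u.isUnit))
  · rw [hE1, ← hX0]
    exact hdvd h0
  · rw [hE0, ← hX1]
    exact hdvd h1

/-- If the critical curves are invariant axes, the coordinates can be ordered in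
such a way that the first one belongs to the non-zero eigenvalue. -/
theorem exists_hasMonomialJac_of_dvd (hF : F.IsCentered) (hdet : (linPart F).det = 0)
    (htr : (linPart F).trace = lam) {a b : ℕ}
    (hjac : Associated (X 0 ^ a * X 1 ^ b) (formalJac F)) (h0 : 1 ≤ a → X 0 ∣ F 0)
    (h1 : 1 ≤ b → X 1 ∣ F 1) :
    ∃ a b E, 1 ≤ a + b ∧ HasMonomialJac lam a b E ∧ FormallyConj F E := by
  have hab : 1 ≤ a + b := by
    by_contra hlt
    obtain ⟨rfl, rfl⟩ : a = 0 ∧ b = 0 := by omega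
    rw [pow_zero, pow_zero, mul_one] at hjac
    have := isUnit_iff_ne.1 (hjac.isUnit isUnit_one)
    rw [constantCoeff_formalJac, hdet] at this
    exact this rfl
  have hcoeff : ∀ {i j : Fin 2} {s : Series}, i ≠ j → X j ∣ s → coeff (Finsupp.single i 1) s = 0 :=
    fun hij h => X_dvd_iff.1 h _ (by simp [hij])
  have hmul : linPart F 0 1 * linPart F 1 0 = 0 := by
    rcases Nat.eq_zero_or_pos a with ha | ha
    · rw [linPart_apply F 1 0, hcoeff (by decide) (h1 (by omega)), mul_zero]
    · rw [linPart_apply F 0 1, hcoeff (by decide) (h0 ha), zero_mul]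
  rw [Matrix.det_fin_two, hmul, sub_zero] at hdet
  rw [Matrix.trace_fin_two] at htr
  rcases mul_eq_zero.1 hdet with hz | hz
  · obtain ⟨E, hE, hconj, ⟨l00, l01, l10, l11⟩, hj, hd0, hd1⟩ := exists_swap hF
    refine ⟨b, a, E, by omega, ⟨hE, ?_, ?_, ?_, hj a b hjac, fun h => hd1 (h1 h),
      fun h => hd0 (h0 h)⟩, hconj⟩
    · rw [l00, ← htr, hz, zero_add]
    · rw [l11, hz]
    · rw [l01, l10, mul_comm, hmul]
  · exact ⟨a, b, F, hab, ⟨hF, by rw [← htr, hz, add_zero], hz, hmul, hjac, h0, h1⟩, X,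
      isFormalCoord_iff.2 ⟨isCentered_X, by rw [← linMap_one, linPart_linMap]; simp⟩, by
        funext i
        simp only [FormalMap.comp, subst_X_eq]
        exact subst_X hF.hasSubst i⟩

/-- A power series that is a monomial up to a unit is divisible by the variables that occur in its
linear part. -/
theorem X_dvd_of_eq_monomial {s u : Series} {a b : ℕ} (hu : IsUnit u)
    (hs : s = X 0 ^ a * X 1 ^ b * u) (h0 : constantCoeff s = 0) {i : Fin 2}
    (hi : coeff (Finsupp.single i 1) s ≠ 0) : X i ∣ s := by
  have key : ∀ (j : Fin 2) (n : ℕ), X j ^ n ∣ s → 1 ≤ n → X i ∣ s := fun j n hn hn1 => by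
    have hj : X j ∣ s := (dvd_pow_self _ (by omega)).trans hn
    by_cases hij : i = j
    · rwa [hij]
    · exact absurd (X_dvd_iff.1 hj _ (by simp [hij])) hi
  rcases Nat.eq_zero_or_pos a with ha | ha
  · rcases Nat.eq_zero_or_pos b with hb | hb
    · rw [hs, ha, hb, pow_zero, pow_zero, one_mul, one_mul] at h0
      exact absurd h0 (isUnit_iff_ne.1 hu)
    · exact key 1 b (hs ▸ (dvd_mul_left _ _).mul_right _) hb
  · exact key 0 a (hs ▸ (dvd_mul_right _ _).mul_right _) ha

/-- The variables are prime: division by a variable is detected by restriction to an axis. -/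
theorem X_dvd_or_dvd {i : Fin 2} {s t : Series} (h : X i ∣ s * t) : X i ∣ s ∨ X i ∣ t := by
  have key : ∀ N : FormalMap, N.IsCentered → subst N (X i : Series) = 0 →
      subst N s = 0 ∨ subst N t = 0 := fun N hN hi => by
    obtain ⟨c, hc⟩ := h
    rw [← mul_eq_zero, ← subst_mul hN.hasSubst, hc, subst_mul hN.hasSubst, hi, zero_mul]
  rcases Fin.exists_fin_two.1 ⟨i, rfl⟩ with rfl | rfl
  · have hN : FormalMap.IsCentered ![0, X 1] := isCentered_vec (by simp) (by simp)
    exact (key _ hN (subst_X hN.hasSubst 0)).imp X_zero_dvd_of_subst_eq_zero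
      X_zero_dvd_of_subst_eq_zero
  · have hN : FormalMap.IsCentered ![X 0, 0] := isCentered_vec (by simp) (by simp)
    exact (key _ hN (subst_X hN.hasSubst 1)).imp X_one_dvd_of_subst_eq_zero
      X_one_dvd_of_subst_eq_zero

/-- If the generalized critical set is `{x = 0}`, no power of `y` divides the Jacobian determinant,
and the axis is preserved. -/
theorem IsAdapted.exists_hasMonomialJac_of_line (hg : IsAdapted g {p | p.1 = 0})
    (hdet : (linPart (toFormal g)).det = 0) (htr : (linPart (toFormal g)).trace = lam) :
    ∃ a b E, 1 ≤ a + b ∧ HasMonomialJac lam a b E ∧ FormallyConj (toFormal g) E := by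
  have hga := hg.holomorphic.analyticAt
  have hc := isCentered_toFormal hg.holomorphic.map_zero
  obtain ⟨a, b, u, hu, hjac, hb⟩ := exists_taylorSeries_eq_monomial_mul (analyticAt_jac hga)
    (hg.crit.mono fun p hp h => by rw [show p.1 = 0 from hp h, zero_mul])
  have hb0 : ¬1 ≤ b := fun h1 => by
    obtain ⟨δ, hδ, hball⟩ := Metric.nhds_basis_closedBall.eventually_iff.1 (hg.crit.and (hb h1))
    obtain ⟨h2, h3⟩ := hball (x := ((δ : ℂ), 0)) (by simp [abs_of_pos hδ, hδ.le])
    have : (δ : ℂ) = 0 := h2 (h3 rfl)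
    exact hδ.ne' (by exact_mod_cast this)
  rw [taylorSeries_jac hga] at hjac
  refine exists_hasMonomialJac_of_dvd hc hdet htr (a := a) (b := b)
    (hjac ▸ associated_mul_unit_right _ _ hu) (fun _ => ?_) fun h => absurd h hb0
  exact X_zero_dvd_taylorSeries (analyticAt_fst_comp hga) hg.forward

/-- If the generalized critical set is `{x y = 0}`, the non-zero eigenvalue forces each axis to be
preserved. -/
theorem IsAdapted.exists_hasMonomialJac_of_cross (hlam : lam ≠ 0)
    (hg : IsAdapted g {p | p.1 * p.2 = 0})
    (hdet : (linPart (toFormal g)).det = 0) (htr : (linPart (toFormal g)).trace = lam) :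
    ∃ a b E, 1 ≤ a + b ∧ HasMonomialJac lam a b E ∧ FormallyConj (toFormal g) E := by
  have hga := hg.holomorphic.analyticAt
  have hg0 := analyticAt_fst_comp hga
  have hg1 := analyticAt_snd_comp hga
  have hc := isCentered_toFormal hg.holomorphic.map_zero
  obtain ⟨a, b, u, hu, hjac, -⟩ := exists_taylorSeries_eq_monomial_mul (analyticAt_jac hga) hg.crit
  rw [taylorSeries_jac hga] at hjac
  have hgg : taylorSeries (fun p => (g p).1 * (g p).2) = toFormal g 0 * toFormal g 1 :=
    HasExpansion.eq_taylorSeries (hg0.mul hg1)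
      ((hasExpansion_taylorSeries hg0).mul (hasExpansion_taylorSeries hg1))
  have hx : X 0 ∣ toFormal g 0 * toFormal g 1 :=
    hgg ▸ X_zero_dvd_taylorSeries (hg0.mul hg1)
      (hg.forward.mono fun p hp h => hp (show p.1 * p.2 = 0 by rw [h, zero_mul]))
  have hy : X 1 ∣ toFormal g 0 * toFormal g 1 :=
    hgg ▸ X_one_dvd_taylorSeries (hg0.mul hg1)
      (hg.forward.mono fun p hp h => hp (show p.1 * p.2 = 0 by rw [h, mul_zero]))
  have hlin : ∀ {i j k : Fin 2}, i ≠ j → X j ∣ toFormal g k → linPart (toFormal g) k i = 0 :=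
    fun hij h => X_dvd_iff.1 h _ (by simp [hij])
  rw [Matrix.trace_fin_two] at htr
  -- the components vanish on the preimage of the axes only, so they are monomials up to units
  obtain ⟨i, j, v, hv, h0, -⟩ := exists_taylorSeries_eq_monomial_mul hg0
    (hg.backward.mono fun p hp h => hp (show (g p).1 * (g p).2 = 0 by rw [h, zero_mul]))
  obtain ⟨k, l, w, hw, h1, -⟩ := exists_taylorSeries_eq_monomial_mul hg1
    (hg.backward.mono fun p hp h => hp (show (g p).1 * (g p).2 = 0 by rw [h, mul_zero]))
  have hdvd : X 0 ∣ toFormal g 0 ∧ X 1 ∣ toFormal g 1 := by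
    rcases X_dvd_or_dvd hx with hx0 | hx1
    · refine ⟨hx0, ?_⟩
      rcases X_dvd_or_dvd hy with hy0 | hy1
      · refine X_dvd_of_eq_monomial hw h1 (hc 1) ?_
        rw [hlin (by decide) hy0, zero_add] at htr
        exact fun h => hlam (htr.symm.trans h)
      · exact hy1
    · rcases X_dvd_or_dvd hy with hy0 | hy1
      · rw [hlin (by decide) hy0, hlin (by decide) hx1, zero_add] at htr
        exact absurd htr.symm hlam
      · refine ⟨X_dvd_of_eq_monomial hv h0 (hc 0) ?_, hy1⟩
        rw [hlin (by decide) hx1, add_zero] at htr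
        exact fun h => hlam (htr.symm.trans h)
  exact exists_hasMonomialJac_of_dvd hc hdet (by rw [Matrix.trace_fin_two, htr]) (a := a) (b := b)
    (hjac ▸ associated_mul_unit_right _ _ hu) (fun _ => hdvd.1) fun _ => hdvd.2

/-- A rigid semi-superattracting germ is formally conjugate to a map with monomial Jacobian
determinant, in coordinates adapted to the non-zero eigenvalue. -/
theorem IsRigid.exists_hasMonomialJac (hf : IsRigid f) (hlam : IsSemiSuperattracting f lam) :
    ∃ a b E, 1 ≤ a + b ∧ HasMonomialJac lam a b E ∧ FormallyConj (toFormal f) E := by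
  have hfh := hf.holomorphic
  have hfc := isCentered_toFormal hfh.map_zero
  obtain ⟨hdet, htr⟩ := hlam.det_trace hfh.analyticAt
  obtain ⟨V, hV, hnc, hfV⟩ := hf.genCritSet
  -- the determinant and the trace of the linear part are invariant under conjugation
  have hinv : ∀ {g : ℂ × ℂ → ℂ × ℂ}, FormallyConj (toFormal f) (toFormal g) →
      (linPart (toFormal g)).det = 0 ∧ (linPart (toFormal g)).trace = lam := by
    rintro g ⟨Φ, hΦ, h⟩
    have hl := linPart_mul_of_comp_eq hΦ.isCentered hfc h
    have hu : IsUnit (linPart Φ).det := (isFormalCoord_iff.1 hΦ).2.isUnit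
    have hg : linPart (toFormal g) = linPart Φ * linPart (toFormal f) * (linPart Φ)⁻¹ := by
      rw [hl, Matrix.mul_nonsing_inv_cancel_right _ _ hu]
    constructor
    · rw [hg, Matrix.det_mul, Matrix.det_mul, hdet, mul_zero, zero_mul]
    · rw [hg, Matrix.trace_mul_comm, ← mul_assoc, Matrix.nonsing_inv_mul _ hu, one_mul, htr]
  rcases hnc with hempty | ⟨ψ, hψ, hline | hcross⟩
  · have h0 : (0 : ℂ × ℂ) ∈ V := (hV.1 0).self_of_nhds (by
      change jac f 0 = 0
      rw [← det_linPart_toFormal hfh.analyticAt, hdet])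
    exact absurd (hempty.mem_iff.self_of_nhds.1 h0) (Set.notMem_empty _)
  · obtain ⟨g, hg, hconj⟩ := exists_isAdapted hfh hV hfV hψ (W := {p | p.1 = 0}) hline
    obtain ⟨a, b, E, hab, hE, hconj'⟩ :=
      hg.exists_hasMonomialJac_of_line (hinv hconj).1 (hinv hconj).2
    exact ⟨a, b, E, hab, hE, hconj.trans hfc (isCentered_toFormal hg.holomorphic.map_zero) hconj'⟩
  · obtain ⟨g, hg, hconj⟩ := exists_isAdapted hfh hV hfV hψ (W := {p | p.1 * p.2 = 0}) hcross
    obtain ⟨a, b, E, hab, hE, hconj'⟩ :=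
      hg.exists_hasMonomialJac_of_cross hlam.1 (hinv hconj).1 (hinv hconj).2
    exact ⟨a, b, E, hab, hE, hconj.trans hfc (isCentered_toFormal hg.holomorphic.map_zero) hconj'⟩

end RigidGerm

namespace RigidGerm
open MvPowerSeries

/-! ### Arithmetic of the eigenvalue -/

theorem eq_one_of_pow_eq_self {lam : ℂ} (hlam : lam ≠ 0) (h : ∀ m : ℕ, lam ^ m = 1 → m = 0) (n : ℕ)
    (hn : n ≠ 0) (hlamn : lam ^ n = lam) : n = 1 := by
  have : lam ^ (n - 1) = 1 := by
    refine mul_right_cancel₀ hlam ?_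
    rw [← pow_succ, Nat.sub_add_cancel (Nat.one_le_iff_ne_zero.2 hn), hlamn, one_mul]
  have := h _ this
  omega

theorem eq_zero_of_pow_eq_one_of_norm_ne {lam : ℂ} (h : ‖lam‖ ≠ 1) (m : ℕ) (hm : lam ^ m = 1) :
    m = 0 := by
  by_contra hne
  refine h ((pow_eq_one_iff_of_nonneg (norm_nonneg lam) hne).1 ?_)
  rw [← norm_pow, hm, norm_one]

theorem eq_zero_of_pow_eq_one_of_irrational {θ : ℝ} (hθ : Irrational θ) (m : ℕ)
    (hm : Complex.exp (2 * Real.pi * Complex.I * θ) ^ m = 1) : m = 0 := by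
  rw [← Complex.exp_nat_mul, Complex.exp_eq_one_iff] at hm
  obtain ⟨n, hn⟩ := hm
  by_contra hne
  refine (hθ.natCast_mul hne).ne_int n ?_
  have : ((m * θ : ℝ) : ℂ) = ((n : ℝ) : ℂ) := by
    refine mul_right_cancel₀ Complex.two_pi_I_ne_zero ?_
    push_cast
    linear_combination hn
  exact_mod_cast this

theorem norm_exp_two_pi_I_mul (θ : ℝ) : ‖Complex.exp (2 * Real.pi * Complex.I * θ)‖ = 1 := by
  rw [show (2 * Real.pi * Complex.I * θ : ℂ) = ((2 * Real.pi * θ : ℝ) : ℂ) * Complex.I by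
    push_cast; ring]
  exact Complex.norm_exp_ofReal_mul_I _

end RigidGerm
end

theorem mainTheorem3 (f : ℂ × ℂ → ℂ × ℂ) (lam : ℂ)
    (hf : RigidGerm.IsRigid f) (hlam : RigidGerm.IsSemiSuperattracting f lam) :
    -- attracting case, or irrational rotation
    ((‖lam‖ < 1 ∨ ∃ θ : ℝ, Irrational θ ∧ lam = Complex.exp (2 * Real.pi * Complex.I * θ)) →
      ∃ c d : ℕ, 1 ≤ d ∧ 2 ≤ c + d ∧
        RigidGerm.FormallyConj (RigidGerm.toFormal f)
          ![RigidGerm.const lam * RigidGerm.zVar, RigidGerm.zVar ^ c * RigidGerm.wVar ^ d]) ∧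
    -- repelling case
    (1 < ‖lam‖ →
      ∃ c d : ℕ, 1 ≤ d ∧ 2 ≤ c + d ∧
        ∃ (l : ℕ) (ε : ℂ), 1 ≤ l ∧ (ε = 0 ∨ (ε = 1 ∧ lam ^ l = d)) ∧
          RigidGerm.FormallyConj (RigidGerm.toFormal f)
            ![RigidGerm.const lam * RigidGerm.zVar,
              RigidGerm.zVar ^ c * RigidGerm.wVar ^ d *
                (1 + RigidGerm.const ε * RigidGerm.zVar ^ l)]) ∧
    -- `lam` is a root of unity of exact order `r`
    (∀ r : ℕ, 0 < r → IsPrimitiveRoot lam r →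
      ∃ c d : ℕ, 1 ≤ d ∧ 2 ≤ c + d ∧
        ∃ ε : PowerSeries ℂ, PowerSeries.constantCoeff ε ≠ -1 ∧ (2 ≤ d → ε = 0) ∧
          ((∃ (s : ℕ) (β : ℂ), 1 ≤ s ∧ r ∣ s ∧
            RigidGerm.FormallyConj (RigidGerm.toFormal f)
              ![RigidGerm.const lam * RigidGerm.zVar *
                  (1 + RigidGerm.zVar ^ s + RigidGerm.const β * RigidGerm.zVar ^ (2 * s)),
                RigidGerm.zVar ^ c * RigidGerm.wVar ^ d *
                  (1 + PowerSeries.subst (RigidGerm.zVar ^ r) ε)]) ∨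
           RigidGerm.FormallyConj (RigidGerm.toFormal f)
              ![RigidGerm.const lam * RigidGerm.zVar,
                RigidGerm.zVar ^ c * RigidGerm.wVar ^ d *
                  (1 + PowerSeries.subst (RigidGerm.zVar ^ r) ε)])) := by
  open RigidGerm in
  obtain ⟨a, b, E, hab, hE, hconj⟩ := hf.exists_hasMonomialJac hlam
  have hlam0 := hlam.1
  obtain ⟨G, v, hG, hlin, hres, hv, hG1, hconj'⟩ := hE.exists_monomial_form hlam0
  have hfc := isCentered_toFormal hf.holomorphic.map_zero
  have hfG : FormallyConj (toFormal f) G := hconj.trans hfc hE.isCentered hconj'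
  have hd : 1 ≤ b + 1 := Nat.le_add_left 1 b
  have hcd : 2 ≤ a + (b + 1) := by omega
  have hlinear : (∀ m : ℕ, lam ^ m = 1 → m = 0) → G 0 = MvPowerSeries.C lam * MvPowerSeries.X 0 :=
    fun h => eq_C_mul_X_of_resonant hG hlin hres (eq_one_of_pow_eq_self hlam0 h)
  refine ⟨fun h => ⟨a, b + 1, hd, hcd, ?_⟩, fun h => ⟨a, b + 1, hd, hcd, ?_⟩,
    fun r hr hroot => ⟨a, b + 1, hd, hcd, ?_⟩⟩
  · obtain ⟨hle, hone⟩ : ‖lam‖ ≤ 1 ∧ ∀ m : ℕ, lam ^ m = 1 → m = 0 := by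
      rcases h with h | ⟨θ, hθ, rfl⟩
      · exact ⟨h.le, eq_zero_of_pow_eq_one_of_norm_ne h.ne⟩
      · exact ⟨(norm_exp_two_pi_I_mul θ).le, eq_zero_of_pow_eq_one_of_irrational hθ⟩
    refine hfG.trans hfc hG
      (formallyConj_monomial hG hlin (hlinear hone) hd hcd hv hG1 fun n hn hlamn => hn (hone n ?_))
    have h1 : ((b + 1 : ℕ) : ℝ) ≤ 1 := by
      rw [← Complex.norm_natCast, ← hlamn, norm_pow]
      exact pow_le_one₀ (norm_nonneg _) hle
    have h2 : b + 1 = 1 := le_antisymm (by exact_mod_cast h1) hd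
    rw [hlamn, h2, Nat.cast_one]
  · have hone := eq_zero_of_pow_eq_one_of_norm_ne h.ne'
    by_cases hl : ∃ l : ℕ, 1 ≤ l ∧ lam ^ l = ((b + 1 : ℕ) : ℂ)
    · obtain ⟨l, hl1, hl⟩ := hl
      have hb : 2 ≤ b + 1 := by
        by_contra hlt
        have : b = 0 := by omega
        subst this
        have := hone l (by simpa using hl)
        omega
      have huniq : ∀ n : ℕ, lam ^ n = ((b + 1 : ℕ) : ℂ) → n = l := fun n hn => by
        refine (pow_right_injective₀ (norm_pos_iff.2 hlam0) h.ne') ?_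
        change ‖lam‖ ^ n = ‖lam‖ ^ l
        rw [← norm_pow, ← norm_pow, hn, hl]
      obtain ⟨ε, hε, hc⟩ := formallyConj_monomial_mul hG hlin (hlinear hone) hb hv hG1
        (Nat.one_le_iff_ne_zero.1 hl1) huniq
      exact ⟨l, ε, hl1, hε.imp_right fun h => ⟨h, hl⟩, hfG.trans hfc hG hc⟩
    · refine ⟨1, 0, le_rfl, Or.inl rfl, hfG.trans hfc hG ?_⟩
      have := formallyConj_monomial hG hlin (hlinear hone) hd hcd hv hG1 fun n hn hlamn =>
        hl ⟨n, Nat.one_le_iff_ne_zero.2 hn, hlamn⟩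
      simpa using this
  · obtain ⟨E', v', hE', hlin', hv', hE1, hGE, hform⟩ :=
      exists_parabolic_conj hr hroot hG hlin hres hcd hv hG1
    have hfE := hfG.trans hfc hG hGE
    obtain ⟨ε, hε, hεd, hg⟩ := formallyConj_root_of_unity hr hroot hE' hlin' hd hv' hE1
    refine ⟨ε, hε, hεd, ?_⟩
    rcases hform with ⟨s, β, hs, hrs, hE0⟩ | hE0
    · refine Or.inl ⟨s, β, hs, hrs, hfE.trans hfc hE' (hg _ hE0 fun Φ hΦ hΦ0 => ?_)⟩
      have hsub := hΦ.hasSubst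
      simp [MvPowerSeries.subst_mul hsub, MvPowerSeries.subst_add hsub,
        MvPowerSeries.subst_pow hsub, MvPowerSeries.subst_X hsub, hΦ0, hΦ.subst_one]
    · refine Or.inr (hfE.trans hfc hE' (hg _ hE0 fun Φ hΦ hΦ0 => ?_))
      have hsub := hΦ.hasSubst
      simp [MvPowerSeries.subst_mul hsub, MvPowerSeries.subst_X hsub, hΦ0]
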